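/- Consider on $\mathbb R$ the Cauchy problem $$m_t+2(u-u_{xx})_x\,m+(u-u_{xx})\,m_x=0,\qquad m=(1-\partial_x^2)^2u=u-2u_{xx}+u_{xxxx},\qquad u(\cdot,0)=u_0 .$$ For $u_0\in H^4(\mathbb R)$ and $0<T\le\infty$, a solution on $[0,T)$ is a real-valued function $u\in C([0,T);H^4(\mathbb R))\cap C^1([0,T);H^3(\mathbb R))$ with $u(\cdot,0)=u_0$ that satisfies the equation, for every $t\in[0,T)$, in the sense of distributions on $\mathbb R$ (with $2v_xm+vm_x$ read as $(vm)_x+v_xm$, where $v=u-u_{xx}$). It is maximal, with lifespan $T$, if it does not extend to a solution on $[0,T')$ for any $T'>T$. **Theorem.** Let $u_0\in H^4(\mathbb R)$ and $m_0=(1-\partial_x^2)^2u_0\in L^2(\mathbb R)$, and suppose that, for some $x_0\in\mathbb R$ and some representative of $m_0$, $$m_0(x_0)=0,\qquad \int_{-\infty}^{x_0}e^{x}m_0(x)\,dx>0,\qquad \int_{x_0}^{\infty}e^{-x}m_0(x)\,dx<0 .$$ Then the corresponding solution blows up in finite time: the Cauchy problem has a maximal solution, and for every maximal solution $u$ the lifespan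 $T$ is finite and $$\lim_{t\to T^-}\|u(\cdot,t)\|_{H^4(\mathbb R)}=\infty .$$ -/

import Mathlib

open MeasureTheory Filter Topology Set
open scoped ENNReal

namespace CHType

/-- The real Hilbert space `L²(ℝ)`. -/
abbrev L2 : Type := Lp ℝ 2 (volume : Measure ℝ)

/-- Smooth compactly supported real functions on the line. -/
def IsTestFunction (φ : ℝ → ℝ) : Prop :=
  ContDiff ℝ ((⊤ : ℕ∞) : WithTop ℕ∞) φ ∧ HasCompactSupport φ

/-- `g` is the weak (distributional) derivative of `f`. -/
def IsWeakDeriv (f g : L2) : Prop :=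
  ∀ φ : ℝ → ℝ, IsTestFunction φ → ∫ x, f x * deriv φ x = -∫ x, g x * φ x

theorem integrable_mul_of_continuous (f : L2) {φ : ℝ → ℝ} (hφ : Continuous φ)
    (hs : HasCompactSupport φ) : Integrable (fun x => f x * φ x) :=
  MemLp.integrable_mul (p := 2) (q := 2) (Lp.memLp f) (hφ.memLp_of_hasCompactSupport hs)

theorem IsTestFunction.integrable_mul (f : L2) {φ : ℝ → ℝ} (hφ : IsTestFunction φ) :
    Integrable (fun x => f x * φ x) :=
  integrable_mul_of_continuous f hφ.1.continuous hφ.2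

theorem IsTestFunction.integrable_mul_deriv (f : L2) {φ : ℝ → ℝ} (hφ : IsTestFunction φ) :
    Integrable (fun x => f x * deriv φ x) :=
  integrable_mul_of_continuous f (hφ.1.continuous_deriv (by exact_mod_cast le_top)) hφ.2.deriv

theorem isWeakDeriv_zero : IsWeakDeriv 0 0 := by
  intro φ _
  have h : ∀ ψ : ℝ → ℝ, ∫ x, (0 : L2) x * ψ x = 0 := by
    intro ψ
    have : (fun x => (0 : L2) x * ψ x) =ᵐ[volume] fun _ => (0 : ℝ) := by
      filter_upwards [Lp.coeFn_zero ℝ 2 (volume : Measure ℝ)] with x hx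
      rw [hx, Pi.zero_apply, zero_mul]
    rw [integral_congr_ae this, integral_zero]
  rw [h, h, neg_zero]

theorem IsWeakDeriv.add {f g f' g' : L2} (h : IsWeakDeriv f g) (h' : IsWeakDeriv f' g') :
    IsWeakDeriv (f + f') (g + g') := by
  intro φ hφ
  have e : ∀ (a b : L2) (ψ : ℝ → ℝ),
      (fun x => (a + b : L2) x * ψ x) =ᵐ[volume] fun x => a x * ψ x + b x * ψ x := by
    intro a b ψ
    filter_upwards [Lp.coeFn_add a b] with x hx
    rw [hx, Pi.add_apply, add_mul]
  rw [integral_congr_ae (e f f' _), integral_congr_ae (e g g' _),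
    integral_add (hφ.integrable_mul_deriv f) (hφ.integrable_mul_deriv f'),
    integral_add (hφ.integrable_mul g) (hφ.integrable_mul g'), h φ hφ, h' φ hφ]
  ring

theorem IsWeakDeriv.smul (c : ℝ) {f g : L2} (h : IsWeakDeriv f g) :
    IsWeakDeriv (c • f) (c • g) := by
  intro φ hφ
  have e : ∀ (a : L2) (ψ : ℝ → ℝ),
      (fun x => (c • a : L2) x * ψ x) =ᵐ[volume] fun x => c * (a x * ψ x) := by
    intro a ψ
    filter_upwards [Lp.coeFn_smul c a] with x hx
    rw [hx, Pi.smul_apply, smul_eq_mul, mul_assoc]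
  rw [integral_congr_ae (e f _), integral_congr_ae (e g _), integral_const_mul,
    integral_const_mul, h φ hφ]
  ring

/-- The Sobolev space `H^k(ℝ)` of real functions whose weak derivatives up to order `k` are in
`L²(ℝ)`. A function `f` is recorded together with its (unique) weak derivatives as the tuple
`(f, f', …, f^(k))`, so that the inherited norm is
`‖f‖_{H^k} = (∑ i ≤ k, ‖f^(i)‖_{L²}²)^{1/2}`. -/
def Sobolev (k : ℕ) : Submodule ℝ (PiLp 2 fun _ : Fin (k + 1) => L2) where
  carrier := {F | ∀ i : Fin k, IsWeakDeriv (F i.castSucc) (F i.succ)}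
  zero_mem' := fun _ => isWeakDeriv_zero
  add_mem' := fun hF hG i => (hF i).add (hG i)
  smul_mem' := fun c _ hF i => (hF i).smul c

/-- The weak derivative of order `i` of an element of `H^k(ℝ)`; order `0` is the function. -/
def wderiv {k : ℕ} (f : Sobolev k) (i : Fin (k + 1)) : L2 :=
  (f : PiLp 2 fun _ : Fin (k + 1) => L2) i

/-- The inclusion `H^(k+1)(ℝ) ⊆ H^k(ℝ)`. -/
def inclusion {k : ℕ} (f : Sobolev (k + 1)) : Sobolev k :=
  ⟨WithLp.toLp 2 fun i : Fin (k + 1) => wderiv f i.castSucc, fun i => f.2 i.castSucc⟩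

/-- `v = u - u_xx`. -/
noncomputable def velocity (u : Sobolev 4) : L2 := wderiv u 0 - wderiv u 2

/-- `v_x = u_x - u_xxx`. -/
noncomputable def velocityDeriv (u : Sobolev 4) : L2 := wderiv u 1 - wderiv u 3

/-- `m = (1 - ∂_x²)² u = u - 2 u_xx + u_xxxx`. -/
noncomputable def momentum (u : Sobolev 4) : L2 := wderiv u 0 - (2 : ℝ) • wderiv u 2 + wderiv u 4

/-- The equation `m_t + 2 v_x m + v m_x = 0` at one instant, where `u ∈ H⁴(ℝ)` is the state and
`w = u_t ∈ H³(ℝ)` its time derivative. Here `m_t = (1 - ∂_x²)² w` and `m_x` need not be functions,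
and the equation is understood in the sense of distributions on the line: `(1 - ∂_x²)²` is
moved to the test function, and `2 v_x m + v m_x` is the distribution `(v m)_x + v_x m`. -/
def SatisfiesEquation (u : Sobolev 4) (w : Sobolev 3) : Prop :=
  ∀ φ : ℝ → ℝ, IsTestFunction φ →
    (∫ x, wderiv w 0 x * (φ x - 2 * iteratedDeriv 2 φ x + iteratedDeriv 4 φ x))
      + ((-∫ x, velocity u x * momentum u x * deriv φ x)
        + ∫ x, velocityDeriv u x * momentum u x * φ x) = 0

/-- The real times in `[0, T)`, for `T` real or `+∞`. -/
def timeInterval (T : EReal) : Set ℝ := {t | 0 ≤ t ∧ (t : EReal) < T}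

/-- `u ∈ C([0,T); H⁴(ℝ)) ∩ C¹([0,T); H³(ℝ))` solves the Cauchy problem with initial value `u₀`.
The values of `u` at times outside `[0, T)` are irrelevant. -/
def IsSolution (u₀ : Sobolev 4) (T : EReal) (u : ℝ → Sobolev 4) : Prop :=
  0 < T ∧ u 0 = u₀ ∧ ContinuousOn u (timeInterval T) ∧
    ∃ w : ℝ → Sobolev 3, ContinuousOn w (timeInterval T) ∧
      ∀ t ∈ timeInterval T,
        HasDerivWithinAt (fun s => inclusion (u s)) (w t) (timeInterval T) t ∧
          SatisfiesEquation (u t) (w t)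

/-- A solution on `[0, T)` that does not extend to a solution on any longer interval;
`T` is then its lifespan. -/
def IsMaximalSolution (u₀ : Sobolev 4) (T : EReal) (u : ℝ → Sobolev 4) : Prop :=
  IsSolution u₀ T u ∧
    ∀ (T' : EReal) (u' : ℝ → Sobolev 4), T < T' → IsSolution u₀ T' u' →
      ¬ ∀ t ∈ timeInterval T, u' t = u t

/-- The lifespan is finite, and the `H⁴` norm tends to infinity at the lifespan. -/
def BlowsUpInFiniteTime (T : EReal) (u : ℝ → Sobolev 4) : Prop :=
  ∃ τ : ℝ, T = (τ : EReal) ∧ Tendsto (fun t => ‖u t‖) (𝓝[<] τ) atTop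

end CHType

namespace CHType

/-! ### The one-sided exponential kernels -/

/-! With `v = u - u_xx` one has `m = v - v_xx`, so this is the Camassa–Holm equation for `v` with
momentum in `L²`. Put `A = (1 + ∂_x)⁻¹ m = v - v_x` and `B = (1 - ∂_x)⁻¹ m = v + v_x`. At `x₀` these
are positive multiples of the two integrals in the hypothesis, so `A > 0 > B` there at time `0`.

Along a characteristic `q_t = v(q)` one finds `A' = (1 + ∂_x)⁻¹(A m) - v A` and `-B' = (1 - ∂_x)⁻¹(B
m) - v B`. Since `(1 + ∂_x)(A²) = 2 A m - A²` and the kernel is nonnegative, `(1 + ∂_x)⁻¹(A m) ≥ A²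
/ 2`, and likewise for `B` (`half_sq_Rfun_le`). Hence `a = A` and `b = -B` satisfy `a' ≥ ab/2` and
`b' ≥ ab/2` (`IsFlow.exists_hasDerivAt_lag`). They stay positive, and `(1/a + 1/b)' ≤ -(a/b + b/a)/2
≤ -1` (`inv_add_inv_le`). A positive quantity cannot decrease at unit rate forever, so no solution
is global (`not_isSolution_top`).

Well-posedness comes from Lagrangian coordinates. The identity `m(q) q_x² = m₀` turns the equation
into an ODE for the density `p = q_x` in the bounded continuous functions, with a locally Lipschitz
field; its existence time depends only on a bound for `‖m₀‖` (`exists_isFlow`,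
`exists_local_solution`). Uniqueness is an energy estimate for the `H¹` norm of the difference of
two velocities (`SolvesOn.eqOn_Icc`); it also transfers the inequalities from the constructed flow
to every solution. Because the existence time is uniform on bounded sets, a solution whose norm
fails to tend to infinity at a finite time can be continued (`IsMaximalSolution.tendsto_norm`). -/

/-- The sign `1` for `true` and `-1` for `false`. -/
def sg (b : Bool) : ℝ := if b then 1 else -1

@[simp] theorem sg_true : sg true = 1 := rfl
@[simp] theorem sg_false : sg false = -1 := rfl

@[simp] theorem sg_mul_self (b : Bool) : sg b * sg b = 1 := by cases b <;> simp
@[simp] theorem sg_not (b : Bool) : sg (!b) = -sg b := by cases b <;> simp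
@[simp] theorem abs_sg (b : Bool) : |sg b| = 1 := by cases b <;> simp

theorem sg_ne_zero (b : Bool) : sg b ≠ 0 := by cases b <;> simp

/-- The fundamental solution of `1 + ∂_x` (for `true`) or of `1 - ∂_x` (for `false`). -/
noncomputable def kern (b : Bool) (r : ℝ) : ℝ :=
  if 0 ≤ sg b * r then Real.exp (-(sg b * r)) else 0

theorem kern_nonneg (b : Bool) (r : ℝ) : 0 ≤ kern b r := by
  unfold kern; split_ifs <;> positivity

theorem kern_le_exp (b : Bool) (r : ℝ) : kern b r ≤ Real.exp (-|r|) := by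
  unfold kern
  split_ifs with h
  · rw [← abs_of_nonneg h, abs_mul, abs_sg, one_mul]
  · positivity

theorem kern_le_one (b : Bool) (r : ℝ) : kern b r ≤ 1 :=
  (kern_le_exp b r).trans (Real.exp_le_one_iff.2 (by simp))

theorem kern_neg (b : Bool) (r : ℝ) : kern b (-r) = kern (!b) r := by
  simp [kern]

theorem kern_sub_comm (b : Bool) (x y : ℝ) : kern b (x - y) = kern (!b) (y - x) := by
  rw [← kern_neg, neg_sub]

theorem kern_true_eq : kern true = (Ici (0 : ℝ)).indicator fun r => Real.exp (-r) := by
  ext r; simp [kern, indicator]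

theorem kern_false_eq (r : ℝ) : kern false r = kern true (-r) := by
  rw [kern_neg]; rfl

theorem integrable_kern (b : Bool) : Integrable (kern b) := by
  have h : Integrable (kern true) := by
    rw [kern_true_eq, integrable_indicator_iff measurableSet_Ici, integrableOn_Ici_iff_integrableOn_Ioi]
    exact integrableOn_exp_neg_Ioi 0
  cases b
  · exact (integrable_congr (Eventually.of_forall kern_false_eq)).2 h.comp_neg
  · exact h

theorem integral_kern (b : Bool) : ∫ r, kern b r = 1 := by
  have h : ∫ r, kern true r = 1 := by
    rw [kern_true_eq, integral_indicator measurableSet_Ici, integral_Ici_eq_integral_Ioi]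
    exact integral_exp_neg_Ioi_zero
  cases b
  · simp_rw [kern_false_eq]
    rw [integral_neg_eq_self (fun r => kern true r), h]
  · exact h

theorem measurable_kern (b : Bool) : Measurable (kern b) := by
  unfold kern
  exact Measurable.ite (measurableSet_le measurable_const (by fun_prop)) (by fun_prop)
    measurable_const

theorem integrable_kern_sub (b : Bool) (x : ℝ) : Integrable fun y => kern b (x - y) :=
  (integrable_kern b).comp_sub_left x

theorem integral_kern_sub (b : Bool) (x : ℝ) : ∫ y, kern b (x - y) = 1 := by
  rw [integral_sub_left_eq_self (fun r => kern b r), integral_kern]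

theorem memLp_kern_sub (b : Bool) (x : ℝ) : MemLp (fun y => kern b (x - y)) 2 := by
  have hm : Measurable fun y => kern b (x - y) := (measurable_kern b).comp (by fun_prop)
  rw [memLp_two_iff_integrable_sq hm.aestronglyMeasurable]
  refine (integrable_kern_sub b x).mono' (hm.pow_const 2).aestronglyMeasurable
    (Eventually.of_forall fun y => ?_)
  rw [Real.norm_of_nonneg (by positivity)]
  nlinarith [kern_nonneg b (x - y), kern_le_one b (x - y)]

theorem continuousAt_kern (b : Bool) {r : ℝ} (hr : r ≠ 0) : ContinuousAt (kern b) r := by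
  have hs : sg b * r ≠ 0 := mul_ne_zero (sg_ne_zero b) hr
  rcases hs.lt_or_gt with h | h
  · have : kern b =ᶠ[𝓝 r] fun _ => 0 := by
      have : ∀ᶠ s in 𝓝 r, sg b * s < 0 := (by fun_prop : Continuous fun s => sg b * s).continuousAt.eventually_lt_const h
      filter_upwards [this] with s hs
      simp [kern, not_le.2 hs]
    exact continuousAt_const.congr this.symm
  · have : kern b =ᶠ[𝓝 r] fun s => Real.exp (-(sg b * s)) := by
      have : ∀ᶠ s in 𝓝 r, 0 < sg b * s := (by fun_prop : Continuous fun s => sg b * s).continuousAt.eventually_const_lt h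
      filter_upwards [this] with s hs
      simp [kern, hs.le]
    exact ContinuousAt.congr (by fun_prop) this.symm

/-- Convolution with `kern b`. -/
noncomputable def Rfun (b : Bool) (f : ℝ → ℝ) (x : ℝ) : ℝ := ∫ y, kern b (x - y) * f y

theorem Rfun_congr_ae (b : Bool) {f g : ℝ → ℝ} (h : f =ᵐ[volume] g) : Rfun b f = Rfun b g := by
  ext x
  exact integral_congr_ae (by filter_upwards [h] with y hy; rw [hy])

theorem integrable_kern_mul (b : Bool) {f : ℝ → ℝ} (hf : MemLp f 2) (x : ℝ) :
    Integrable fun y => kern b (x - y) * f y :=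
  MemLp.integrable_mul (p := 2) (q := 2) (memLp_kern_sub b x) hf

theorem integrable_kern_mul_sq (b : Bool) {f : ℝ → ℝ} (hf : MemLp f 2) (x : ℝ) :
    Integrable fun y => kern b (x - y) * f y ^ 2 := by
  have hm : Measurable fun y => kern b (x - y) := (measurable_kern b).comp (by fun_prop)
  refine hf.integrable_sq.mono' (hm.aestronglyMeasurable.mul hf.integrable_sq.1)
    (Eventually.of_forall fun y => ?_)
  rw [Real.norm_of_nonneg (mul_nonneg (kern_nonneg _ _) (sq_nonneg _))]
  exact mul_le_of_le_one_left (sq_nonneg _) (kern_le_one _ _)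

/-- Jensen's inequality: the kernel is a probability density, and the variance about the mean `c` is
nonnegative. -/
theorem sq_Rfun_le (b : Bool) {f : ℝ → ℝ} (hf : MemLp f 2) (x : ℝ) :
    Rfun b f x ^ 2 ≤ ∫ y, kern b (x - y) * f y ^ 2 := by
  set c := Rfun b f x with hc
  have h0 : 0 ≤ ∫ y, kern b (x - y) * (f y - c) ^ 2 :=
    integral_nonneg fun y => mul_nonneg (kern_nonneg _ _) (sq_nonneg _)
  have e : ∫ y, kern b (x - y) * (f y - c) ^ 2
      = (∫ y, kern b (x - y) * f y ^ 2) - c ^ 2 := by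
    have e1 : ∀ y, kern b (x - y) * (f y - c) ^ 2
        = kern b (x - y) * f y ^ 2 - 2 * c * (kern b (x - y) * f y) + c ^ 2 * kern b (x - y) := by
      intro y; ring
    simp_rw [e1]
    have i2 : Integrable fun y => kern b (x - y) * f y ^ 2 - 2 * c * (kern b (x - y) * f y) :=
      (integrable_kern_mul_sq b hf x).sub ((integrable_kern_mul b hf x).const_mul _)
    rw [integral_add i2 ((integrable_kern_sub b x).const_mul _),
      integral_sub (integrable_kern_mul_sq b hf x) ((integrable_kern_mul b hf x).const_mul _),
      integral_const_mul, integral_const_mul, integral_kern_sub]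
    change _ - 2 * c * c + _ = _
    ring
  linarith

theorem sq_Rfun_le_integral (b : Bool) {f : ℝ → ℝ} (hf : MemLp f 2) (x : ℝ) :
    Rfun b f x ^ 2 ≤ ∫ y, f y ^ 2 :=
  (sq_Rfun_le b hf x).trans <| integral_mono (integrable_kern_mul_sq b hf x) hf.integrable_sq
    fun _ => mul_le_of_le_one_left (sq_nonneg _) (kern_le_one _ _)

theorem integrable_kern_prod (b : Bool) {f : ℝ → ℝ} (hf : Integrable f) :
    Integrable (fun p : ℝ × ℝ => kern b (p.1 - p.2) * f p.2) (volume.prod volume) := by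
  have := hf.convolution_integrand (ContinuousLinearMap.mul ℝ ℝ) (integrable_kern b)
  exact this.congr (Eventually.of_forall fun p => mul_comm _ _)

theorem aestronglyMeasurable_kern_prod (b : Bool) {f : ℝ → ℝ} (hf : AEStronglyMeasurable f volume) :
    AEStronglyMeasurable (fun p : ℝ × ℝ => kern b (p.1 - p.2) * f p.2) (volume.prod volume) :=
  ((measurable_kern b).comp (by fun_prop : Measurable fun p : ℝ × ℝ => p.1 - p.2)).aestronglyMeasurable.mul
    hf.comp_snd

theorem aestronglyMeasurable_Rfun (b : Bool) {f : ℝ → ℝ} (hf : AEStronglyMeasurable f volume) :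
    AEStronglyMeasurable (Rfun b f) volume :=
  (aestronglyMeasurable_kern_prod b hf).integral_prod_right'

theorem integrable_sq_Rfun (b : Bool) {f : ℝ → ℝ} (hf : MemLp f 2) :
    Integrable (fun x => Rfun b f x ^ 2) := by
  refine (integrable_kern_prod b hf.integrable_sq).integral_prod_left.mono'
    ((aestronglyMeasurable_Rfun b hf.1).pow 2) (Eventually.of_forall fun x => ?_)
  rw [Real.norm_of_nonneg (sq_nonneg _)]
  exact sq_Rfun_le b hf x

theorem memLp_Rfun (b : Bool) {f : ℝ → ℝ} (hf : MemLp f 2) : MemLp (Rfun b f) 2 :=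
  (memLp_two_iff_integrable_sq (aestronglyMeasurable_Rfun b hf.1)).2 (integrable_sq_Rfun b hf)

theorem integral_sq_Rfun_le (b : Bool) {f : ℝ → ℝ} (hf : MemLp f 2) :
    ∫ x, Rfun b f x ^ 2 ≤ ∫ x, f x ^ 2 := by
  have hi := integrable_kern_prod b hf.integrable_sq
  calc ∫ x, Rfun b f x ^ 2 ≤ ∫ x, ∫ y, kern b (x - y) * f y ^ 2 :=
        integral_mono (integrable_sq_Rfun b hf) hi.integral_prod_left fun x => sq_Rfun_le b hf x
    _ = ∫ y, ∫ x, kern b (x - y) * f y ^ 2 := integral_integral_swap hi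
    _ = ∫ y, f y ^ 2 := by
        congr 1; ext y
        rw [integral_mul_const, integral_sub_right_eq_self (fun r => kern b r), integral_kern, one_mul]

theorem integral_Rfun_mul (b : Bool) {f g : ℝ → ℝ} (hf : MemLp f 2) (hg : MemLp g 2) :
    ∫ x, Rfun b f x * g x = ∫ y, f y * Rfun (!b) g y := by
  have hm : AEStronglyMeasurable (fun p : ℝ × ℝ => kern b (p.1 - p.2) * f p.2 * g p.1)
      (volume.prod volume) := (aestronglyMeasurable_kern_prod b hf.1).mul hg.1.comp_fst
  have h1 := integrable_kern_prod b hf.integrable_sq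
  have h2 : Integrable (fun p : ℝ × ℝ => kern b (p.1 - p.2) * g p.1 ^ 2) (volume.prod volume) := by
    have := (integrable_kern_prod (!b) hg.integrable_sq).swap
    refine this.congr (Eventually.of_forall fun p => ?_)
    simp [kern_sub_comm b p.1 p.2]
  have hi : Integrable (fun p : ℝ × ℝ => kern b (p.1 - p.2) * f p.2 * g p.1)
      (volume.prod volume) := by
    -- Fubini is justified by `|f g| ≤ f² + g²`, as the kernel is integrable in each variable.
    refine (h1.add h2).mono' hm (Eventually.of_forall fun p => ?_)
    simp only [Pi.add_apply]
    rw [mul_assoc, norm_mul, Real.norm_of_nonneg (kern_nonneg _ _), ← mul_add, Real.norm_eq_abs]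
    refine mul_le_mul_of_nonneg_left ?_ (kern_nonneg _ _)
    rw [abs_le]
    constructor <;> nlinarith [sq_nonneg (f p.2 + g p.1), sq_nonneg (f p.2 - g p.1)]
  calc ∫ x, Rfun b f x * g x = ∫ x, ∫ y, kern b (x - y) * f y * g x := by
        congr 1; ext x; rw [integral_mul_const]; rfl
    _ = ∫ y, ∫ x, kern b (x - y) * f y * g x := integral_integral_swap hi
    _ = ∫ y, f y * Rfun (!b) g y := by
        congr 1; ext y
        rw [Rfun, ← integral_const_mul]
        congr 1; ext x
        rw [kern_sub_comm]; ring

theorem continuous_Rfun (b : Bool) {f : ℝ → ℝ} (hf : MemLp f 2) : Continuous (Rfun b f) := by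
  rw [continuous_iff_continuousAt]
  intro x₀
  -- For `|x - x₀| < 1` the kernel is at most `e · e^{-|x₀ - y|}`, and its only jump, at `y = x₀`,
  -- is a null set.
  have hE : Integrable fun y => Real.exp 1 * ((kern true (x₀ - y) + kern false (x₀ - y)) * |f y|) :=
    (MemLp.integrable_mul (p := 2) (q := 2)
      ((memLp_kern_sub true x₀).add (memLp_kern_sub false x₀)) hf.abs).const_mul _
  refine continuousAt_of_dominated ?_ ?_ hE ?_
  · exact Eventually.of_forall fun x => (integrable_kern_mul b hf x).1
  · filter_upwards [Metric.ball_mem_nhds x₀ one_pos] with x hx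
    refine Eventually.of_forall fun y => ?_
    have h0 : Real.exp (-|x₀ - y|) ≤ kern true (x₀ - y) + kern false (x₀ - y) := by
      rcases le_total 0 (x₀ - y) with h | h
      · refine le_add_of_le_of_nonneg ?_ (kern_nonneg _ _)
        simp [kern, abs_of_nonneg h, sub_nonneg.1 h]
      · refine le_add_of_nonneg_of_le (kern_nonneg _ _) ?_
        simp [kern, abs_of_nonpos h, sub_nonpos.1 h]
    have h1 : kern b (x - y) ≤ Real.exp 1 * Real.exp (-|x₀ - y|) := by
      refine (kern_le_exp _ _).trans ?_
      rw [← Real.exp_add]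
      refine Real.exp_le_exp.2 ?_
      have h2 : |x₀ - y| ≤ |x₀ - x| + |x - y| := abs_sub_le _ _ _
      have h3 : |x₀ - x| < 1 := by rwa [Metric.mem_ball', Real.dist_eq] at hx
      linarith
    rw [norm_mul, Real.norm_of_nonneg (kern_nonneg _ _), Real.norm_eq_abs, ← mul_assoc]
    refine mul_le_mul_of_nonneg_right (h1.trans ?_) (abs_nonneg _)
    exact mul_le_mul_of_nonneg_left h0 (Real.exp_pos _).le
  · have : ∀ᵐ y : ℝ, y ≠ x₀ := by simp [ae_iff]
    filter_upwards [this] with y hy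
    have hk : ContinuousAt (kern b) (x₀ - y) := continuousAt_kern b (sub_ne_zero.2 hy.symm)
    exact (ContinuousAt.comp (f := fun x => x - y) hk (by fun_prop)).mul continuousAt_const

/-! ### The resolvents on `L²` and calculus of weak derivatives -/

theorem inner_eq_integral (f g : L2) : inner ℝ f g = ∫ x, f x * g x := by
  rw [L2.inner_def]
  congr 1; ext x
  simp [mul_comm]

theorem norm_sq_eq_integral (f : L2) : ‖f‖ ^ 2 = ∫ x, f x ^ 2 := by
  rw [← real_inner_self_eq_norm_sq, inner_eq_integral]
  simp_rw [sq]

theorem norm_toLp_sq {f : ℝ → ℝ} (hf : MemLp f 2) : ‖hf.toLp f‖ ^ 2 = ∫ x, f x ^ 2 := by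
  rw [norm_sq_eq_integral]
  exact integral_congr_ae (by filter_upwards [hf.coeFn_toLp] with x hx; rw [hx])

theorem integrable_mul (f g : L2) : Integrable (fun x => f x * g x) :=
  MemLp.integrable_mul (p := 2) (q := 2) (Lp.memLp f) (Lp.memLp g)

theorem abs_Rfun_le (b : Bool) (f : L2) (x : ℝ) : |Rfun b f x| ≤ ‖f‖ := by
  rw [← abs_of_nonneg (norm_nonneg f)]
  refine sq_le_sq.1 ?_
  rw [norm_sq_eq_integral]
  exact sq_Rfun_le_integral b (Lp.memLp f) x

theorem Rfun_add (b : Bool) {f g : ℝ → ℝ} (hf : MemLp f 2) (hg : MemLp g 2) (x : ℝ) :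
    Rfun b (f + g) x = Rfun b f x + Rfun b g x := by
  unfold Rfun
  rw [← integral_add (integrable_kern_mul b hf x) (integrable_kern_mul b hg x)]
  simp [mul_add]

theorem Rfun_smul (b : Bool) (c : ℝ) (f : ℝ → ℝ) (x : ℝ) :
    Rfun b (c • f) x = c * Rfun b f x := by
  unfold Rfun
  rw [← integral_const_mul]
  congr 1; ext y
  simp; ring

/-- The operator `(1 + ∂_x)⁻¹` (for `true`) or `(1 - ∂_x)⁻¹` (for `false`) on `L²(ℝ)`. -/
noncomputable def resolvent (b : Bool) : L2 →L[ℝ] L2 :=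
  LinearMap.mkContinuous
    { toFun := fun f => (memLp_Rfun b (Lp.memLp f)).toLp _
      map_add' := fun f g => by
        rw [← MemLp.toLp_add]
        refine MemLp.toLp_congr _ _ (Eventually.of_forall fun x => ?_)
        rw [Rfun_congr_ae b (Lp.coeFn_add f g), Rfun_add b (Lp.memLp f) (Lp.memLp g), Pi.add_apply]
      map_smul' := fun c f => by
        rw [← MemLp.toLp_const_smul]
        refine MemLp.toLp_congr _ _ (Eventually.of_forall fun x => ?_)
        rw [Rfun_congr_ae b (Lp.coeFn_smul c f), Rfun_smul]
        rfl }
    1 fun f => by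
      rw [one_mul]
      refine le_of_sq_le_sq ?_ (norm_nonneg _)
      change ‖(memLp_Rfun b (Lp.memLp f)).toLp _‖ ^ 2 ≤ _
      rw [norm_toLp_sq, norm_sq_eq_integral]
      exact integral_sq_Rfun_le b (Lp.memLp f)

theorem coeFn_resolvent (b : Bool) (f : L2) : resolvent b f =ᵐ[volume] Rfun b f :=
  MemLp.coeFn_toLp (memLp_Rfun b (Lp.memLp f))

theorem norm_resolvent_le (b : Bool) (f : L2) : ‖resolvent b f‖ ≤ ‖f‖ := by
  have := ContinuousLinearMap.le_of_opNorm_le (resolvent b)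
    (LinearMap.mkContinuous_norm_le _ zero_le_one _) f
  rwa [one_mul] at this

theorem inner_resolvent (b : Bool) (f g : L2) :
    inner ℝ (resolvent b f) g = inner ℝ f (resolvent (!b) g) := by
  rw [inner_eq_integral, inner_eq_integral]
  calc ∫ x, resolvent b f x * g x = ∫ x, Rfun b f x * g x :=
        integral_congr_ae (by filter_upwards [coeFn_resolvent b f] with x hx; rw [hx])
    _ = ∫ x, f x * Rfun (!b) g x := integral_Rfun_mul b (Lp.memLp f) (Lp.memLp g)
    _ = _ := integral_congr_ae (by filter_upwards [coeFn_resolvent (!b) g] with x hx; rw [hx])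

/-- Reflection exchanges the two kernels, so that only one of them needs calculus. -/
theorem Rfun_not (b : Bool) (f : ℝ → ℝ) (x : ℝ) :
    Rfun (!b) f x = Rfun b (fun y => f (-y)) (-x) := by
  unfold Rfun
  rw [← integral_neg_eq_self]
  congr 1; ext y
  rw [← kern_neg]
  congr 2; ring

theorem Rfun_true_eq {f : ℝ → ℝ} (x : ℝ) :
    Rfun true f x = Real.exp (-x) * ∫ y in Iic x, Real.exp y * f y := by
  rw [← integral_indicator measurableSet_Iic, ← integral_const_mul]
  unfold Rfun
  congr 1; ext y
  by_cases h : y ≤ x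
  · simp [kern, h, ← mul_assoc, ← Real.exp_add]
    left; ring
  · simp [kern, h]

theorem integrableOn_exp_mul {f : ℝ → ℝ} (hf : MemLp f 2) (x : ℝ) :
    IntegrableOn (fun y => Real.exp y * f y) (Iic x) := by
  rw [← integrable_indicator_iff measurableSet_Iic]
  refine ((integrable_kern_mul true hf x).const_mul (Real.exp x)).congr
    (Eventually.of_forall fun y => ?_)
  by_cases h : y ≤ x
  · simp [kern, h, ← mul_assoc, ← Real.exp_add]
  · simp [kern, h]

theorem hasDerivAt_Rfun (b : Bool) {f : ℝ → ℝ} (hf : MemLp f 2) (hc : Continuous f) (x : ℝ) :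
    HasDerivAt (Rfun b f) (sg b * (f x - Rfun b f x)) x := by
  have key : ∀ {f : ℝ → ℝ} (_ : MemLp f 2) (_ : Continuous f) (x : ℝ),
      HasDerivAt (Rfun true f) (f x - Rfun true f x) x := by
    intro f hf hc x
    have hce : Continuous fun y => Real.exp y * f y := by fun_prop
    have e : Rfun true f = fun x => Real.exp (-x) *
        ((∫ y in Iic 0, Real.exp y * f y) + ∫ y in (0 : ℝ)..x, Real.exp y * f y) := by
      ext x
      rw [Rfun_true_eq, ← intervalIntegral.integral_Iic_sub_Iic (integrableOn_exp_mul hf 0)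
        (integrableOn_exp_mul hf x)]
      congr 1; ring
    have h1 : HasDerivAt (fun x => ∫ y in (0 : ℝ)..x, Real.exp y * f y) (Real.exp x * f x) x :=
      intervalIntegral.integral_hasDerivAt_right (hce.intervalIntegrable _ _)
        (hce.stronglyMeasurableAtFilter _ _) hce.continuousAt
    have h2 := ((hasDerivAt_neg x).exp).mul (h1.const_add (∫ y in Iic 0, Real.exp y * f y))
    rw [e]
    refine h2.congr_deriv ?_
    have : Real.exp (-x) * Real.exp x = 1 := by rw [← Real.exp_add]; simp
    linear_combination f x * this
  cases b
  · have hf' : MemLp (fun y => f (-y)) 2 :=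
      hf.comp_measurePreserving (Measure.measurePreserving_neg volume)
    have h := (key hf' (by fun_prop) (-x)).comp x (hasDerivAt_neg x)
    have e : Rfun false f = Rfun true (fun y => f (-y)) ∘ fun x => -x := by
      ext y; exact Rfun_not true f y
    rw [e]
    refine h.congr_deriv ?_
    simp
  · simpa using key hf hc x

theorem IsTestFunction.memLp {φ : ℝ → ℝ} (hφ : IsTestFunction φ) : MemLp φ 2 :=
  hφ.1.continuous.memLp_of_hasCompactSupport hφ.2

theorem IsTestFunction.deriv {φ : ℝ → ℝ} (hφ : IsTestFunction φ) : IsTestFunction (deriv φ) :=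
  ⟨(contDiff_infty_iff_deriv.1 hφ.1).2, hφ.2.deriv⟩

theorem IsTestFunction.differentiable {φ : ℝ → ℝ} (hφ : IsTestFunction φ) : Differentiable ℝ φ :=
  hφ.1.differentiable (by simp)

theorem IsTestFunction.mul {φ ψ : ℝ → ℝ} (hφ : IsTestFunction φ) (hψ : IsTestFunction ψ) :
    IsTestFunction (fun x => φ x * ψ x) :=
  ⟨hφ.1.mul hψ.1, hφ.2.mul_right⟩

/-- Two computations of the derivative of one convolution are compared: on the test function, and on
the exponential integral. -/
theorem Rfun_deriv (b : Bool) {φ : ℝ → ℝ} (hφ : IsTestFunction φ) (x : ℝ) :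
    Rfun b (deriv φ) x = sg b * (φ x - Rfun b φ x) := by
  have h1 := HasCompactSupport.hasDerivAt_convolution_right (μ := volume)
    (ContinuousLinearMap.mul ℝ ℝ) (integrable_kern b).locallyIntegrable hφ.2
    (hφ.1.of_le (by exact_mod_cast le_top)) x
  have e : ∀ ψ : ℝ → ℝ, (convolution (kern b) ψ (ContinuousLinearMap.mul ℝ ℝ) volume) = Rfun b ψ := by
    intro ψ
    ext x
    rw [convolution_eq_swap]
    rfl
  rw [e, e] at h1
  exact h1.unique (hasDerivAt_Rfun b hφ.memLp hφ.1.continuous x)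

theorem isWeakDeriv_resolvent (b : Bool) (f : L2) :
    IsWeakDeriv (resolvent b f) (sg b • (f - resolvent b f)) := by
  intro φ hφ
  have e1 : ∫ x, resolvent b f x * φ x = ∫ x, f x * Rfun (!b) φ x := by
    rw [← integral_Rfun_mul b (Lp.memLp f) hφ.memLp]
    exact integral_congr_ae (by filter_upwards [coeFn_resolvent b f] with x hx; rw [hx])
  have e2 : ∫ x, resolvent b f x * deriv φ x = ∫ x, f x * Rfun (!b) (deriv φ) x := by
    rw [← integral_Rfun_mul b (Lp.memLp f) hφ.deriv.memLp]
    exact integral_congr_ae (by filter_upwards [coeFn_resolvent b f] with x hx; rw [hx])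
  have e3 : ∫ x, (sg b • (f - resolvent b f) : L2) x * φ x
      = sg b * ((∫ x, f x * φ x) - ∫ x, resolvent b f x * φ x) := by
    rw [← integral_sub (hφ.integrable_mul f) (hφ.integrable_mul _), ← integral_const_mul]
    refine integral_congr_ae ?_
    filter_upwards [Lp.coeFn_smul (sg b) (f - resolvent b f), Lp.coeFn_sub f (resolvent b f)]
      with x h1 h2
    rw [h1, Pi.smul_apply, h2, Pi.sub_apply, smul_eq_mul]
    ring
  have i : Integrable fun x => f x * Rfun (!b) φ x :=
    MemLp.integrable_mul (p := 2) (q := 2) (Lp.memLp f) (memLp_Rfun (!b) hφ.memLp)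
  rw [e2, e3, e1, ← integral_sub (hφ.integrable_mul f) i, ← integral_const_mul, ← integral_neg]
  congr 1; ext x
  rw [Rfun_deriv (!b) hφ, sg_not]
  ring

theorem eq_zero_of_integral_test {f : L2}
    (h : ∀ φ : ℝ → ℝ, IsTestFunction φ → ∫ x, f x * φ x = 0) : f = 0 := by
  rw [Lp.eq_zero_iff_ae_eq_zero]
  refine ae_eq_zero_of_integral_contDiff_smul_eq_zero
    ((Lp.memLp f).locallyIntegrable one_le_two) fun φ h1 h2 => ?_
  rw [← h φ ⟨h1, h2⟩]
  simp [mul_comm]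

theorem eq_of_integral_test {f g : L2}
    (h : ∀ φ : ℝ → ℝ, IsTestFunction φ → ∫ x, f x * φ x = ∫ x, g x * φ x) : f = g := by
  rw [← sub_eq_zero]
  refine eq_zero_of_integral_test fun φ hφ => ?_
  rw [← sub_eq_zero.2 (h φ hφ), ← integral_sub (hφ.integrable_mul f) (hφ.integrable_mul g)]
  refine integral_congr_ae ?_
  filter_upwards [Lp.coeFn_sub f g] with x hx
  rw [hx, Pi.sub_apply, sub_mul]

theorem IsWeakDeriv.unique {f g g' : L2} (h : IsWeakDeriv f g) (h' : IsWeakDeriv f g') : g = g' :=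
  eq_of_integral_test fun φ hφ => neg_injective ((h φ hφ).symm.trans (h' φ hφ))

theorem IsWeakDeriv.neg {f g : L2} (h : IsWeakDeriv f g) : IsWeakDeriv (-f) (-g) := by
  simpa using h.smul (-1)

theorem IsWeakDeriv.sub {f g f' g' : L2} (h : IsWeakDeriv f g) (h' : IsWeakDeriv f' g') :
    IsWeakDeriv (f - f') (g - g') := by
  simpa [sub_eq_add_neg] using h.add h'.neg

theorem abs_integral_mul_le (f : L2) {φ : ℝ → ℝ} (hφ : MemLp φ 2) :
    |∫ x, f x * φ x| ≤ ‖f‖ * ‖hφ.toLp φ‖ := by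
  have : ∫ x, f x * φ x = inner ℝ f (hφ.toLp φ) := by
    rw [inner_eq_integral]
    exact integral_congr_ae (by filter_upwards [hφ.coeFn_toLp] with x hx; rw [hx])
  rw [this]
  exact abs_real_inner_le_norm _ _

/-- A solution of `h' = c h` is a multiple of `e^{cx}`, which lies in `L²` only if it vanishes.
Mollification makes this classical: the convolution `J` of `h` with a test function satisfies `J' =
c J` and is bounded. -/
theorem IsWeakDeriv.eq_zero_of_eq_smul {h : L2} {c : ℝ} (hc : c ≠ 0)
    (hh : IsWeakDeriv h (c • h)) : h = 0 := by
  refine eq_zero_of_integral_test fun φ hφ => ?_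
  set g : ℝ → ℝ := fun x => φ (-x) with hg
  have hrefl : ∀ s : ℝ, ∀ ψ : ℝ → ℝ, IsTestFunction ψ → IsTestFunction fun x => ψ (s - x) := by
    intro s ψ hψ
    refine ⟨hψ.1.comp (contDiff_const.sub contDiff_id), ?_⟩
    exact hψ.2.comp_homeomorph (Homeomorph.subLeft s)
  have hgt : IsTestFunction g := by
    have := hrefl 0 φ hφ
    simpa only [zero_sub] using this
  set J : ℝ → ℝ := fun s => ∫ x, h x * g (s - x) with hJ
  have hJ' : ∀ s, HasDerivAt J (c * J s) s := by
    intro s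
    have h1 := HasCompactSupport.hasDerivAt_convolution_right (μ := volume)
      (ContinuousLinearMap.mul ℝ ℝ) ((Lp.memLp h).locallyIntegrable one_le_two) hgt.2
      (hgt.1.of_le (by exact_mod_cast le_top)) s
    refine h1.congr_deriv ?_
    have h2 := hh _ (hrefl s g hgt)
    have h3 : ∀ x, _root_.deriv (fun x => g (s - x)) x = -(_root_.deriv g (s - x)) := by
      intro x
      rw [deriv_comp_const_sub]
    have h4 : ∫ x, (c • h : L2) x * g (s - x) = c * J s := by
      rw [hJ, ← integral_const_mul]
      refine integral_congr_ae ?_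
      filter_upwards [Lp.coeFn_smul c h] with x hx
      rw [hx, Pi.smul_apply, smul_eq_mul, mul_assoc]
    rw [h4] at h2
    simp_rw [h3, mul_neg] at h2
    rw [integral_neg, neg_inj] at h2
    exact h2
  have hbound : ∀ s, |J s| ≤ ‖h‖ * ‖hgt.memLp.toLp g‖ := by
    intro s
    refine (abs_integral_mul_le h (hrefl s g hgt).memLp).trans_eq ?_
    congr 1
    rw [← sq_eq_sq₀ (norm_nonneg _) (norm_nonneg _), norm_toLp_sq, norm_toLp_sq]
    exact integral_sub_left_eq_self (fun x => g x ^ 2) volume s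
  have hconst : ∀ s, J s * Real.exp (-(c * s)) = J 0 := by
    have hd : ∀ s, HasDerivAt (fun s => J s * Real.exp (-(c * s))) 0 s := by
      intro s
      have := (hJ' s).mul (((hasDerivAt_id s).const_mul c).neg.exp)
      refine this.congr_deriv ?_
      simp; ring
    intro s
    have := is_const_of_deriv_eq_zero (fun s => (hd s).differentiableAt) (fun s => (hd s).deriv) s 0
    simpa using this
  have hJ0 : J 0 = 0 := by
    -- Evaluating at `n / c` gives the factor `e^{-n}` for either sign of `c`.
    have hb : ∀ n : ℕ, |J 0| ≤ ‖h‖ * ‖hgt.memLp.toLp g‖ * Real.exp (-(n : ℝ)) := by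
      intro n
      rw [← hconst (n / c), abs_mul, abs_of_pos (Real.exp_pos _), mul_div_cancel₀ _ hc]
      exact mul_le_mul_of_nonneg_right (hbound _) (Real.exp_pos _).le
    have ht : Tendsto (fun n : ℕ => ‖h‖ * ‖hgt.memLp.toLp g‖ * Real.exp (-(n : ℝ))) atTop (𝓝 0) := by
      rw [← mul_zero (‖h‖ * ‖hgt.memLp.toLp g‖)]
      exact (Real.tendsto_exp_neg_atTop_nhds_zero.comp tendsto_natCast_atTop_atTop).const_mul _
    have := ge_of_tendsto' ht hb
    exact abs_eq_zero.1 (le_antisymm this (abs_nonneg _))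
  simpa [hJ, hg] using hJ0

/-- A function of class `H¹` is recovered from its derivative by the resolvents. -/
theorem IsWeakDeriv.eq_resolvent {f g : L2} (h : IsWeakDeriv f g) (b : Bool) :
    f = resolvent b (f + sg b • g) := by
  rw [← sub_eq_zero]
  -- Both sides solve `F + sg b • F' = f + sg b • g`, so their difference `d` satisfies `d' = -sg b
  -- • d`.
  refine IsWeakDeriv.eq_zero_of_eq_smul (c := -sg b) (neg_ne_zero.2 (sg_ne_zero b)) ?_
  have := h.sub (isWeakDeriv_resolvent b (f + sg b • g))
  convert this using 1
  rw [smul_sub, smul_sub, smul_add, smul_smul, sg_mul_self, one_smul, neg_smul, neg_smul]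
  abel

/-- Integration by parts in `H¹`. -/
theorem IsWeakDeriv.inner_eq {f f' g g' : L2} (hf : IsWeakDeriv f f') (hg : IsWeakDeriv g g') :
    inner ℝ f g' = -inner ℝ f' g := by
  -- Since `(1 + ∂_x)⁻¹` and `(1 - ∂_x)⁻¹` are adjoint, `⟨f, g - g'⟩ = ⟨f + f', g⟩`.
  have h := inner_resolvent true (f + sg true • f') (g + sg false • g')
  rw [← hf.eq_resolvent true, Bool.not_true, ← hg.eq_resolvent false] at h
  simp only [sg_true, sg_false, one_smul, neg_smul, inner_add_left, inner_add_right,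
    inner_neg_right] at h
  linarith

/-- The continuous representative of an element of `H¹`. -/
theorem IsWeakDeriv.ae_eq {f g : L2} (h : IsWeakDeriv f g) (b : Bool) :
    f =ᵐ[volume] Rfun b (f + sg b • g : L2) := by
  have := coeFn_resolvent b (f + sg b • g)
  rwa [← h.eq_resolvent b] at this

theorem IsWeakDeriv.ae_abs_le {f g : L2} (h : IsWeakDeriv f g) :
    ∀ᵐ x, |f x| ≤ ‖f‖ + ‖g‖ := by
  filter_upwards [h.ae_eq true] with x hx
  rw [hx]
  refine (abs_Rfun_le _ _ _).trans ((norm_add_le _ _).trans ?_)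
  simp

/-! ### Products of functions of class `H¹` -/

theorem memLp_mul_of_ae_bound {f g : ℝ → ℝ} (hf : AEStronglyMeasurable f volume) {C : ℝ}
    (hC : ∀ᵐ x, |f x| ≤ C) (hg : MemLp g 2) : MemLp (fun x => f x * g x) 2 := by
  refine hg.of_le_mul (c := C) (hf.mul hg.1) ?_
  filter_upwards [hC] with x hx
  rw [norm_mul, Real.norm_eq_abs]
  exact mul_le_mul_of_nonneg_right hx (norm_nonneg _)

theorem IsWeakDeriv.memLp_mul {f f' : L2} (hf : IsWeakDeriv f f') (g : L2) :
    MemLp (fun x => f x * g x) 2 :=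
  memLp_mul_of_ae_bound (Lp.memLp f).1 hf.ae_abs_le (Lp.memLp g)

theorem IsWeakDeriv.mul_test {f f' h h' : L2} (hf : IsWeakDeriv f f') {φ : ℝ → ℝ}
    (hφ : IsTestFunction φ) (hh : h =ᵐ[volume] fun x => f x * φ x)
    (hh' : h' =ᵐ[volume] fun x => f' x * φ x + f x * deriv φ x) : IsWeakDeriv h h' := by
  intro ψ hψ
  have key := hf _ (hφ.mul hψ)
  have hd : ∀ x, deriv (fun x => φ x * ψ x) x = deriv φ x * ψ x + φ x * deriv ψ x := fun x =>
    deriv_fun_mul (hφ.differentiable x) (hψ.differentiable x)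
  simp_rw [hd] at key
  have i1 := (hφ.deriv.mul hψ).integrable_mul f
  have i2 := (hφ.mul hψ.deriv).integrable_mul f
  have i3 := (hφ.mul hψ).integrable_mul f'
  have e1 : ∫ x, h x * deriv ψ x = ∫ x, f x * (φ x * deriv ψ x) :=
    integral_congr_ae (by filter_upwards [hh] with x hx; rw [hx]; ring)
  have e2 : ∫ x, h' x * ψ x = (∫ x, f' x * (φ x * ψ x)) + ∫ x, f x * (deriv φ x * ψ x) := by
    rw [← integral_add i3 i1]
    exact integral_congr_ae (by filter_upwards [hh'] with x hx; rw [hx]; ring)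
  simp_rw [mul_add] at key
  rw [integral_add i1 i2] at key
  rw [e1, e2]
  linarith

/-- The product rule for functions of class `H¹`. -/
theorem IsWeakDeriv.mul {f f' g g' h h' : L2} (hf : IsWeakDeriv f f') (hg : IsWeakDeriv g g')
    (hh : h =ᵐ[volume] fun x => f x * g x)
    (hh' : h' =ᵐ[volume] fun x => f' x * g x + f x * g' x) : IsWeakDeriv h h' := by
  intro φ hφ
  have hb : ∀ {φ : ℝ → ℝ}, IsTestFunction φ → ∃ C, ∀ x, |φ x| ≤ C := fun hφ =>
    hφ.1.continuous.bounded_above_of_compact_support hφ.2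
  obtain ⟨C, hC⟩ := hb hφ
  obtain ⟨C', hC'⟩ := hb hφ.deriv
  have m : ∀ a : L2, MemLp (fun x => a x * φ x) 2 := fun a => by
    simpa only [mul_comm] using memLp_mul_of_ae_bound hφ.1.continuous.aestronglyMeasurable
      (Eventually.of_forall hC) (Lp.memLp a)
  have m1' : MemLp (fun x => f x * deriv φ x) 2 := by
    simpa only [mul_comm] using memLp_mul_of_ae_bound hφ.deriv.1.continuous.aestronglyMeasurable
      (Eventually.of_forall hC') (Lp.memLp f)
  have m2 : MemLp (fun x => f' x * φ x + f x * deriv φ x) 2 := (m f').add m1'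
  -- The test function is absorbed into `f`; integration by parts of `f φ` against `g` is then the
  -- product rule tested with `φ`.
  have w := hf.mul_test hφ (m f).coeFn_toLp m2.coeFn_toLp
  have key := w.inner_eq hg
  rw [inner_eq_integral, inner_eq_integral] at key
  have iA : Integrable fun x => (f x * φ x) * g' x :=
    MemLp.integrable_mul (p := 2) (q := 2) (m f) (Lp.memLp g')
  have iB : Integrable fun x => (f' x * φ x) * g x :=
    MemLp.integrable_mul (p := 2) (q := 2) (m f') (Lp.memLp g)
  have iC : Integrable fun x => (f x * deriv φ x) * g x :=
    MemLp.integrable_mul (p := 2) (q := 2) m1' (Lp.memLp g)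
  have eA : ∫ x, ((m f).toLp _ : L2) x * g' x = ∫ x, (f x * φ x) * g' x :=
    integral_congr_ae (by filter_upwards [(m f).coeFn_toLp] with x hx; rw [hx])
  have eB : ∫ x, (m2.toLp _ : L2) x * g x
      = (∫ x, (f' x * φ x) * g x) + ∫ x, (f x * deriv φ x) * g x := by
    rw [← integral_add iB iC]
    exact integral_congr_ae (by filter_upwards [m2.coeFn_toLp] with x hx; rw [hx]; ring)
  have e1 : ∫ x, h x * deriv φ x = ∫ x, (f x * deriv φ x) * g x :=
    integral_congr_ae (by filter_upwards [hh] with x hx; rw [hx]; ring)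
  have e2 : ∫ x, h' x * φ x = (∫ x, (f' x * φ x) * g x) + ∫ x, (f x * φ x) * g' x := by
    rw [← integral_add iB iA]
    exact integral_congr_ae (by filter_upwards [hh'] with x hx; rw [hx]; ring)
  rw [eA, eB] at key
  rw [e1, e2]
  linarith

theorem memLp_Rfun_mul (b : Bool) {f g : ℝ → ℝ} (hf : MemLp f 2) (hg : MemLp g 2) :
    MemLp (fun x => Rfun b f x * g x) 2 := by
  refine memLp_mul_of_ae_bound (C := ‖hf.toLp f‖) (aestronglyMeasurable_Rfun b hf.1)
    (Eventually.of_forall fun x => ?_) hg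
  rw [← Rfun_congr_ae b hf.coeFn_toLp]
  exact abs_Rfun_le b _ x

/-- The algebraic inequality behind the blow-up criterion. -/
theorem half_sq_Rfun_le (b : Bool) {m : ℝ → ℝ} (hm : MemLp m 2) (x : ℝ) :
    Rfun b m x ^ 2 / 2 ≤ Rfun b (fun y => Rfun b m y * m y) x := by
  set M : L2 := hm.toLp m with hM
  have hMm : M =ᵐ[volume] m := hm.coeFn_toLp
  have hR : Rfun b M = Rfun b m := Rfun_congr_ae b hMm
  set f : L2 := resolvent b M with hf
  have hfR : f =ᵐ[volume] Rfun b m := by rw [← hR]; exact coeFn_resolvent b M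
  have w := isWeakDeriv_resolvent b M
  have mfm := memLp_Rfun_mul b hm hm
  have mff := memLp_Rfun_mul b hm (memLp_Rfun b hm)
  set s : L2 := mff.toLp _ with hs
  set s' : L2 := (2 * sg b) • (mfm.toLp _ - mff.toLp _) with hs'
  have hsae : s =ᵐ[volume] fun x => Rfun b m x * Rfun b m x := mff.coeFn_toLp
  have hsf : s =ᵐ[volume] fun x => f x * f x := by
    filter_upwards [hsae, hfR] with x h1 h2
    rw [h1, h2]
  have hsf' : s' =ᵐ[volume] fun x => (sg b • (M - f) : L2) x * f x + f x * (sg b • (M - f) : L2) x := by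
    filter_upwards [Lp.coeFn_smul (2 * sg b) (mfm.toLp _ - mff.toLp _),
      Lp.coeFn_sub (mfm.toLp _) (mff.toLp _), mfm.coeFn_toLp, mff.coeFn_toLp, hfR, hMm,
      Lp.coeFn_smul (sg b) (M - f), Lp.coeFn_sub M f] with x h1 h2 h3 h4 h5 h6 h7 h8
    rw [h1, Pi.smul_apply, h2, Pi.sub_apply, h3, h4, h7, Pi.smul_apply, h8, Pi.sub_apply, h5, h6]
    simp only [smul_eq_mul]
    ring
  -- Here `s = f²` and `s' = 2 f f'` with `f' = sg b (m - f)`, so `s + sg b s' = 2 f m - f²`.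
  have ws : IsWeakDeriv s s' := w.mul w hsf hsf'
  have e0 : s + sg b • s' = (2 : ℝ) • mfm.toLp _ - mff.toLp _ := by
    rw [hs', smul_smul, show sg b * (2 * sg b) = 2 * (sg b * sg b) by ring, sg_mul_self, hs]
    rw [mul_one, smul_sub, two_smul ℝ (mff.toLp _)]
    abel
  have e1 : s =ᵐ[volume] Rfun b (s + sg b • s' : L2) := ws.ae_eq b
  have e2 : (s + sg b • s' : L2) =ᵐ[volume]
      ((2 : ℝ) • fun y => Rfun b m y * m y) + (-1 : ℝ) • fun y => Rfun b m y * Rfun b m y := by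
    rw [e0]
    filter_upwards [Lp.coeFn_sub ((2 : ℝ) • mfm.toLp _) (mff.toLp _),
      Lp.coeFn_smul (2 : ℝ) (mfm.toLp _), mfm.coeFn_toLp, mff.coeFn_toLp] with x h1 h2 h3 h4
    rw [h1, Pi.sub_apply, h2, Pi.smul_apply, h3, h4]
    simp [sub_eq_add_neg]
  -- Inverting gives `f² = 2 R(f m) - R(f²)`, where `R = Rfun b`. Both sides are continuous, so the
  -- identity holds at every point; it remains to use `R(f²) ≥ 0`.
  have e3 : (fun x => Rfun b m x * Rfun b m x) = fun x =>
      2 * Rfun b (fun y => Rfun b m y * m y) x - Rfun b (fun y => Rfun b m y * Rfun b m y) x := by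
    have c := continuous_Rfun b hm
    have c1 := continuous_Rfun b mfm
    have c2 := continuous_Rfun b mff
    rw [← Continuous.ae_eq_iff_eq (volume : Measure ℝ) (by fun_prop) (by fun_prop)]
    filter_upwards [hsae, e1] with x h1 h2
    rw [← h1, h2, Rfun_congr_ae b e2, Rfun_add b (mfm.const_smul 2) (mff.const_smul (-1)),
      Rfun_smul, Rfun_smul]
    ring
  have e4 := congrFun e3 x
  have h0 : 0 ≤ Rfun b (fun y => Rfun b m y * Rfun b m y) x :=
    integral_nonneg fun y => mul_nonneg (kern_nonneg _ _) (mul_self_nonneg _)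
  nlinarith

/-! ### Sobolev spaces -/

/-- The weak derivative of order `i` as a continuous linear map. -/
noncomputable def wderivL {k : ℕ} (i : Fin (k + 1)) : Sobolev k →L[ℝ] L2 :=
  (PiLp.proj 2 (fun _ : Fin (k + 1) => L2) i).comp (Sobolev k).subtypeL

theorem Sobolev.ext {k : ℕ} {f g : Sobolev k} (h : ∀ i, wderiv f i = wderiv g i) : f = g :=
  Subtype.ext (PiLp.ext h)

theorem isWeakDeriv_wderiv {k : ℕ} (f : Sobolev k) (i : Fin k) :
    IsWeakDeriv (wderiv f i.castSucc) (wderiv f i.succ) := f.2 i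

/-- Each test condition is an equality of continuous functionals. This makes the Sobolev spaces
complete, as needed to integrate curves in them. -/
theorem isClosed_isWeakDeriv {φ : ℝ → ℝ} (hφ : IsTestFunction φ) :
    IsClosed {p : L2 × L2 | ∫ x, p.1 x * deriv φ x = -∫ x, p.2 x * φ x} := by
  have e : ∀ (f : L2) {ψ : ℝ → ℝ} (hψ : MemLp ψ 2), ∫ x, f x * ψ x = inner ℝ f (hψ.toLp ψ) := by
    intro f ψ hψ
    rw [inner_eq_integral]
    exact integral_congr_ae (by filter_upwards [hψ.coeFn_toLp] with x hx; rw [hx])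
  simp_rw [e _ hφ.memLp, e _ hφ.deriv.memLp]
  exact isClosed_eq (by fun_prop) (by fun_prop)

instance {k : ℕ} : CompleteSpace (Sobolev k) := by
  have : IsClosed (Sobolev k : Set (PiLp 2 fun _ : Fin (k + 1) => L2)) := by
    have e : (Sobolev k : Set (PiLp 2 fun _ : Fin (k + 1) => L2)) =
        ⋂ (i : Fin k) (φ : ℝ → ℝ) (_ : IsTestFunction φ),
          {F | ∫ x, F i.castSucc x * deriv φ x = -∫ x, F i.succ x * φ x} := by
      ext F
      simp only [mem_iInter]
      rfl
    rw [e]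
    refine isClosed_iInter fun i => isClosed_iInter fun φ => isClosed_iInter fun hφ => ?_
    exact (isClosed_isWeakDeriv hφ).preimage
      (f := fun F : PiLp 2 fun _ : Fin (k + 1) => L2 => (F i.castSucc, F i.succ)) (by fun_prop)
  exact this.completeSpace_coe

/-- A continuous linear map into a Sobolev space, given by the derivatives of its values. -/
noncomputable def Sobolev.lift {E : Type*} [NormedAddCommGroup E] [NormedSpace ℝ E] {k : ℕ}
    (L : Fin (k + 1) → E →L[ℝ] L2)
    (hL : ∀ (x : E) (i : Fin k), IsWeakDeriv (L i.castSucc x) (L i.succ x)) : E →L[ℝ] Sobolev k where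
  toFun x := ⟨WithLp.toLp 2 fun i => L i x, hL x⟩
  map_add' x y := Sobolev.ext fun i => (L i).map_add x y
  map_smul' c x := Sobolev.ext fun i => (L i).map_smul c x
  cont := by
    refine Continuous.subtype_mk ?_ _
    refine (PiLp.continuous_toLp 2 _).comp ?_
    exact continuous_pi fun i => (L i).continuous

/-- The inclusion `H^(k+1) ⊆ H^k` as a continuous linear map. -/
noncomputable def inclusionL {k : ℕ} : Sobolev (k + 1) →L[ℝ] Sobolev k :=
  Sobolev.lift (fun i => wderivL i.castSucc) fun f i => f.2 i.castSucc

theorem inclusionL_apply {k : ℕ} (f : Sobolev (k + 1)) : inclusionL f = inclusion f := rfl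

/-- The derivative as a continuous linear map `H^(k+1) → H^k`. -/
noncomputable def tailL {k : ℕ} : Sobolev (k + 1) →L[ℝ] Sobolev k :=
  Sobolev.lift (fun i => wderivL i.succ) fun f i => f.2 i.succ

/-! ### Green operators and the inversion of `(1 - ∂_x²)²` -/

/-- The operator `(1 - ∂_x²)⁻¹` on `L²`. -/
noncomputable def green : L2 →L[ℝ] L2 := (1 / 2 : ℝ) • (resolvent true + resolvent false)

/-- The operator `∂_x (1 - ∂_x²)⁻¹` on `L²`. -/
noncomputable def dgreen : L2 →L[ℝ] L2 := (1 / 2 : ℝ) • (resolvent false - resolvent true)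

theorem green_apply (f : L2) : green f = (1 / 2 : ℝ) • (resolvent true f + resolvent false f) := rfl

theorem dgreen_apply (f : L2) : dgreen f = (1 / 2 : ℝ) • (resolvent false f - resolvent true f) :=
  rfl

theorem isWeakDeriv_green (f : L2) : IsWeakDeriv (green f) (dgreen f) := by
  rw [green_apply, dgreen_apply]
  have := ((isWeakDeriv_resolvent true f).add (isWeakDeriv_resolvent false f)).smul (1 / 2)
  convert this using 2
  simp

theorem isWeakDeriv_dgreen (f : L2) : IsWeakDeriv (dgreen f) (green f - f) := by
  rw [green_apply, dgreen_apply]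
  have := ((isWeakDeriv_resolvent false f).sub (isWeakDeriv_resolvent true f)).smul (1 / 2)
  convert this using 1
  simp only [sg_true, sg_false]
  module

/-- The functions `f + f'` and `f - f'` are `(1 - ∂_x)⁻¹` and `(1 + ∂_x)⁻¹` of the same function `f
- f''`; half their sum and half their difference are the claims. -/
theorem eq_green {f f' f'' : L2} (h : IsWeakDeriv f f') (h' : IsWeakDeriv f' f'') :
    f = green (f - f'') ∧ f' = dgreen (f - f'') := by
  have h1 := (h.add h').eq_resolvent false
  have h2 := (h.sub h').eq_resolvent true
  have e1 : f + f' + sg false • (f' + f'') = f - f'' := by simp only [sg_false]; module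
  have e2 : f - f' + sg true • (f' - f'') = f - f'' := by simp only [sg_true]; module
  rw [e1] at h1
  rw [e2] at h2
  rw [green_apply, dgreen_apply, ← h1, ← h2]
  constructor <;> module

/-- The inverse of `(1 - ∂_x²)²`. -/
noncomputable def solve : L2 →L[ℝ] Sobolev 4 :=
  Sobolev.lift
    -- Every second derivative is rewritten by `∂_x² green = green - 1`.
    ![green ∘L green, dgreen ∘L green, green ∘L green - green, dgreen ∘L green - dgreen,
      green ∘L green - green - (green - ContinuousLinearMap.id ℝ L2)] (by
    intro f i
    fin_cases i
    · exact isWeakDeriv_green _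
    · exact isWeakDeriv_dgreen _
    · exact (isWeakDeriv_green _).sub (isWeakDeriv_green _)
    · exact (isWeakDeriv_dgreen _).sub (isWeakDeriv_dgreen _))

theorem velocity_solve (f : L2) : velocity (solve f) = green f := by
  change green (green f) - (green (green f) - green f) = green f
  abel

theorem velocityDeriv_solve (f : L2) : velocityDeriv (solve f) = dgreen f := by
  change dgreen (green f) - (dgreen (green f) - dgreen f) = dgreen f
  abel

theorem momentum_solve (f : L2) : momentum (solve f) = f := by
  change green (green f) - (2 : ℝ) • (green (green f) - green f)
    + (green (green f) - green f - (green f - f)) = f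
  module

theorem isWeakDeriv_velocity (u : Sobolev 4) : IsWeakDeriv (velocity u) (velocityDeriv u) :=
  (isWeakDeriv_wderiv u 0).sub (isWeakDeriv_wderiv u 2)

theorem isWeakDeriv_velocityDeriv (u : Sobolev 4) :
    IsWeakDeriv (velocityDeriv u) (velocity u - momentum u) := by
  have e : velocity u - momentum u = wderiv u 2 - wderiv u 4 := by
    unfold velocity momentum
    module
  rw [e]
  exact (isWeakDeriv_wderiv u 1).sub (isWeakDeriv_wderiv u 3)

theorem velocity_eq_green (u : Sobolev 4) :
    velocity u = green (momentum u) ∧ velocityDeriv u = dgreen (momentum u) := by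
  have := eq_green (isWeakDeriv_velocity u) (isWeakDeriv_velocityDeriv u)
  rwa [sub_sub_cancel] at this

theorem Sobolev.ext_zero {k : ℕ} {f g : Sobolev k} (h : wderiv f 0 = wderiv g 0) : f = g := by
  refine Sobolev.ext fun i => ?_
  induction i using Fin.induction with
  | zero => exact h
  | succ i ih =>
    have h1 := isWeakDeriv_wderiv f i
    rw [ih] at h1
    exact h1.unique (isWeakDeriv_wderiv g i)

theorem solve_momentum (u : Sobolev 4) : solve (momentum u) = u := by
  refine Sobolev.ext_zero ?_
  change green (green (momentum u)) = _
  rw [← (velocity_eq_green u).1]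
  exact (eq_green (isWeakDeriv_wderiv u 0) (isWeakDeriv_wderiv u 1)).1.symm

/-- The momentum as a continuous linear map. -/
noncomputable def momentumL : Sobolev 4 →L[ℝ] L2 := wderivL 0 - (2 : ℝ) • wderivL 2 + wderivL 4

theorem momentumL_apply (u : Sobolev 4) : momentumL u = momentum u := rfl

/-! ### The quadratic terms and the weak form of the equation -/

/-- Multiplication `H¹ × L² → L²`. -/
noncomputable def mulH : Sobolev 1 →L[ℝ] L2 →L[ℝ] L2 :=
  LinearMap.mkContinuous₂
    (LinearMap.mk₂ ℝ (fun (f : Sobolev 1) (g : L2) => ((isWeakDeriv_wderiv f 0).memLp_mul g).toLp _)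
      (fun f f' g => by
        rw [← MemLp.toLp_add]
        refine MemLp.toLp_congr _ _ ?_
        filter_upwards [Lp.coeFn_add (wderiv f 0) (wderiv f' 0)] with x hx
        change (wderiv f 0 + wderiv f' 0 : L2) x * g x = _
        rw [hx]; exact add_mul _ _ _)
      (fun c f g => by
        rw [← MemLp.toLp_const_smul]
        refine MemLp.toLp_congr _ _ ?_
        filter_upwards [Lp.coeFn_smul c (wderiv f 0)] with x hx
        change (c • wderiv f 0 : L2) x * g x = _
        rw [hx]; exact mul_assoc _ _ _)
      (fun f g g' => by
        rw [← MemLp.toLp_add]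
        refine MemLp.toLp_congr _ _ ?_
        filter_upwards [Lp.coeFn_add g g'] with x hx
        rw [hx]; exact mul_add _ _ _)
      (fun c f g => by
        rw [← MemLp.toLp_const_smul]
        refine MemLp.toLp_congr _ _ ?_
        filter_upwards [Lp.coeFn_smul c g] with x hx
        rw [hx]; exact mul_left_comm _ _ _)) 2 fun f g => by
    have hb := (isWeakDeriv_wderiv f 0).ae_abs_le
    have h0 : ‖wderiv f 0‖ ≤ ‖f‖ := PiLp.norm_apply_le (f : PiLp 2 fun _ : Fin 2 => L2) 0
    have h1 : ‖wderiv f 1‖ ≤ ‖f‖ := PiLp.norm_apply_le (f : PiLp 2 fun _ : Fin 2 => L2) 1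
    refine Lp.norm_le_mul_norm_of_ae_le_mul ?_
    filter_upwards [((isWeakDeriv_wderiv f 0).memLp_mul g).coeFn_toLp, hb] with x hx hx'
    change ‖(((isWeakDeriv_wderiv f 0).memLp_mul g).toLp _ : L2) x‖ ≤ _
    rw [hx, norm_mul, Real.norm_eq_abs]
    refine mul_le_mul_of_nonneg_right (hx'.trans ?_) (norm_nonneg _)
    change ‖wderiv f 0‖ + ‖wderiv f 1‖ ≤ _
    linarith

theorem coeFn_mulH (f : Sobolev 1) (g : L2) :
    mulH f g =ᵐ[volume] fun x => wderiv f 0 x * g x :=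
  ((isWeakDeriv_wderiv f 0).memLp_mul g).coeFn_toLp

/-- `v = (1 - ∂_x²)⁻¹ m` as an element of `H¹`. -/
noncomputable def velocityH : L2 →L[ℝ] Sobolev 1 :=
  Sobolev.lift ![green, dgreen] fun f i => by
    fin_cases i; exact isWeakDeriv_green f

/-- `v_x = ∂_x (1 - ∂_x²)⁻¹ m` as an element of `H¹`. -/
noncomputable def velocityDerivH : L2 →L[ℝ] Sobolev 1 :=
  Sobolev.lift ![dgreen, green - ContinuousLinearMap.id ℝ L2] fun f i => by
    fin_cases i; exact isWeakDeriv_dgreen f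

/-- The product `v m`. -/
noncomputable def flux (m : L2) : L2 := mulH (velocityH m) m

/-- The product `v_x m`. -/
noncomputable def source (m : L2) : L2 := mulH (velocityDerivH m) m

theorem coeFn_flux (m : L2) : flux m =ᵐ[volume] fun x => green m x * m x := coeFn_mulH _ _

theorem coeFn_source (m : L2) : source m =ᵐ[volume] fun x => dgreen m x * m x := coeFn_mulH _ _

theorem continuous_flux : Continuous flux := by unfold flux; fun_prop

theorem continuous_source : Continuous source := by unfold source; fun_prop

/-- The time derivative in `H³` of a solution with momentum `m`. -/
noncomputable def rate (m : L2) : Sobolev 3 :=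
  -- This is `-(1 - ∂_x²)⁻² ((v m)_x + v_x m)`; the derivative taken by `tailL` costs one order,
  -- whence `H³`.
  -(tailL (solve (flux m)) + inclusionL (solve (source m)))

theorem continuous_rate : Continuous rate := by
  unfold rate
  have := continuous_flux
  have := continuous_source
  fun_prop

/-- `(1 - ∂_x²) w` as a function of `w ∈ H³`. -/
noncomputable def vel3 : Sobolev 3 →L[ℝ] L2 := wderivL 0 - wderivL 2

/-- `∂_x (1 - ∂_x²) w` as a function of `w ∈ H³`. -/
noncomputable def dvel3 : Sobolev 3 →L[ℝ] L2 := wderivL 1 - wderivL 3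

theorem isWeakDeriv_vel3 (w : Sobolev 3) : IsWeakDeriv (vel3 w) (dvel3 w) :=
  (isWeakDeriv_wderiv w 0).sub (isWeakDeriv_wderiv w 2)

theorem vel3_inclusion (u : Sobolev 4) : vel3 (inclusion u) = velocity u := rfl

theorem dvel3_inclusion (u : Sobolev 4) : dvel3 (inclusion u) = velocityDeriv u := rfl

/-- The pairing of a test function with `(1 - ∂_x²)² w`. -/
noncomputable def pairing (φ : ℝ → ℝ) (w : Sobolev 3) : ℝ :=
  (∫ x, vel3 w x * φ x) + ∫ x, dvel3 w x * deriv φ x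

theorem integral_sub_mul (f g : L2) {φ : ℝ → ℝ} (hφ : IsTestFunction φ) :
    ∫ x, (f - g : L2) x * φ x = (∫ x, f x * φ x) - ∫ x, g x * φ x := by
  rw [← integral_sub (hφ.integrable_mul f) (hφ.integrable_mul g)]
  refine integral_congr_ae ?_
  filter_upwards [Lp.coeFn_sub f g] with x hx
  rw [hx, Pi.sub_apply, sub_mul]

theorem integral_add_mul (f g : L2) {φ : ℝ → ℝ} (hφ : IsTestFunction φ) :
    ∫ x, (f + g : L2) x * φ x = (∫ x, f x * φ x) + ∫ x, g x * φ x := by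
  rw [← integral_add (hφ.integrable_mul f) (hφ.integrable_mul g)]
  refine integral_congr_ae ?_
  filter_upwards [Lp.coeFn_add f g] with x hx
  rw [hx, Pi.add_apply, add_mul]

/-- An element of `H³` admits three of the four integrations by parts; the last derivative stays on
the test function. -/
theorem pairing_eq_integral {φ : ℝ → ℝ} (hφ : IsTestFunction φ) (w : Sobolev 3) :
    ∫ x, wderiv w 0 x * (φ x - 2 * iteratedDeriv 2 φ x + iteratedDeriv 4 φ x) = pairing φ w := by
  have d1 := hφ.deriv
  have d2 := d1.deriv
  have d3 := d2.deriv
  have d4 := d3.deriv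
  have e2 : iteratedDeriv 2 φ = deriv (deriv φ) := by simp [iteratedDeriv_succ, iteratedDeriv_zero]
  have e4 : iteratedDeriv 4 φ = deriv (deriv (deriv (deriv φ))) := by
    simp [iteratedDeriv_succ, iteratedDeriv_zero]
  rw [e2, e4]
  have s : ∀ x, wderiv w 0 x * (φ x - 2 * deriv (deriv φ) x + deriv (deriv (deriv (deriv φ))) x)
      = wderiv w 0 x * φ x - 2 * (wderiv w 0 x * deriv (deriv φ) x)
        + wderiv w 0 x * deriv (deriv (deriv (deriv φ))) x := fun x => by ring
  simp_rw [s]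
  have i0 := hφ.integrable_mul (wderiv w 0)
  have i2 := (d2.integrable_mul (wderiv w 0)).const_mul 2
  have i4 := d4.integrable_mul (wderiv w 0)
  have i02 : Integrable fun x =>
    wderiv w 0 x * φ x - 2 * (wderiv w 0 x * deriv (deriv φ) x) := i0.sub i2
  rw [integral_add i02 i4, integral_sub i0 i2, integral_const_mul]
  have w0 := isWeakDeriv_wderiv w 0
  have w1 := isWeakDeriv_wderiv w 1
  have w2 := isWeakDeriv_wderiv w 2
  have a1 := w0 _ d1
  have a2 := w1 _ hφ
  have b1 := w0 _ d3
  have b2 := w1 _ d2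
  have b3 := w2 _ d1
  simp only [Fin.isValue, Fin.castSucc_zero, Fin.succ_zero_eq_one] at *
  change _ = -∫ x, wderiv w 2 x * _ at a2
  change ∫ x, wderiv w 1 x * _ = _ at a2
  change ∫ x, wderiv w 1 x * _ = -∫ x, wderiv w 2 x * _ at b2
  change ∫ x, wderiv w 2 x * _ = -∫ x, wderiv w 3 x * _ at b3
  unfold pairing
  change _ = (∫ x, (wderiv w 0 - wderiv w 2 : L2) x * φ x)
    + ∫ x, (wderiv w 1 - wderiv w 3 : L2) x * deriv φ x
  rw [integral_sub_mul _ _ hφ, integral_sub_mul _ _ d1]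
  linarith

/-- With `V = (1 - ∂_x²) w` the equation reads `(V_x - v m)_x = V + v_x m`. In this form it is a
relation between `L²` functions to which integration by parts in `H¹` applies. -/
theorem satisfiesEquation_iff (u : Sobolev 4) (w : Sobolev 3) :
    SatisfiesEquation u w ↔
      IsWeakDeriv (dvel3 w - flux (momentum u)) (vel3 w + source (momentum u)) := by
  unfold SatisfiesEquation IsWeakDeriv
  refine forall₂_congr fun φ hφ => ?_
  rw [pairing_eq_integral hφ, integral_sub_mul _ _ hφ.deriv, integral_add_mul _ _ hφ]
  have e1 : ∫ x, velocity u x * momentum u x * deriv φ x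
      = ∫ x, flux (momentum u) x * deriv φ x := by
    refine integral_congr_ae ?_
    filter_upwards [coeFn_flux (momentum u)] with x hx
    rw [hx, (velocity_eq_green u).1]
  have e2 : ∫ x, velocityDeriv u x * momentum u x * φ x
      = ∫ x, source (momentum u) x * φ x := by
    refine integral_congr_ae ?_
    filter_upwards [coeFn_source (momentum u)] with x hx
    rw [hx, (velocity_eq_green u).2]
  rw [e1, e2, pairing]
  constructor <;> intro h <;> linarith

theorem vel3_rate (m : L2) : vel3 (rate m) = -(dgreen (flux m) + green (source m)) := by
  have h1 : vel3 (tailL (solve (flux m))) = dgreen (flux m) := velocityDeriv_solve _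
  have h2 : vel3 (inclusionL (solve (source m))) = green (source m) := velocity_solve _
  rw [rate, map_neg, map_add, h1, h2]

theorem dvel3_rate (m : L2) :
    dvel3 (rate m) = -(green (flux m) - flux m + dgreen (source m)) := by
  have h1 : dvel3 (tailL (solve (flux m))) = green (flux m) - flux m := by
    change (green (green (flux m)) - green (flux m))
      - (green (green (flux m)) - green (flux m) - (green (flux m) - flux m)) = _
    abel
  have h2 : dvel3 (inclusionL (solve (source m))) = dgreen (source m) := velocityDeriv_solve _
  rw [rate, map_neg, map_add, h1, h2]

theorem isWeakDeriv_rate (m : L2) :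
    IsWeakDeriv (dvel3 (rate m) - flux m) (vel3 (rate m) + source m) := by
  rw [vel3_rate, dvel3_rate]
  have := ((isWeakDeriv_green (flux m)).add (isWeakDeriv_dgreen (source m))).neg
  convert this using 1 <;> abel

theorem satisfiesEquation_rate (m : L2) : SatisfiesEquation (solve m) (rate m) := by
  rw [satisfiesEquation_iff, momentum_solve]
  exact isWeakDeriv_rate m

theorem pairing_rate (m : L2) {φ : ℝ → ℝ} (hφ : IsTestFunction φ) :
    pairing φ (rate m) = (∫ x, flux m x * deriv φ x) - ∫ x, source m x * φ x := by
  have h := isWeakDeriv_rate m φ hφ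
  rw [integral_sub_mul _ _ hφ.deriv, integral_add_mul _ _ hφ] at h
  unfold pairing
  linarith

theorem pairing_inclusion (u : Sobolev 4) {φ : ℝ → ℝ} (hφ : IsTestFunction φ) :
    pairing φ (inclusion u) = ∫ x, momentum u x * φ x := by
  unfold pairing
  rw [vel3_inclusion, dvel3_inclusion, isWeakDeriv_velocityDeriv u φ hφ,
    integral_sub_mul _ _ hφ]
  ring

theorem eq_zero_of_pairing_eq_zero {w : Sobolev 3}
    (h : ∀ φ : ℝ → ℝ, IsTestFunction φ → pairing φ w = 0) : w = 0 := by
  have h1 : IsWeakDeriv (dvel3 w) (vel3 w) := fun φ hφ => by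
    have := h φ hφ
    unfold pairing at this
    linarith
  have h2 := (eq_green (isWeakDeriv_vel3 w) h1).1
  rw [sub_self, map_zero] at h2
  have h3 := (eq_green (isWeakDeriv_wderiv w 0) (isWeakDeriv_wderiv w 1)).1
  have h4 : wderiv w (0 : Fin 3).castSucc - wderiv w (1 : Fin 3).succ = 0 := h2
  rw [h4, map_zero] at h3
  exact Sobolev.ext_zero h3

/-- The pairing as a continuous linear functional. -/
noncomputable def pairingL {φ : ℝ → ℝ} (hφ : IsTestFunction φ) : Sobolev 3 →L[ℝ] ℝ :=
  (innerSL ℝ (hφ.memLp.toLp φ)) ∘L vel3 + (innerSL ℝ (hφ.deriv.memLp.toLp (deriv φ))) ∘L dvel3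

theorem pairingL_apply {φ : ℝ → ℝ} (hφ : IsTestFunction φ) (w : Sobolev 3) :
    pairingL hφ w = pairing φ w := by
  have e : ∀ (f : L2) {ψ : ℝ → ℝ} (hψ : MemLp ψ 2), inner ℝ (hψ.toLp ψ) f = ∫ x, f x * ψ x := by
    intro f ψ hψ
    rw [inner_eq_integral]
    exact integral_congr_ae (by filter_upwards [hψ.coeFn_toLp] with x hx; rw [hx, mul_comm])
  unfold pairing
  rw [← e _ hφ.memLp, ← e _ hφ.deriv.memLp]
  rfl

/-- A curve of momenta satisfying the equation in weak form is differentiable in `H³`. -/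
theorem hasDerivAt_inclusion_solve {m : ℝ → L2} {a b : ℝ} (hm : ContinuousOn m (Ioo a b))
    (hw : ∀ φ : ℝ → ℝ, IsTestFunction φ → ∀ t ∈ Ioo a b,
      HasDerivAt (fun t => ∫ x, m t x * φ x)
        ((∫ x, flux (m t) x * deriv φ x) - ∫ x, source (m t) x * φ x) t)
    {t : ℝ} (ht : t ∈ Ioo a b) :
    HasDerivAt (fun t => inclusion (solve (m t))) (rate (m t)) t := by
  have hc : ContinuousOn (fun s => rate (m s)) (Ioo a b) := continuous_rate.comp_continuousOn hm
  -- The curve is compared with the primitive of the expected derivative. Every pairing of the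
  -- difference has derivative zero, and the pairings separate points of `H³`.
  set W : ℝ → Sobolev 3 := fun s => ∫ r in t..s, rate (m r) with hW
  have hW' : ∀ s ∈ Ioo a b, HasDerivAt W (rate (m s)) s := by
    intro s hs
    refine intervalIntegral.integral_hasDerivAt_right ?_ ?_ ?_
    · refine (hc.mono ?_).intervalIntegrable
      exact ordConnected_Ioo.uIcc_subset ht hs
    · have : SecondCountableTopologyEither ℝ (Sobolev 3) := secondCountableTopologyEither_of_left _ _
      exact hc.stronglyMeasurableAtFilter isOpen_Ioo s hs
    · exact hc.continuousAt (isOpen_Ioo.mem_nhds hs)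
  set D : ℝ → Sobolev 3 := fun s => inclusionL (solve (m s)) - W s with hD
  have hDc : ∀ s ∈ Ioo a b, D s = D t := by
    intro s hs
    rw [← sub_eq_zero]
    refine eq_zero_of_pairing_eq_zero fun φ hφ => ?_
    rw [← pairingL_apply hφ, map_sub, sub_eq_zero]
    have hd : ∀ r ∈ Ioo a b, HasDerivAt (fun r => pairingL hφ (D r)) 0 r := by
      intro r hr
      have h1 := (pairingL hφ).hasFDerivAt.comp_hasDerivAt r (hW' r hr)
      have h2 := (hw φ hφ r hr).sub h1
      have e : (fun r => pairingL hφ (D r)) = fun r => (∫ x, m r x * φ x) - pairingL hφ (W r) := by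
        ext r
        rw [hD, map_sub, pairingL_apply hφ (inclusionL _), inclusionL_apply, pairing_inclusion _ hφ,
          momentum_solve]
      rw [e]
      refine h2.congr_deriv ?_
      rw [pairingL_apply, pairing_rate _ hφ, sub_self]
    refine (convex_Ioo a b).is_const_of_fderivWithin_eq_zero (𝕜 := ℝ)
      (f := fun r => pairingL hφ (D r)) ?_ ?_ hs ht
    · intro r hr; exact (hd r hr).differentiableAt.differentiableWithinAt
    · intro r hr
      rw [fderivWithin_of_isOpen isOpen_Ioo hr]
      ext
      simpa using (hd r hr).deriv
  refine ((hW' t ht).const_add (D t)).congr_of_eventuallyEq ?_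
  filter_upwards [isOpen_Ioo.mem_nhds ht] with s hs
  rw [← hDc s hs]
  exact (sub_add_cancel (inclusionL (solve (m s))) (W s)).symm

/-! ### Uniqueness -/

theorem ae_green_eq (m : L2) :
    green m =ᵐ[volume] fun x => (Rfun true m x + Rfun false m x) / 2 := by
  rw [green_apply]
  filter_upwards [Lp.coeFn_smul (1 / 2 : ℝ) (resolvent true m + resolvent false m),
    Lp.coeFn_add (resolvent true m) (resolvent false m), coeFn_resolvent true m,
    coeFn_resolvent false m] with x h1 h2 h3 h4
  rw [h1, Pi.smul_apply, h2, Pi.add_apply, h3, h4, smul_eq_mul]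
  ring

theorem ae_dgreen_eq (m : L2) :
    dgreen m =ᵐ[volume] fun x => (Rfun false m x - Rfun true m x) / 2 := by
  rw [dgreen_apply]
  filter_upwards [Lp.coeFn_smul (1 / 2 : ℝ) (resolvent false m - resolvent true m),
    Lp.coeFn_sub (resolvent false m) (resolvent true m), coeFn_resolvent true m,
    coeFn_resolvent false m] with x h1 h2 h3 h4
  rw [h1, Pi.smul_apply, h2, Pi.sub_apply, h3, h4, smul_eq_mul]
  ring

theorem ae_abs_green_le (m : L2) : ∀ᵐ x, |green m x| ≤ ‖m‖ := by
  filter_upwards [ae_green_eq m] with x hx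
  have h1 := abs_le.1 (abs_Rfun_le true m x)
  have h2 := abs_le.1 (abs_Rfun_le false m x)
  rw [hx, abs_le]
  constructor <;> linarith

theorem ae_abs_dgreen_le (m : L2) : ∀ᵐ x, |dgreen m x| ≤ ‖m‖ := by
  filter_upwards [ae_dgreen_eq m] with x hx
  have h1 := abs_le.1 (abs_Rfun_le true m x)
  have h2 := abs_le.1 (abs_Rfun_le false m x)
  rw [hx, abs_le]
  constructor <;> linarith

theorem norm_green_le (m : L2) : ‖green m‖ ≤ ‖m‖ := by
  rw [green_apply, norm_smul, Real.norm_of_nonneg (by norm_num)]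
  have := norm_add_le (resolvent true m) (resolvent false m)
  linarith [norm_resolvent_le true m, norm_resolvent_le false m]

theorem norm_mulH_le {A : Sobolev 1} {C : ℝ} (hA : ∀ᵐ x, |wderiv A 0 x| ≤ C) (f : L2) :
    ‖mulH A f‖ ≤ C * ‖f‖ := by
  refine Lp.norm_le_mul_norm_of_ae_le_mul ?_
  filter_upwards [coeFn_mulH A f, hA] with x hx hx'
  rw [hx, norm_mul, Real.norm_eq_abs]
  exact mul_le_mul_of_nonneg_right hx' (norm_nonneg _)

theorem inner_mulH (A F : Sobolev 1) (g : L2) :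
    inner ℝ (wderiv A 0) (mulH F g) = inner ℝ (mulH A (wderiv F 0)) g := by
  rw [inner_eq_integral, inner_eq_integral]
  refine integral_congr_ae ?_
  filter_upwards [coeFn_mulH F g, coeFn_mulH A (wderiv F 0)] with x h1 h2
  rw [h1, h2, mul_assoc]

theorem abs_inner_mulH_le {A : Sobolev 1} {C : ℝ} (hA : ∀ᵐ x, |wderiv A 0 x| ≤ C)
    (F : Sobolev 1) (g : L2) :
    |inner ℝ (wderiv A 0) (mulH F g)| ≤ C * ‖wderiv F 0‖ * ‖g‖ := by
  rw [inner_mulH]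
  exact (abs_real_inner_le_norm _ _).trans
    (mul_le_mul_of_nonneg_right (norm_mulH_le hA _) (norm_nonneg _))

/-- For `z = green n` and `v = green m`, all terms cancel pointwise except `(v z_x - v_x z) n`. On
the right `n` is replaced by `z - z_xx`, with `z_xx` written `green n - n`. -/
theorem inner_flux_sub_inner_source (m n : L2) :
    inner ℝ (flux (m + n) - flux m) (dgreen n) - inner ℝ (source (m + n) - source m) (green n)
      = inner ℝ (green m) (mulH (velocityH n) (dgreen n))
        - inner ℝ (green m) (mulH (velocityDerivH n) (green n - n))
        - inner ℝ (dgreen m) (mulH (velocityH n) (green n))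
        + inner ℝ (dgreen m) (mulH (velocityH n) (green n - n)) := by
  simp only [inner_eq_integral]
  rw [← integral_sub (integrable_mul _ _) (integrable_mul _ _),
    ← integral_sub (integrable_mul _ _) (integrable_mul _ _)]
  have i1 : Integrable fun x => green m x * mulH (velocityH n) (dgreen n) x
      - green m x * mulH (velocityDerivH n) (green n - n) x :=
    (integrable_mul _ _).sub (integrable_mul _ _)
  have i2 : Integrable fun x => green m x * mulH (velocityH n) (dgreen n) x
      - green m x * mulH (velocityDerivH n) (green n - n) x
      - dgreen m x * mulH (velocityH n) (green n) x := i1.sub (integrable_mul _ _)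
  rw [← integral_sub i1 (integrable_mul _ _), ← integral_add i2 (integrable_mul _ _)]
  refine integral_congr_ae ?_
  have g1 : green (m + n) =ᵐ[volume] fun x => green m x + green n x := by
    rw [map_add]; exact Lp.coeFn_add _ _
  have g2 : dgreen (m + n) =ᵐ[volume] fun x => dgreen m x + dgreen n x := by
    rw [map_add]; exact Lp.coeFn_add _ _
  have p1 : mulH (velocityH n) (dgreen n) =ᵐ[volume] fun x => green n x * dgreen n x :=
    coeFn_mulH _ _
  have p2 : mulH (velocityDerivH n) (green n - n) =ᵐ[volume]
      fun x => dgreen n x * (green n - n : L2) x := coeFn_mulH _ _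
  have p3 : mulH (velocityH n) (green n) =ᵐ[volume] fun x => green n x * green n x :=
    coeFn_mulH _ _
  have p4 : mulH (velocityH n) (green n - n) =ᵐ[volume]
      fun x => green n x * (green n - n : L2) x := coeFn_mulH _ _
  filter_upwards [Lp.coeFn_sub (flux (m + n)) (flux m), Lp.coeFn_sub (source (m + n)) (source m),
    coeFn_flux (m + n), coeFn_flux m, coeFn_source (m + n), coeFn_source m, Lp.coeFn_add m n,
    g1, g2, p1, p2, p3, p4, Lp.coeFn_sub (green n) n]
    with x h1 h2 h3 h4 h5 h6 h7 h8 h9 q1 q2 q3 q4 q5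
  rw [h1, h2, q1, q2, q3, q4, q5]
  simp only [Pi.sub_apply]
  rw [h3, h4, h5, h6, h7, h8, h9]
  simp only [Pi.add_apply]
  ring

/-- The terms with `z_xx` are removed through `2 z_x z_xx = (z_x²)_x` and `z z_xx = (z z_x)_x -
z_x²`, so that only the `H¹` norm of `z` enters. The four bounds contribute `1 + 1/2 + 1 + (1 + 4) ≤
8`. -/
theorem abs_inner_flux_sub_inner_source_le (m n : L2) :
    |inner ℝ (flux (m + n) - flux m) (dgreen n) - inner ℝ (source (m + n) - source m) (green n)|
      ≤ 8 * ‖m‖ * (‖green n‖ ^ 2 + ‖dgreen n‖ ^ 2) := by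
  rw [inner_flux_sub_inner_source]
  have w1 : IsWeakDeriv (mulH (velocityDerivH n) (dgreen n))
      ((2 : ℝ) • mulH (velocityDerivH n) (green n - n)) := by
    refine (isWeakDeriv_dgreen n).mul (isWeakDeriv_dgreen n) (coeFn_mulH _ _) ?_
    have p : mulH (velocityDerivH n) (green n - n) =ᵐ[volume]
      fun x => dgreen n x * (green n - n : L2) x := coeFn_mulH _ _
    filter_upwards [Lp.coeFn_smul (2 : ℝ) (mulH (velocityDerivH n) (green n - n)), p] with x h1 h2
    rw [h1, Pi.smul_apply, h2, smul_eq_mul]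
    ring
  have w2 : IsWeakDeriv (mulH (velocityH n) (dgreen n))
      (mulH (velocityDerivH n) (dgreen n) + mulH (velocityH n) (green n - n)) := by
    refine (isWeakDeriv_green n).mul (isWeakDeriv_dgreen n) (coeFn_mulH _ _) ?_
    have p : mulH (velocityDerivH n) (dgreen n) =ᵐ[volume]
      fun x => dgreen n x * dgreen n x := coeFn_mulH _ _
    have p' : mulH (velocityH n) (green n - n) =ᵐ[volume]
      fun x => green n x * (green n - n : L2) x := coeFn_mulH _ _
    filter_upwards [Lp.coeFn_add (mulH (velocityDerivH n) (dgreen n))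
      (mulH (velocityH n) (green n - n)), p, p'] with x h1 h2 h3
    rw [h1, Pi.add_apply, h2, h3]
  have k1 := (isWeakDeriv_green m).inner_eq w1
  have k2 := (isWeakDeriv_dgreen m).inner_eq w2
  rw [inner_smul_right] at k1
  rw [inner_add_right] at k2
  have b1 : |inner ℝ (green m) (mulH (velocityH n) (dgreen n))| ≤ ‖m‖ * ‖green n‖ * ‖dgreen n‖ :=
    abs_inner_mulH_le (A := velocityH m) (ae_abs_green_le m) (velocityH n) (dgreen n)
  have b2 : |inner ℝ (dgreen m) (mulH (velocityDerivH n) (dgreen n))|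
      ≤ ‖m‖ * ‖dgreen n‖ * ‖dgreen n‖ :=
    abs_inner_mulH_le (A := velocityDerivH m) (ae_abs_dgreen_le m) (velocityDerivH n) (dgreen n)
  have b3 : |inner ℝ (dgreen m) (mulH (velocityH n) (green n))| ≤ ‖m‖ * ‖green n‖ * ‖green n‖ :=
    abs_inner_mulH_le (A := velocityDerivH m) (ae_abs_dgreen_le m) (velocityH n) (green n)
  have b4 : |inner ℝ (green m - m) (mulH (velocityH n) (dgreen n))|
      ≤ (2 * ‖m‖) * ((‖green n‖ + ‖dgreen n‖) * ‖dgreen n‖) := by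
    -- Here `v_xx = v - m` is only in `L²`, so the sup norm is put on `z` instead.
    refine (abs_real_inner_le_norm _ _).trans (mul_le_mul ?_ ?_ (norm_nonneg _) (by positivity))
    · refine (norm_sub_le _ _).trans ?_
      linarith [norm_green_le m]
    · exact norm_mulH_le (A := velocityH n) (isWeakDeriv_green n).ae_abs_le _
  set X := ‖green n‖
  set Y := ‖dgreen n‖
  set K := ‖m‖
  have hX : 0 ≤ X := norm_nonneg _
  have hY : 0 ≤ Y := norm_nonneg _
  have hK : 0 ≤ K := norm_nonneg _
  have c1 : K * X * Y ≤ K * (X ^ 2 + Y ^ 2) := by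
    rw [mul_assoc]; exact mul_le_mul_of_nonneg_left (by nlinarith [sq_nonneg (X - Y)]) hK
  have c2 : K * Y * Y ≤ K * (X ^ 2 + Y ^ 2) := by
    rw [mul_assoc]; exact mul_le_mul_of_nonneg_left (by nlinarith) hK
  have c3 : K * X * X ≤ K * (X ^ 2 + Y ^ 2) := by
    rw [mul_assoc]; exact mul_le_mul_of_nonneg_left (by nlinarith) hK
  have c4 : (2 * K) * ((X + Y) * Y) ≤ 4 * (K * (X ^ 2 + Y ^ 2)) := by
    have : (2 * K) * ((X + Y) * Y) = 2 * (K * X * Y) + 2 * (K * Y * Y) := by ring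
    linarith
  rw [abs_le] at b1 b2 b3 b4 ⊢
  have c0 : 0 ≤ K * (X ^ 2 + Y ^ 2) := by positivity
  have e : 8 * K * (X ^ 2 + Y ^ 2) = 8 * (K * (X ^ 2 + Y ^ 2)) := by ring
  rw [e]
  constructor <;> linarith [b1.1, b1.2, b2.1, b2.2, b3.1, b3.2, b4.1, b4.2]

/-- `u` solves the evolution equation on the set of times `s`. -/
def SolvesOn (s : Set ℝ) (u : ℝ → Sobolev 4) : Prop :=
  ContinuousOn u s ∧ ∃ w : ℝ → Sobolev 3, ContinuousOn w s ∧
    ∀ t ∈ s, HasDerivWithinAt (fun r => inclusion (u r)) (w t) s t ∧ SatisfiesEquation (u t) (w t)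

theorem SolvesOn.mono {s t : Set ℝ} {u : ℝ → Sobolev 4} (h : SolvesOn t u) (hst : s ⊆ t) :
    SolvesOn s u := by
  obtain ⟨h1, w, h2, h3⟩ := h
  exact ⟨h1.mono hst, w, h2.mono hst, fun r hr => ⟨(h3 r (hst hr)).1.mono hst, (h3 r (hst hr)).2⟩⟩

/-- Energy method: `E` is the squared `H¹` norm of the difference of the velocities, and testing the
subtracted equations with that difference gives `|E'| ≤ 16 K E`, where `K` bounds the momentum of
`v`. Grönwall's inequality then forces `E = 0`. -/
theorem SolvesOn.eqOn_Icc {u v : ℝ → Sobolev 4} {a b : ℝ} (hu : SolvesOn (Icc a b) u)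
    (hv : SolvesOn (Icc a b) v) (h0 : u a = v a) : EqOn u v (Icc a b) := by
  obtain ⟨cu, w, -, hw⟩ := hu
  obtain ⟨cv, y, -, hy⟩ := hv
  set z : ℝ → L2 := fun t => vel3 (inclusionL (u t) - inclusionL (v t)) with hz
  set z' : ℝ → L2 := fun t => dvel3 (inclusionL (u t) - inclusionL (v t)) with hz'
  set E : ℝ → ℝ := fun t => ‖z t‖ ^ 2 + ‖z' t‖ ^ 2 with hE
  set E' : ℝ → ℝ := fun t =>
    2 * inner ℝ (z t) (vel3 (w t - y t)) + 2 * inner ℝ (z' t) (dvel3 (w t - y t)) with hE'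
  have hd : ∀ t ∈ Icc a b, HasDerivWithinAt E (E' t) (Icc a b) t := by
    intro t ht
    have d := (hw t ht).1.sub (hy t ht).1
    exact (vel3.hasFDerivAt.comp_hasDerivWithinAt t d).norm_sq.add
      (dvel3.hasFDerivAt.comp_hasDerivWithinAt t d).norm_sq
  have hc : ContinuousOn E (Icc a b) := fun t ht => (hd t ht).continuousWithinAt
  obtain ⟨K, hK⟩ := isCompact_Icc.exists_bound_of_continuousOn
    (momentumL.continuous.comp_continuousOn cv)
  have hzg : ∀ t, z t = green (momentumL (u t) - momentumL (v t)) := by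
    intro t
    rw [hz]
    simp only [map_sub, momentumL_apply, ← (velocity_eq_green _).1]
    rfl
  have hzg' : ∀ t, z' t = dgreen (momentumL (u t) - momentumL (v t)) := by
    intro t
    rw [hz']
    simp only [map_sub, momentumL_apply, ← (velocity_eq_green _).2]
    rfl
  have bound : ∀ t ∈ Ico a b, ‖E' t‖ ≤ (16 * K) * ‖E t‖ := by
    intro t ht
    have ht' := Ico_subset_Icc_self ht
    have s1 := (satisfiesEquation_iff _ _).1 (hw t ht').2
    have s2 := (satisfiesEquation_iff _ _).1 (hy t ht').2
    have s3 := (s1.sub s2).inner_eq (isWeakDeriv_vel3 (inclusionL (u t) - inclusionL (v t)))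
    change inner ℝ _ (z' t) = -inner ℝ _ (z t) at s3
    have key := abs_inner_flux_sub_inner_source_le (momentumL (v t))
      (momentumL (u t) - momentumL (v t))
    rw [← hzg, ← hzg', add_sub_cancel] at key
    have e : E' t = 2 * (inner ℝ (flux (momentumL (u t)) - flux (momentumL (v t))) (z' t)
        - inner ℝ (source (momentumL (u t)) - source (momentumL (v t))) (z t)) := by
      rw [hE']
      simp only [map_sub, inner_sub_left, inner_add_left,
        real_inner_comm _ (z t), real_inner_comm _ (z' t), momentumL_apply] at s3 ⊢
      linarith
    rw [e, norm_mul, Real.norm_of_nonneg (zero_le_two (α := ℝ)), Real.norm_eq_abs,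
      Real.norm_of_nonneg (by positivity : 0 ≤ E t)]
    have hK' : ‖momentumL (v t)‖ ≤ K := hK t ht'
    have hE0 : 0 ≤ E t := by positivity
    have : 8 * ‖momentumL (v t)‖ * E t ≤ 8 * K * E t := by gcongr
    linarith
  have hzero := eq_zero_of_abs_deriv_le_mul_abs_self_of_eq_zero_right hc
    (fun t ht => (hd t (Ico_subset_Icc_self ht)).mono_of_mem_nhdsWithin
      (Icc_mem_nhdsGE_of_mem ht)) (by simp [hE, hz, hz', h0]) bound
  intro t ht
  have h1 : z t = 0 := by
    have h2 := hzero t ht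
    have h3 : ‖z t‖ ^ 2 = 0 := by
      have := sq_nonneg ‖z' t‖
      have := sq_nonneg ‖z t‖
      simp only [hE] at h2
      linarith
    simpa using h3
  have h2 : z' t = 0 := by
    have h2 := hzero t ht
    have h3 : ‖z' t‖ ^ 2 = 0 := by
      have := sq_nonneg ‖z' t‖
      have := sq_nonneg ‖z t‖
      simp only [hE] at h2
      linarith
    simpa using h3
  -- The difference of the momenta is `z - z_xx`, hence vanishes with `z` and `z_x`.
  have h3 : IsWeakDeriv (z' t) (z t - (momentumL (u t) - momentumL (v t))) := by
    rw [hzg, hzg']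
    exact isWeakDeriv_dgreen _
  rw [h1, h2, zero_sub] at h3
  have h4 := h3.unique isWeakDeriv_zero
  rw [neg_eq_zero, sub_eq_zero] at h4
  rw [← solve_momentum (u t), ← solve_momentum (v t)]
  exact congrArg solve h4

/-! ### Lagrangian coordinates -/

open scoped BoundedContinuousFunction

/-- The densities of the flow maps that are used: those close to `1`. -/
def Admissible (p : ℝ →ᵇ ℝ) : Prop := ∀ x, 1 / 2 ≤ p x ∧ p x ≤ 3 / 2

theorem admissible_of_mem_closedBall {p : ℝ →ᵇ ℝ} (hp : ‖p - 1‖ ≤ 1 / 2) : Admissible p := by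
  intro x
  have := ((p - 1).norm_coe_le_norm x).trans hp
  rw [Real.norm_eq_abs, abs_le] at this
  simp only [BoundedContinuousFunction.coe_sub, BoundedContinuousFunction.coe_one, Pi.sub_apply,
    Pi.one_apply] at this
  constructor <;> linarith [this.1, this.2]

/-- The flow map with density `p` that maps `0` to `c`. -/
noncomputable def flowMap (c : ℝ) (p : ℝ →ᵇ ℝ) (x : ℝ) : ℝ := c + ∫ y in (0 : ℝ)..x, p y

theorem hasDerivAt_flowMap (c : ℝ) (p : ℝ →ᵇ ℝ) (x : ℝ) : HasDerivAt (flowMap c p) (p x) x :=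
  (intervalIntegral.integral_hasDerivAt_right (p.continuous.intervalIntegrable _ _)
    (p.continuous.stronglyMeasurableAtFilter _ _) p.continuous.continuousAt).const_add c

theorem continuous_flowMap (c : ℝ) (p : ℝ →ᵇ ℝ) : Continuous (flowMap c p) :=
  continuous_iff_continuousAt.2 fun x => (hasDerivAt_flowMap c p x).continuousAt

theorem flowMap_sub (c : ℝ) (p : ℝ →ᵇ ℝ) (x y : ℝ) :
    flowMap c p x - flowMap c p y = ∫ z in y..x, p z := by
  unfold flowMap
  rw [add_sub_add_left_eq_sub, intervalIntegral.integral_interval_sub_left] <;>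
  exact p.continuous.intervalIntegrable _ _

theorem abs_flowMap_sub_sub_le (p q : ℝ →ᵇ ℝ) (c d x y : ℝ) :
    |(flowMap c p x - flowMap c p y) - (flowMap d q x - flowMap d q y)| ≤ ‖p - q‖ * |x - y| := by
  rw [flowMap_sub, flowMap_sub, ← intervalIntegral.integral_sub (p.continuous.intervalIntegrable _ _)
    (q.continuous.intervalIntegrable _ _)]
  exact intervalIntegral.norm_integral_le_of_norm_le_const
    fun z _ => (p - q).norm_coe_le_norm z

theorem half_sub_le_flowMap_sub {p : ℝ →ᵇ ℝ} (hp : Admissible p) (c : ℝ) {x y : ℝ} (h : y ≤ x) :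
    (x - y) / 2 ≤ flowMap c p x - flowMap c p y := by
  rw [flowMap_sub]
  have := intervalIntegral.integral_mono_on h (f := fun _ => (1 / 2 : ℝ)) (μ := volume)
    intervalIntegrable_const (p.continuous.intervalIntegrable _ _) fun z _ => (hp z).1
  rw [intervalIntegral.integral_const, smul_eq_mul] at this
  linarith

theorem half_abs_sub_le_abs_flowMap_sub {p : ℝ →ᵇ ℝ} (hp : Admissible p) (c x y : ℝ) :
    |x - y| / 2 ≤ |flowMap c p x - flowMap c p y| := by
  rcases le_total y x with h | h
  · have := half_sub_le_flowMap_sub hp c h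
    rw [abs_of_nonneg (sub_nonneg.2 h)]
    exact this.trans (le_abs_self _)
  · have := half_sub_le_flowMap_sub hp c h
    rw [abs_sub_comm x, abs_sub_comm (flowMap c p x), abs_of_nonneg (sub_nonneg.2 h)]
    exact this.trans (le_abs_self _)

theorem strictMono_flowMap {p : ℝ →ᵇ ℝ} (hp : Admissible p) (c : ℝ) :
    StrictMono (flowMap c p) := by
  intro y x h
  have := half_sub_le_flowMap_sub hp c h.le
  linarith

theorem surjective_flowMap {p : ℝ →ᵇ ℝ} (hp : Admissible p) (c : ℝ) :
    Function.Surjective (flowMap c p) := by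
  refine (continuous_flowMap c p).surjective ?_ ?_
  · refine tendsto_atTop_mono' _ (f₁ := fun x => flowMap c p 0 + x / 2) ?_
      (tendsto_atTop_add_const_left _ _ (tendsto_id.atTop_div_const two_pos))
    filter_upwards [eventually_ge_atTop 0] with x hx
    have := half_sub_le_flowMap_sub hp c hx
    simp only [sub_zero] at this
    linarith
  · refine tendsto_atBot_mono' _ (f₂ := flowMap c p) (f₁ := fun x => flowMap c p 0 + x / 2) ?_
      (tendsto_atBot_add_const_left _ _ (tendsto_id.atBot_div_const two_pos))
    filter_upwards [eventually_le_atBot 0] with x hx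
    have := half_sub_le_flowMap_sub hp c hx
    simp only [zero_sub] at this
    linarith

/-- The inverse of the flow map. -/
noncomputable def flowInv (c : ℝ) (p : ℝ →ᵇ ℝ) : ℝ → ℝ := Function.invFun (flowMap c p)

theorem flowInv_flowMap {p : ℝ →ᵇ ℝ} (hp : Admissible p) (c x : ℝ) :
    flowInv c p (flowMap c p x) = x :=
  Function.leftInverse_invFun (strictMono_flowMap hp c).injective x

theorem flowMap_flowInv {p : ℝ →ᵇ ℝ} (hp : Admissible p) (c z : ℝ) :
    flowMap c p (flowInv c p z) = z :=
  Function.rightInverse_invFun (surjective_flowMap hp c) z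

theorem measurable_flowInv {p : ℝ →ᵇ ℝ} (hp : Admissible p) (c : ℝ) :
    Measurable (flowInv c p) := by
  refine Monotone.measurable fun y z h => ?_
  by_contra! h'
  have := strictMono_flowMap hp c h'
  rw [flowMap_flowInv hp, flowMap_flowInv hp] at this
  linarith

theorem integral_comp_flowMap {p : ℝ →ᵇ ℝ} (hp : Admissible p) (c : ℝ) (f : ℝ → ℝ) :
    ∫ z, f z = ∫ x, p x * f (flowMap c p x) := by
  have h := integral_image_eq_integral_abs_deriv_smul (s := univ) MeasurableSet.univ
    (fun x _ => (hasDerivAt_flowMap c p x).hasDerivWithinAt)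
    (strictMono_flowMap hp c).injective.injOn f
  rw [image_univ, (surjective_flowMap hp c).range_eq, setIntegral_univ, setIntegral_univ] at h
  rw [h]
  congr 1; ext x
  rw [abs_of_nonneg (by linarith [(hp x).1]), smul_eq_mul]

theorem integrable_comp_flowMap {p : ℝ →ᵇ ℝ} (hp : Admissible p) (c : ℝ) (f : ℝ → ℝ) :
    Integrable f ↔ Integrable fun x => p x * f (flowMap c p x) := by
  have h := integrableOn_image_iff_integrableOn_abs_deriv_smul (s := univ) MeasurableSet.univ
    (fun x _ => (hasDerivAt_flowMap c p x).hasDerivWithinAt)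
    (strictMono_flowMap hp c).injective.injOn f
  rw [image_univ, (surjective_flowMap hp c).range_eq, integrableOn_univ, integrableOn_univ] at h
  rw [h]
  refine integrable_congr (Eventually.of_forall fun x => ?_)
  simp only [smul_eq_mul]
  rw [abs_of_nonneg (by linarith [(hp x).1])]

/-! ### Transport of the momentum by a flow map -/

/-- The Eulerian momentum obtained by transporting `m₀`. -/
noncomputable def transport (m₀ : L2) (c : ℝ) (p : ℝ →ᵇ ℝ) (z : ℝ) : ℝ :=
  m₀ (flowInv c p z) / p (flowInv c p z) ^ 2

/-- This is the conservation law `m(q) q_x² = m₀` of the equation, with `q_x = p`. -/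
theorem transport_flowMap (m₀ : L2) (c : ℝ) {p : ℝ →ᵇ ℝ} (hp : Admissible p) (x : ℝ) :
    transport m₀ c p (flowMap c p x) = m₀ x / p x ^ 2 := by
  rw [transport, flowInv_flowMap hp]

theorem integral_transport_mul (m₀ : L2) (c : ℝ) {p : ℝ →ᵇ ℝ} (hp : Admissible p) (f : ℝ → ℝ) :
    ∫ z, transport m₀ c p z * f z = ∫ x, m₀ x / p x * f (flowMap c p x) := by
  rw [integral_comp_flowMap hp c]
  congr 1; ext x
  rw [transport_flowMap m₀ c hp]
  have : p x ≠ 0 := by linarith [(hp x).1]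
  field_simp

theorem measurable_bcf (p : ℝ →ᵇ ℝ) : Measurable p := p.continuous.measurable

theorem integrable_sq_div (m₀ : L2) {p : ℝ →ᵇ ℝ} (hp : Admissible p) :
    Integrable fun x => m₀ x ^ 2 / p x ^ 3 := by
  refine ((Lp.memLp m₀).integrable_sq.const_mul 8).mono' ?_ (Eventually.of_forall fun x => ?_)
  · exact ((Lp.memLp m₀).integrable_sq.1.aemeasurable.div
      ((measurable_bcf p).pow_const 3).aemeasurable).aestronglyMeasurable
  · have h := (hp x).1
    have h3 : (1 / 8 : ℝ) ≤ p x ^ 3 := by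
      have := pow_le_pow_left₀ (by norm_num) h 3
      norm_num at this ⊢
      exact this
    rw [Real.norm_of_nonneg (by positivity), div_le_iff₀ (by positivity)]
    nlinarith [sq_nonneg (m₀ x)]

theorem memLp_transport (m₀ : L2) (c : ℝ) {p : ℝ →ᵇ ℝ} (hp : Admissible p) :
    MemLp (transport m₀ c p) 2 := by
  have hm : Measurable (transport m₀ c p) :=
    ((Lp.stronglyMeasurable m₀).measurable.comp (measurable_flowInv hp c)).div
      (((measurable_bcf p).comp (measurable_flowInv hp c)).pow_const 2)
  rw [memLp_two_iff_integrable_sq hm.aestronglyMeasurable, integrable_comp_flowMap hp c]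
  refine (integrable_sq_div m₀ hp).congr (Eventually.of_forall fun x => ?_)
  have : p x ≠ 0 := by linarith [(hp x).1]
  simp only [transport_flowMap m₀ c hp]
  field_simp

theorem integral_sq_transport (m₀ : L2) (c : ℝ) {p : ℝ →ᵇ ℝ} (hp : Admissible p) :
    ∫ z, transport m₀ c p z ^ 2 = ∫ x, m₀ x ^ 2 / p x ^ 3 := by
  rw [integral_comp_flowMap hp c]
  congr 1; ext x
  have : p x ≠ 0 := by linarith [(hp x).1]
  rw [transport_flowMap m₀ c hp]
  field_simp

open Classical in
/-- The Eulerian momentum as an element of `L²`. -/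
noncomputable def transportL (m₀ : L2) (c : ℝ) (p : ℝ →ᵇ ℝ) : L2 :=
  if h : MemLp (transport m₀ c p) 2 then h.toLp _ else 0

theorem coeFn_transportL (m₀ : L2) (c : ℝ) {p : ℝ →ᵇ ℝ} (hp : Admissible p) :
    transportL m₀ c p =ᵐ[volume] transport m₀ c p := by
  rw [transportL, dif_pos (memLp_transport m₀ c hp)]
  exact MemLp.coeFn_toLp _

theorem norm_sq_transportL (m₀ : L2) (c : ℝ) {p : ℝ →ᵇ ℝ} (hp : Admissible p) :
    ‖transportL m₀ c p‖ ^ 2 = ∫ x, m₀ x ^ 2 / p x ^ 3 := by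
  rw [transportL, dif_pos (memLp_transport m₀ c hp), norm_toLp_sq, integral_sq_transport m₀ c hp]

/-- The constant comes from `1 / p³ ≤ 8 ≤ 3²`. -/
theorem norm_transportL_le (m₀ : L2) (c : ℝ) {p : ℝ →ᵇ ℝ} (hp : Admissible p) :
    ‖transportL m₀ c p‖ ≤ 3 * ‖m₀‖ := by
  refine le_of_sq_le_sq ?_ (by positivity)
  rw [norm_sq_transportL m₀ c hp, mul_pow, norm_sq_eq_integral, ← integral_const_mul]
  refine integral_mono (integrable_sq_div m₀ hp) ((Lp.memLp m₀).integrable_sq.const_mul _)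
    fun x => ?_
  have h := (hp x).1
  have h3 : (1 / 8 : ℝ) ≤ p x ^ 3 := by
    have := pow_le_pow_left₀ (by norm_num) h 3
    norm_num at this ⊢
    exact this
  simp only
  rw [div_le_iff₀ (by positivity)]
  nlinarith [sq_nonneg (m₀ x)]

theorem integral_transportL_mul (m₀ : L2) (c : ℝ) {p : ℝ →ᵇ ℝ} (hp : Admissible p) (f : ℝ → ℝ) :
    ∫ z, transportL m₀ c p z * f z = ∫ x, m₀ x / p x * f (flowMap c p x) := by
  rw [← integral_transport_mul m₀ c hp]
  exact integral_congr_ae (by filter_upwards [coeFn_transportL m₀ c hp] with z hz; rw [hz])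

theorem Rfun_transportL (b : Bool) (m₀ : L2) (c : ℝ) {p : ℝ →ᵇ ℝ} (hp : Admissible p) (x : ℝ) :
    Rfun b (transportL m₀ c p) (flowMap c p x)
      = ∫ y, m₀ y / p y * kern b (flowMap c p x - flowMap c p y) := by
  rw [← integral_transportL_mul m₀ c hp fun z => kern b (flowMap c p x - z)]
  unfold Rfun
  simp_rw [mul_comm]

/-- Lagrangian form of the resolvents, independent of the position of the flow map. -/
theorem Rfun_transportL_eq (b : Bool) (m₀ : L2) (c : ℝ) {p : ℝ →ᵇ ℝ} (hp : Admissible p) (x : ℝ) :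
    Rfun b (transportL m₀ c p) (flowMap c p x)
      = Rfun b (transportL m₀ 0 p) (flowMap 0 p x) := by
  rw [Rfun_transportL b m₀ c hp, Rfun_transportL b m₀ 0 hp]
  simp_rw [flowMap_sub]

/-- The resolvent of the transported momentum, in Lagrangian coordinates. -/
noncomputable def lag (b : Bool) (m₀ : L2) (p : ℝ →ᵇ ℝ) : ℝ →ᵇ ℝ :=
  BoundedContinuousFunction.ofNormedAddCommGroup
    (fun x => Rfun b (transportL m₀ 0 p) (flowMap 0 p x))
    ((continuous_Rfun b (Lp.memLp _)).comp (continuous_flowMap 0 p)) ‖transportL m₀ 0 p‖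
    fun _ => abs_Rfun_le b _ _

theorem lag_apply (b : Bool) (m₀ : L2) (c : ℝ) {p : ℝ →ᵇ ℝ} (hp : Admissible p) (x : ℝ) :
    lag b m₀ p x = Rfun b (transportL m₀ c p) (flowMap c p x) :=
  (Rfun_transportL_eq b m₀ c hp x).symm

theorem norm_lag_le (b : Bool) (m₀ : L2) {p : ℝ →ᵇ ℝ} (hp : Admissible p) :
    ‖lag b m₀ p‖ ≤ 3 * ‖m₀‖ :=
  (BoundedContinuousFunction.norm_ofNormedAddCommGroup_le _ (norm_nonneg _) _).trans
    (norm_transportL_le m₀ 0 hp)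

/-! ### Lipschitz dependence of the Lagrangian resolvents on the density -/

/-- The weight that dominates the Lagrangian kernels. -/
noncomputable def weight (r : ℝ) : ℝ := Real.exp (-(|r| / 4))

theorem weight_pos (r : ℝ) : 0 < weight r := Real.exp_pos _

theorem continuous_weight : Continuous weight := by unfold weight; fun_prop

theorem sq_weight_le (r : ℝ) : weight r ^ 2 ≤ kern true (r / 2) + kern false (r / 2) := by
  have h0 : weight r ^ 2 = Real.exp (-|r / 2|) := by
    rw [weight, sq, ← Real.exp_add, abs_div, abs_two]
    ring_nf
  rw [h0]
  rcases le_total 0 r with h | h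
  · refine le_add_of_le_of_nonneg ?_ (kern_nonneg _ _)
    have : 0 ≤ r / 2 := by linarith
    simp [kern, abs_of_nonneg this, if_pos this]
  · refine le_add_of_nonneg_of_le (kern_nonneg _ _) ?_
    have : r / 2 ≤ 0 := by linarith
    simp [kern, abs_of_nonpos this, this]

theorem integrable_kern_half (b : Bool) : Integrable fun r : ℝ => kern b (r / 2) :=
  (integrable_kern b).comp_div two_ne_zero

theorem integral_kern_half (b : Bool) : ∫ r : ℝ, kern b (r / 2) = 2 := by
  rw [Measure.integral_comp_div, integral_kern]
  simp

theorem integrable_sq_weight : Integrable fun r => weight r ^ 2 := by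
  refine ((integrable_kern_half true).add (integrable_kern_half false)).mono'
    (continuous_weight.pow 2).aestronglyMeasurable (Eventually.of_forall fun r => ?_)
  rw [Real.norm_of_nonneg (sq_nonneg _)]
  exact sq_weight_le r

theorem memLp_weight_sub (x : ℝ) : MemLp (fun y => weight (x - y)) 2 := by
  have hc : Continuous fun y => weight (x - y) := continuous_weight.comp (by fun_prop)
  rw [memLp_two_iff_integrable_sq hc.aestronglyMeasurable]
  exact integrable_sq_weight.comp_sub_left x

theorem integrable_abs_mul_weight (m₀ : L2) (x : ℝ) :
    Integrable fun y => |m₀ y| * weight (x - y) :=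
  MemLp.integrable_mul (p := 2) (q := 2) (Lp.memLp m₀).abs (memLp_weight_sub x)

/-- Cauchy–Schwarz, with `∫ weight² ≤ 2 + 2`. -/
theorem integral_abs_mul_weight_le (m₀ : L2) (x : ℝ) :
    ∫ y, |m₀ y| * weight (x - y) ≤ 2 * ‖m₀‖ := by
  have e : ∫ y, |m₀ y| * weight (x - y) = ∫ y, ((Lp.memLp m₀).abs.toLp _ : L2) y * weight (x - y) :=
    integral_congr_ae (by filter_upwards [(Lp.memLp m₀).abs.coeFn_toLp] with y hy; rw [hy, Pi.abs_apply])
  have hn : ‖(Lp.memLp m₀).abs.toLp _‖ = ‖m₀‖ := by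
    rw [← sq_eq_sq₀ (norm_nonneg _) (norm_nonneg _), norm_toLp_sq, norm_sq_eq_integral]
    simp
  have hw : ‖(memLp_weight_sub x).toLp _‖ ≤ 2 := by
    refine le_of_sq_le_sq ?_ zero_le_two
    rw [norm_toLp_sq, integral_sub_left_eq_self (fun r => weight r ^ 2)]
    refine (integral_mono integrable_sq_weight
      ((integrable_kern_half true).add (integrable_kern_half false)) sq_weight_le).trans ?_
    rw [integral_add' (integrable_kern_half true) (integrable_kern_half false),
      integral_kern_half, integral_kern_half]
    norm_num
  rw [e]
  refine (le_abs_self _).trans ((abs_integral_mul_le _ (memLp_weight_sub x)).trans ?_)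
  rw [hn, mul_comm]
  exact mul_le_mul_of_nonneg_right hw (norm_nonneg _)

/-- Half of the decay pays for the linear factor: `2 |r| + 4 ≤ 12 (1 + |r| / 4) ≤ 12 e^{|r| / 4}`.
-/
theorem mul_exp_le_weight (r : ℝ) :
    (2 * |r| + 4) * Real.exp (-(|r| / 2)) ≤ 12 * weight r := by
  have h1 : Real.exp (-(|r| / 2)) = Real.exp (-(|r| / 4)) * Real.exp (-(|r| / 4)) := by
    rw [← Real.exp_add]; ring_nf
  have h2 : (2 * |r| + 4) * Real.exp (-(|r| / 4)) ≤ 12 := by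
    have h3 := Real.add_one_le_exp (|r| / 4)
    have h4 : Real.exp (-(|r| / 4)) * Real.exp (|r| / 4) = 1 := by rw [← Real.exp_add]; simp
    have h5 := Real.exp_pos (-(|r| / 4))
    have h6 := abs_nonneg r
    calc (2 * |r| + 4) * Real.exp (-(|r| / 4)) ≤ 12 * Real.exp (|r| / 4) * Real.exp (-(|r| / 4)) :=
          mul_le_mul_of_nonneg_right (by linarith) h5.le
      _ = 12 := by linear_combination 12 * h4
  rw [h1, ← mul_assoc, weight]
  exact mul_le_mul_of_nonneg_right h2 (Real.exp_pos _).le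

/-- As the flow map is increasing, the jump of the kernel sits at `y = x` whatever the density. In
these labels the resolvent therefore depends on `p` in a Lipschitz way, and no boundary term appears
under time differentiation. -/
theorem kern_flowMap_sub (b : Bool) {p : ℝ →ᵇ ℝ} (hp : Admissible p) (c x y : ℝ) :
    kern b (flowMap c p x - flowMap c p y) = if 0 ≤ sg b * (x - y) then
      Real.exp (-(sg b * (flowMap c p x - flowMap c p y))) else 0 := by
  have : 0 ≤ sg b * (flowMap c p x - flowMap c p y) ↔ 0 ≤ sg b * (x - y) := by
    cases b <;> simp [(strictMono_flowMap hp c).le_iff_le]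
  simp only [kern, this]

theorem half_abs_le_sg_mul {b : Bool} {p : ℝ →ᵇ ℝ} (hp : Admissible p) (c : ℝ) {x y : ℝ}
    (h : 0 ≤ sg b * (x - y)) :
    |x - y| / 2 ≤ sg b * (flowMap c p x - flowMap c p y) := by
  cases b
  · simp only [sg_false, neg_mul, one_mul, neg_sub, sub_nonneg] at h ⊢
    rw [abs_of_nonpos (sub_nonpos.2 h)]
    linarith [half_sub_le_flowMap_sub hp c h]
  · simp only [sg_true, one_mul, sub_nonneg] at h ⊢
    rw [abs_of_nonneg (sub_nonneg.2 h)]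
    exact half_sub_le_flowMap_sub hp c h

theorem kern_flowMap_sub_le (b : Bool) {p : ℝ →ᵇ ℝ} (hp : Admissible p) (c x y : ℝ) :
    kern b (flowMap c p x - flowMap c p y) ≤ Real.exp (-(|x - y| / 2)) :=
  (kern_le_exp _ _).trans
    (Real.exp_le_exp.2 (neg_le_neg (half_abs_sub_le_abs_flowMap_sub hp c x y)))

theorem abs_exp_neg_sub_exp_neg_le {a b c : ℝ} (ha : c ≤ a) (hb : c ≤ b) :
    |Real.exp (-a) - Real.exp (-b)| ≤ |a - b| * Real.exp (-c) := by
  wlog h : a ≤ b generalizing a b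
  · rw [abs_sub_comm, abs_sub_comm a]
    exact this hb ha (le_of_not_ge h)
  have h1 : Real.exp (-b) = Real.exp (-a) * Real.exp (-(b - a)) := by
    rw [← Real.exp_add]; ring_nf
  have h2 := Real.one_sub_le_exp_neg (b - a)
  have h3 : Real.exp (-a) ≤ Real.exp (-c) := Real.exp_le_exp.2 (neg_le_neg ha)
  rw [abs_of_nonneg (sub_nonneg.2 (Real.exp_le_exp.2 (neg_le_neg h))), abs_sub_comm,
    abs_of_nonneg (sub_nonneg.2 h), h1]
  have h4 := Real.exp_pos (-a)
  nlinarith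

theorem abs_kern_div_sub_le (b : Bool) {p q : ℝ →ᵇ ℝ} (hp : Admissible p) (hq : Admissible q)
    (x y : ℝ) :
    |kern b (flowMap 0 p x - flowMap 0 p y) / p y - kern b (flowMap 0 q x - flowMap 0 q y) / q y|
      ≤ 12 * ‖p - q‖ * weight (x - y) := by
  rw [kern_flowMap_sub b hp, kern_flowMap_sub b hq]
  split_ifs with h
  · set A := sg b * (flowMap 0 p x - flowMap 0 p y) with hA
    set B := sg b * (flowMap 0 q x - flowMap 0 q y) with hB
    have hpy := (hp y).1
    have hqy := (hq y).1
    have h1 : |Real.exp (-A) - Real.exp (-B)| ≤ ‖p - q‖ * |x - y| * Real.exp (-(|x - y| / 2)) := by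
      refine (abs_exp_neg_sub_exp_neg_le (half_abs_le_sg_mul hp 0 h)
        (half_abs_le_sg_mul hq 0 h)).trans ?_
      refine mul_le_mul_of_nonneg_right ?_ (Real.exp_pos _).le
      rw [← mul_sub, abs_mul, abs_sg, one_mul]
      exact abs_flowMap_sub_sub_le p q 0 0 x y
    have h2 : |p y - q y| ≤ ‖p - q‖ := (p - q).norm_coe_le_norm y
    have h3 : Real.exp (-B) ≤ Real.exp (-(|x - y| / 2)) :=
      Real.exp_le_exp.2 (neg_le_neg (half_abs_le_sg_mul hq 0 h))
    have e : Real.exp (-A) / p y - Real.exp (-B) / q y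
        = (Real.exp (-A) - Real.exp (-B)) * (1 / p y)
          - Real.exp (-B) * (p y - q y) * (1 / p y * (1 / q y)) := by
      have : p y ≠ 0 := by linarith
      have : q y ≠ 0 := by linarith
      field_simp
      ring
    have i1 : 1 / p y ≤ 2 := by rw [div_le_iff₀ (by linarith)]; linarith
    have i2 : 1 / q y ≤ 2 := by rw [div_le_iff₀ (by linarith)]; linarith
    have i1' : 0 ≤ 1 / p y := by positivity
    have i2' : 0 ≤ 1 / q y := by positivity
    calc _ ≤ |Real.exp (-A) - Real.exp (-B)| * (1 / p y)
          + Real.exp (-B) * |p y - q y| * (1 / p y * (1 / q y)) := by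
          rw [e]
          refine (abs_sub _ _).trans_eq ?_
          rw [abs_mul, abs_mul, abs_mul, abs_of_nonneg i1', abs_of_pos (Real.exp_pos (-B)),
            abs_of_nonneg (mul_nonneg i1' i2')]
      _ ≤ (‖p - q‖ * |x - y| * Real.exp (-(|x - y| / 2))) * 2
          + Real.exp (-(|x - y| / 2)) * ‖p - q‖ * (2 * 2) := by gcongr
      _ = ‖p - q‖ * ((2 * |x - y| + 4) * Real.exp (-(|x - y| / 2))) := by ring
      _ ≤ ‖p - q‖ * (12 * weight (x - y)) :=
          mul_le_mul_of_nonneg_left (mul_exp_le_weight _) (norm_nonneg _)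
      _ = _ := by ring
  · simp only [zero_div, sub_self, abs_zero]
    have := weight_pos (x - y)
    positivity

theorem measurable_kern_flowMap (b : Bool) (c x : ℝ) (p : ℝ →ᵇ ℝ) :
    Measurable fun y => kern b (flowMap c p x - flowMap c p y) :=
  (measurable_kern b).comp (measurable_const.sub (continuous_flowMap c p).measurable)

theorem aestronglyMeasurable_lag_integrand (b : Bool) (m₀ : L2) (c x : ℝ) (p : ℝ →ᵇ ℝ) :
    AEStronglyMeasurable (fun y => m₀ y / p y * kern b (flowMap c p x - flowMap c p y)) volume :=
  (((Lp.stronglyMeasurable m₀).measurable.div (measurable_bcf p)).mul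
    (measurable_kern_flowMap b c x p)).aestronglyMeasurable

theorem exp_half_le_weight (r : ℝ) : Real.exp (-(|r| / 2)) ≤ weight r := by
  refine Real.exp_le_exp.2 ?_
  have := abs_nonneg r
  linarith

theorem integrable_lag_integrand (b : Bool) (m₀ : L2) (c x : ℝ) {p : ℝ →ᵇ ℝ} (hp : Admissible p) :
    Integrable fun y => m₀ y / p y * kern b (flowMap c p x - flowMap c p y) := by
  refine ((integrable_abs_mul_weight m₀ x).const_mul 2).mono'
    (aestronglyMeasurable_lag_integrand b m₀ c x p) (Eventually.of_forall fun y => ?_)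
  have hpy := (hp y).1
  rw [norm_mul, norm_div, Real.norm_eq_abs, Real.norm_of_nonneg (kern_nonneg _ _),
    Real.norm_of_nonneg (by linarith : 0 ≤ p y)]
  have h1 : |m₀ y| / p y ≤ 2 * |m₀ y| := by
    rw [div_le_iff₀ (by linarith)]
    nlinarith [abs_nonneg (m₀ y)]
  rw [← mul_assoc]
  exact mul_le_mul h1 ((kern_flowMap_sub_le b hp c x y).trans (exp_half_le_weight _))
    (kern_nonneg _ _) (by positivity)

theorem norm_lag_sub_le (b : Bool) (m₀ : L2) {p q : ℝ →ᵇ ℝ} (hp : Admissible p)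
    (hq : Admissible q) : ‖lag b m₀ p - lag b m₀ q‖ ≤ 24 * ‖m₀‖ * ‖p - q‖ := by
  rw [BoundedContinuousFunction.norm_le (by positivity)]
  intro x
  have ip := integrable_lag_integrand b m₀ 0 x hp
  have iq := integrable_lag_integrand b m₀ 0 x hq
  change ‖Rfun b (transportL m₀ 0 p) (flowMap 0 p x)
    - Rfun b (transportL m₀ 0 q) (flowMap 0 q x)‖ ≤ _
  rw [Rfun_transportL b m₀ 0 hp, Rfun_transportL b m₀ 0 hq, ← integral_sub ip iq]
  calc _ ≤ ∫ y, 12 * ‖p - q‖ * (|m₀ y| * weight (x - y)) := by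
        refine norm_integral_le_of_norm_le ((integrable_abs_mul_weight m₀ x).const_mul _)
          (Eventually.of_forall fun y => ?_)
        have e : m₀ y / p y * kern b (flowMap 0 p x - flowMap 0 p y)
            - m₀ y / q y * kern b (flowMap 0 q x - flowMap 0 q y)
            = m₀ y * (kern b (flowMap 0 p x - flowMap 0 p y) / p y
              - kern b (flowMap 0 q x - flowMap 0 q y) / q y) := by ring
        rw [e, norm_mul, Real.norm_eq_abs, Real.norm_eq_abs]
        have := mul_le_mul_of_nonneg_left (abs_kern_div_sub_le b hp hq x y) (abs_nonneg (m₀ y))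
        linarith
    _ = 12 * ‖p - q‖ * ∫ y, |m₀ y| * weight (x - y) := integral_const_mul _ _
    _ ≤ 12 * ‖p - q‖ * (2 * ‖m₀‖) :=
        mul_le_mul_of_nonneg_left (integral_abs_mul_weight_le m₀ x) (by positivity)
    _ = _ := by ring

/-! ### The Lagrangian flow -/

/-- The velocity in Lagrangian coordinates. -/
noncomputable def lagV (m₀ : L2) (p : ℝ →ᵇ ℝ) : ℝ →ᵇ ℝ :=
  (1 / 2 : ℝ) • (lag true m₀ p + lag false m₀ p)

/-- The derivative of the velocity in Lagrangian coordinates. -/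
noncomputable def lagW (m₀ : L2) (p : ℝ →ᵇ ℝ) : ℝ →ᵇ ℝ :=
  (1 / 2 : ℝ) • (lag false m₀ p - lag true m₀ p)

theorem lagV_apply (m₀ : L2) (p : ℝ →ᵇ ℝ) (x : ℝ) :
    lagV m₀ p x = (lag true m₀ p x + lag false m₀ p x) / 2 := by
  simp [lagV]; ring

theorem lagW_apply (m₀ : L2) (p : ℝ →ᵇ ℝ) (x : ℝ) :
    lagW m₀ p x = (lag false m₀ p x - lag true m₀ p x) / 2 := by
  simp [lagW]; ring

theorem norm_lagV_le (m₀ : L2) {p : ℝ →ᵇ ℝ} (hp : Admissible p) : ‖lagV m₀ p‖ ≤ 3 * ‖m₀‖ := by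
  rw [lagV, norm_smul, Real.norm_of_nonneg (by norm_num)]
  linarith [norm_add_le (lag true m₀ p) (lag false m₀ p), norm_lag_le true m₀ hp,
    norm_lag_le false m₀ hp]

theorem norm_lagW_le (m₀ : L2) {p : ℝ →ᵇ ℝ} (hp : Admissible p) : ‖lagW m₀ p‖ ≤ 3 * ‖m₀‖ := by
  rw [lagW, norm_smul, Real.norm_of_nonneg (by norm_num)]
  linarith [norm_sub_le (lag false m₀ p) (lag true m₀ p), norm_lag_le true m₀ hp,
    norm_lag_le false m₀ hp]

theorem norm_lagV_sub_le (m₀ : L2) {p q : ℝ →ᵇ ℝ} (hp : Admissible p) (hq : Admissible q) :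
    ‖lagV m₀ p - lagV m₀ q‖ ≤ 24 * ‖m₀‖ * ‖p - q‖ := by
  have e : lagV m₀ p - lagV m₀ q = (1 / 2 : ℝ) •
      ((lag true m₀ p - lag true m₀ q) + (lag false m₀ p - lag false m₀ q)) := by
    unfold lagV; module
  rw [e, norm_smul, Real.norm_of_nonneg (by norm_num)]
  linarith [norm_add_le (lag true m₀ p - lag true m₀ q) (lag false m₀ p - lag false m₀ q),
    norm_lag_sub_le true m₀ hp hq, norm_lag_sub_le false m₀ hp hq]

theorem norm_lagW_sub_le (m₀ : L2) {p q : ℝ →ᵇ ℝ} (hp : Admissible p) (hq : Admissible q) :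
    ‖lagW m₀ p - lagW m₀ q‖ ≤ 24 * ‖m₀‖ * ‖p - q‖ := by
  have e : lagW m₀ p - lagW m₀ q = (1 / 2 : ℝ) •
      ((lag false m₀ p - lag false m₀ q) - (lag true m₀ p - lag true m₀ q)) := by
    unfold lagW; module
  rw [e, norm_smul, Real.norm_of_nonneg (by norm_num)]
  linarith [norm_sub_le (lag false m₀ p - lag false m₀ q) (lag true m₀ p - lag true m₀ q),
    norm_lag_sub_le true m₀ hp hq, norm_lag_sub_le false m₀ hp hq]

/-- The vector field of the Lagrangian system. -/
noncomputable def lagField (m₀ : L2) (s : (ℝ →ᵇ ℝ) × ℝ) : (ℝ →ᵇ ℝ) × ℝ :=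
  (lagW m₀ s.1 * s.1, lagV m₀ s.1 0)

/-- `(p, c)` is a solution of the Lagrangian system on `(-δ, δ)` with initial momentum `m₀`. -/
structure IsFlow (m₀ : L2) (δ : ℝ) (p : ℝ → ℝ →ᵇ ℝ) (c : ℝ → ℝ) : Prop where
  pos : 0 < δ
  p_zero : p 0 = 1
  c_zero : c 0 = 0
  admissible : ∀ t, Admissible (p t)
  abs_c_le : ∀ t, |c t| ≤ 1 / 2
  hasDerivAt_p : ∀ t ∈ Ioo (-δ) δ, HasDerivAt p (lagW m₀ (p t) * p t) t
  hasDerivAt_c : ∀ t ∈ Ioo (-δ) δ, HasDerivAt c (lagV m₀ (p t) 0) t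

theorem admissible_of_mem {s : (ℝ →ᵇ ℝ) × ℝ} (hs : s ∈ Metric.closedBall ((1 : ℝ →ᵇ ℝ), (0 : ℝ)) (1 / 2)) :
    Admissible s.1 ∧ |s.2| ≤ 1 / 2 ∧ ‖s.1‖ ≤ 3 / 2 := by
  rw [mem_closedBall_iff_norm, Prod.norm_def, sup_le_iff] at hs
  have h1 : ‖s.1 - 1‖ ≤ 1 / 2 := hs.1
  refine ⟨admissible_of_mem_closedBall h1, by simpa using hs.2, ?_⟩
  have h2 := norm_add_le (s.1 - 1) 1
  have h3 : ‖(1 : ℝ →ᵇ ℝ)‖ ≤ 1 := by simp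
  rw [sub_add_cancel] at h2
  linarith

/-- Picard–Lindelöf on the ball of radius `1/2` about `(1, 0)`. The field is bounded there by `5 (M
+ 1)`, so it cannot leave the ball before time `(1/2) / (5 (M + 1))`; the Lipschitz constant is `24
· 3/2 + 3 = 39` times `M`. -/
theorem exists_isFlow {M : ℝ} {m₀ : L2} (h : ‖m₀‖ ≤ M) :
    ∃ p c, IsFlow m₀ (1 / (10 * (M + 1))) p c := by
  have hM : 0 ≤ M := (norm_nonneg _).trans h
  set δ : ℝ := 1 / (10 * (M + 1)) with hδ
  have hδ0 : 0 < δ := by positivity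
  have hb : ∀ s ∈ Metric.closedBall ((1 : ℝ →ᵇ ℝ), (0 : ℝ)) (1 / 2),
      ‖lagField m₀ s‖ ≤ 5 * (M + 1) := by
    intro s hs
    obtain ⟨h1, -, h3⟩ := admissible_of_mem hs
    rw [Prod.norm_def, sup_le_iff]
    constructor
    · refine (norm_mul_le _ _).trans ?_
      have := mul_le_mul (norm_lagW_le m₀ h1) h3 (norm_nonneg _) (by positivity)
      linarith
    · refine ((lagV m₀ s.1).norm_coe_le_norm 0).trans ?_
      linarith [norm_lagV_le m₀ h1]
  have hl : ∀ s ∈ Metric.closedBall ((1 : ℝ →ᵇ ℝ), (0 : ℝ)) (1 / 2),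
      ∀ r ∈ Metric.closedBall ((1 : ℝ →ᵇ ℝ), (0 : ℝ)) (1 / 2),
      ‖lagField m₀ s - lagField m₀ r‖ ≤ (39 * M) * ‖s - r‖ := by
    intro s hs r hr
    obtain ⟨s1, -, s3⟩ := admissible_of_mem hs
    obtain ⟨r1, -, r3⟩ := admissible_of_mem hr
    have hd : ‖s.1 - r.1‖ ≤ ‖s - r‖ := norm_fst_le (s - r)
    have hd0 := norm_nonneg (s.1 - r.1)
    have hmd : ‖m₀‖ * ‖s.1 - r.1‖ ≤ M * ‖s - r‖ := mul_le_mul h hd hd0 hM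
    rw [Prod.norm_def, sup_le_iff]
    constructor
    · have e : (lagField m₀ s - lagField m₀ r).1
          = (lagW m₀ s.1 - lagW m₀ r.1) * s.1 + lagW m₀ r.1 * (s.1 - r.1) := by
        simp only [lagField, Prod.fst_sub]; ring
      rw [e]
      refine (norm_add_le _ _).trans ?_
      have i1 := (norm_mul_le (lagW m₀ s.1 - lagW m₀ r.1) s.1).trans
        (mul_le_mul (norm_lagW_sub_le m₀ s1 r1) s3 (norm_nonneg _) (by positivity))
      have i2 := (norm_mul_le (lagW m₀ r.1) (s.1 - r.1)).trans
        (mul_le_mul_of_nonneg_right (norm_lagW_le m₀ r1) hd0)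
      linarith
    · have i := ((lagV m₀ s.1 - lagV m₀ r.1).norm_coe_le_norm 0).trans (norm_lagV_sub_le m₀ s1 r1)
      have : 0 ≤ M * ‖s - r‖ := by positivity
      change ‖(lagV m₀ s.1 - lagV m₀ r.1) 0‖ ≤ _
      linarith
  have h0m : (0 : ℝ) ∈ Icc (-δ) δ := ⟨by linarith, hδ0.le⟩
  obtain ⟨L, hL⟩ : ∃ L : NNReal, (L : ℝ) = 5 * (M + 1) := ⟨⟨_, by positivity⟩, rfl⟩
  obtain ⟨K, hK⟩ : ∃ K : NNReal, (K : ℝ) = 39 * M := ⟨⟨_, by positivity⟩, rfl⟩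
  have hPL : IsPicardLindelof (fun _ => lagField m₀) (tmin := -δ) (tmax := δ)
      ⟨0, h0m⟩ ((1 : ℝ →ᵇ ℝ), (0 : ℝ)) (1 / 2) 0 L K := by
    refine IsPicardLindelof.of_time_independent ?_ ?_ ?_
    · intro s hs
      rw [hL]
      exact hb s (by simpa using hs)
    · refine LipschitzOnWith.of_dist_le_mul fun s hs r hr => ?_
      rw [dist_eq_norm, dist_eq_norm, hK]
      exact hl s (by simpa using hs) r (by simpa using hr)
    · simp only [sub_zero, zero_sub, neg_neg, max_self, NNReal.coe_div, hL,
        NNReal.coe_one, NNReal.coe_ofNat, NNReal.coe_zero]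
      rw [hδ]
      apply le_of_eq
      field_simp
      norm_num
  have hx : ((1 : ℝ →ᵇ ℝ), (0 : ℝ)) ∈ Metric.closedBall ((1 : ℝ →ᵇ ℝ), (0 : ℝ)) ((0 : NNReal) : ℝ) :=
    Metric.mem_closedBall_self le_rfl
  -- Working with the fixed point itself gives a curve that lies in the ball at all real times, so
  -- that `admissible` and `abs_c_le` hold without restriction on `t`.
  obtain ⟨β, hβ⟩ := ODE.FunSpace.exists_isFixedPt_next hPL hx
  have hball : ∀ t, β.compProj t ∈ Metric.closedBall ((1 : ℝ →ᵇ ℝ), (0 : ℝ)) (1 / 2) := by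
    intro t
    simpa using β.compProj_mem_closedBall hPL.mul_max_le (t := t)
  have h0 : β.compProj 0 = ((1 : ℝ →ᵇ ℝ), (0 : ℝ)) := by
    rw [ODE.FunSpace.compProj_of_mem h0m, ← hβ]
    exact ODE.FunSpace.next_apply₀ hPL hx β
  have hd : ∀ t ∈ Ioo (-δ) δ, HasDerivAt β.compProj (lagField m₀ (β.compProj t)) t := by
    intro t ht
    have ht' := Ioo_subset_Icc_self ht
    have h1 := ODE.hasDerivWithinAt_picard_Icc (t₀ := 0) h0m
      hPL.continuousOn_uncurry β.continuous_compProj.continuousOn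
      (fun _ _ => β.compProj_mem_closedBall hPL.mul_max_le) ((1 : ℝ →ᵇ ℝ), (0 : ℝ)) ht'
    have h2 : HasDerivWithinAt β.compProj (lagField m₀ (β.compProj t)) (Icc (-δ) δ) t := by
      refine h1.congr_of_mem ?_ ht'
      intro s hs
      nth_rw 1 [← hβ]
      rw [ODE.FunSpace.compProj_of_mem hs, ODE.FunSpace.next_apply]
    exact h2.hasDerivAt (Icc_mem_nhds ht.1 ht.2)
  refine ⟨fun t => (β.compProj t).1, fun t => (β.compProj t).2, hδ0, by rw [h0], by rw [h0],
    fun t => (admissible_of_mem (hball t)).1, fun t => (admissible_of_mem (hball t)).2.1,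
    fun t ht => ?_, fun t ht => ?_⟩
  · exact (ContinuousLinearMap.fst ℝ (ℝ →ᵇ ℝ) ℝ).hasFDerivAt.comp_hasDerivAt t (hd t ht)
  · exact (ContinuousLinearMap.snd ℝ (ℝ →ᵇ ℝ) ℝ).hasFDerivAt.comp_hasDerivAt t (hd t ht)

/-- The continuous representative equals `Rfun true (f + g)`, which is classically differentiable
since `f + g` is continuous. -/
theorem hasDerivAt_of_isWeakDeriv {F G : L2} {f g : ℝ → ℝ} (h : IsWeakDeriv F G)
    (hf : F =ᵐ[volume] f) (hg : G =ᵐ[volume] g) (cf : Continuous f) (cg : Continuous g) (x : ℝ) :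
    HasDerivAt f (g x) x := by
  have mf : MemLp f 2 := (memLp_congr_ae hf).1 (Lp.memLp F)
  have mg : MemLp g 2 := (memLp_congr_ae hg).1 (Lp.memLp G)
  have e1 : (F + sg true • G : L2) =ᵐ[volume] f + g := by
    rw [sg_true, one_smul]
    filter_upwards [Lp.coeFn_add F G, hf, hg] with x h1 h2 h3
    rw [h1, Pi.add_apply, Pi.add_apply, h2, h3]
  have e2 : f = Rfun true (f + g) := by
    rw [← Continuous.ae_eq_iff_eq (volume : Measure ℝ) cf (continuous_Rfun true (mf.add mg)),
      ← Rfun_congr_ae true e1]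
    exact hf.symm.trans (h.ae_eq true)
  have h1 := hasDerivAt_Rfun true (mf.add mg) (cf.add cg) x
  rw [← e2] at h1
  exact h1.congr_deriv (by simp)

theorem hasDerivAt_velocity (m : L2) (z : ℝ) :
    HasDerivAt (fun z => (Rfun true m z + Rfun false m z) / 2)
      ((Rfun false m z - Rfun true m z) / 2) z := by
  have c1 := continuous_Rfun true (Lp.memLp m)
  have c2 := continuous_Rfun false (Lp.memLp m)
  exact hasDerivAt_of_isWeakDeriv (g := fun z => (Rfun false m z - Rfun true m z) / 2)
    (isWeakDeriv_green m) (ae_green_eq m) (ae_dgreen_eq m) (by fun_prop) (by fun_prop) z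

theorem hasDerivAt_lagV (m₀ : L2) {p : ℝ →ᵇ ℝ} (hp : Admissible p) (x : ℝ) :
    HasDerivAt (lagV m₀ p) (lagW m₀ p x * p x) x := by
  have h := (hasDerivAt_velocity (transportL m₀ 0 p) (flowMap 0 p x)).comp x
    (hasDerivAt_flowMap 0 p x)
  have e : (lagV m₀ p : ℝ → ℝ) = (fun z => (Rfun true (transportL m₀ 0 p) z
      + Rfun false (transportL m₀ 0 p) z) / 2) ∘ flowMap 0 p := by
    ext y
    rw [lagV_apply, lag_apply true m₀ 0 hp, lag_apply false m₀ 0 hp]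
    rfl
  rw [e, lagW_apply, lag_apply true m₀ 0 hp, lag_apply false m₀ 0 hp]
  exact h

/-- Integration over an interval as a continuous linear functional. -/
noncomputable def integralL (x : ℝ) : (ℝ →ᵇ ℝ) →L[ℝ] ℝ :=
  LinearMap.mkContinuous
    { toFun := fun p => ∫ y in (0 : ℝ)..x, p y
      map_add' := fun p q => intervalIntegral.integral_add (p.continuous.intervalIntegrable _ _)
        (q.continuous.intervalIntegrable _ _)
      map_smul' := fun a p => intervalIntegral.integral_const_mul a fun y => p y }
    |x| fun p => by
      have := intervalIntegral.norm_integral_le_of_norm_le_const (a := 0) (b := x) (f := p)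
        fun z _ => p.norm_coe_le_norm z
      rw [sub_zero, mul_comm] at this
      exact this

namespace IsFlow

variable {m₀ : L2} {δ : ℝ} {p : ℝ → ℝ →ᵇ ℝ} {c : ℝ → ℝ}

/-- By `(v ∘ q)_x = (v_x ∘ q) q_x`, the integral of `p_t` over `[0, x]` is `lagV` at `x` minus
`lagV` at `0`; the derivative of `c` restores the latter. Thus `q_t = v(q)` for every label. -/
theorem hasDerivAt_flowMap (h : IsFlow m₀ δ p c) {t : ℝ} (ht : t ∈ Ioo (-δ) δ) (x : ℝ) :
    HasDerivAt (fun t => flowMap (c t) (p t) x) (lagV m₀ (p t) x) t := by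
  have h1 := (integralL x).hasFDerivAt.comp_hasDerivAt t (h.hasDerivAt_p t ht)
  refine ((h.hasDerivAt_c t ht).add h1).congr_deriv ?_
  have h2 := intervalIntegral.integral_eq_sub_of_hasDerivAt (a := 0) (b := x)
    (fun y _ => hasDerivAt_lagV m₀ (h.admissible t) y)
    ((lagW m₀ (p t) * p t).continuous.intervalIntegrable _ _)
  have h3 : integralL x (lagW m₀ (p t) * p t) = ∫ y in (0 : ℝ)..x, lagW m₀ (p t) y * p t y := rfl
  rw [h3, h2]
  ring

theorem hasDerivAt_apply (h : IsFlow m₀ δ p c) {t : ℝ} (ht : t ∈ Ioo (-δ) δ) (y : ℝ) :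
    HasDerivAt (fun t => p t y) (lagW m₀ (p t) y * p t y) t :=
  (BoundedContinuousFunction.evalCLM (β := ℝ) ℝ y).hasFDerivAt.comp_hasDerivAt t
    (h.hasDerivAt_p t ht)

theorem abs_lagW_le (h : IsFlow m₀ δ p c) (t y : ℝ) : |lagW m₀ (p t) y| ≤ 3 * ‖m₀‖ :=
  ((lagW m₀ (p t)).norm_coe_le_norm y).trans (norm_lagW_le m₀ (h.admissible t))

theorem abs_lagV_le (h : IsFlow m₀ δ p c) (t y : ℝ) : |lagV m₀ (p t) y| ≤ 3 * ‖m₀‖ :=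
  ((lagV m₀ (p t)).norm_coe_le_norm y).trans (norm_lagV_le m₀ (h.admissible t))

/-- Differentiation under the integral sign against the transported momentum. -/
theorem hasDerivAt_integral (h : IsFlow m₀ δ p c) {F F' : ℝ → ℝ → ℝ} {C x : ℝ}
    (hFm : ∀ t, AEStronglyMeasurable (F t) volume) (hF'm : ∀ t, AEStronglyMeasurable (F' t) volume)
    (hF : ∀ t y, |F t y| ≤ C * weight (x - y)) (hF' : ∀ t y, |F' t y| ≤ C * weight (x - y))
    (hd : ∀ t ∈ Ioo (-δ) δ, ∀ y, HasDerivAt (fun t => F t y) (F' t y) t)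
    {t : ℝ} (ht : t ∈ Ioo (-δ) δ) :
    HasDerivAt (fun t => ∫ y, m₀ y / p t y * F t y)
      (∫ y, m₀ y / p t y * (F' t y - lagW m₀ (p t) y * F t y)) t := by
  have hm : ∀ t, AEStronglyMeasurable (fun y => m₀ y / p t y) volume := fun t =>
    ((Lp.stronglyMeasurable m₀).measurable.div (measurable_bcf (p t))).aestronglyMeasurable
  have hle : ∀ t y, |m₀ y / p t y| ≤ 2 * |m₀ y| := by
    intro t y
    have hp := (h.admissible t y).1
    rw [abs_div, abs_of_nonneg (by linarith : 0 ≤ p t y), div_le_iff₀ (by linarith)]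
    nlinarith [abs_nonneg (m₀ y)]
  have hC : 0 ≤ C := by
    have := (abs_nonneg _).trans (hF 0 0)
    exact nonneg_of_mul_nonneg_left this (weight_pos _)
  refine (hasDerivAt_integral_of_dominated_loc_of_deriv_le (s := Ioo (-δ) δ)
    (bound := fun y => (2 * C * (1 + 3 * ‖m₀‖)) * (|m₀ y| * weight (x - y)))
    (F' := fun t y => m₀ y / p t y * (F' t y - lagW m₀ (p t) y * F t y))
    (isOpen_Ioo.mem_nhds ht) ?_ ?_ ?_ ?_ ?_ ?_).2
  · exact Eventually.of_forall fun t => (hm t).mul (hFm t)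
  · refine ((integrable_abs_mul_weight m₀ x).const_mul (2 * C)).mono' ((hm t).mul (hFm t))
      (Eventually.of_forall fun y => ?_)
    rw [norm_mul, Real.norm_eq_abs, Real.norm_eq_abs]
    calc _ ≤ (2 * |m₀ y|) * (C * weight (x - y)) :=
          mul_le_mul (hle t y) (hF t y) (abs_nonneg _) (by positivity)
      _ = _ := by ring
  · exact (hm t).mul ((hF'm t).sub ((lagW m₀ (p t)).continuous.aestronglyMeasurable.mul (hFm t)))
  · refine Eventually.of_forall fun y s _ => ?_
    have hw := weight_pos (x - y)
    have h1 : |F' s y - lagW m₀ (p s) y * F s y|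
        ≤ C * weight (x - y) + 3 * ‖m₀‖ * (C * weight (x - y)) := by
      refine (abs_sub _ _).trans (add_le_add (hF' s y) ?_)
      rw [abs_mul]
      exact mul_le_mul (h.abs_lagW_le s y) (hF s y) (abs_nonneg _) (by positivity)
    rw [norm_mul, Real.norm_eq_abs, Real.norm_eq_abs]
    calc _ ≤ (2 * |m₀ y|) * (C * weight (x - y) + 3 * ‖m₀‖ * (C * weight (x - y))) :=
          mul_le_mul (hle s y) h1 (abs_nonneg _) (by positivity)
      _ = _ := by ring
  · exact (integrable_abs_mul_weight m₀ x).const_mul _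
  · refine Eventually.of_forall fun y s hs => ?_
    have hp : p s y ≠ 0 := by linarith [(h.admissible s y).1]
    have h1 := ((hasDerivAt_const s (m₀ y)).div (h.hasDerivAt_apply hs y) hp).mul (hd s hs y)
    refine h1.congr_deriv ?_
    simp only [Pi.div_apply]
    field_simp
    ring

/-- The momentum at time `t`. -/
noncomputable def momentumAt (_ : IsFlow m₀ δ p c) (t : ℝ) : L2 := transportL m₀ (c t) (p t)

theorem norm_momentumAt_le (h : IsFlow m₀ δ p c) (t : ℝ) : ‖h.momentumAt t‖ ≤ 3 * ‖m₀‖ :=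
  norm_transportL_le m₀ (c t) (h.admissible t)

theorem lag_eq (h : IsFlow m₀ δ p c) (b : Bool) (t x : ℝ) :
    lag b m₀ (p t) x = Rfun b (h.momentumAt t) (flowMap (c t) (p t) x) :=
  lag_apply b m₀ (c t) (h.admissible t) x

theorem integral_momentumAt_mul (h : IsFlow m₀ δ p c) (t : ℝ) (f : ℝ → ℝ) :
    ∫ z, h.momentumAt t z * f z = ∫ y, m₀ y / p t y * f (flowMap (c t) (p t) y) :=
  integral_transportL_mul m₀ (c t) (h.admissible t) f

theorem exp_neg_abs_flowMap_le (h : IsFlow m₀ δ p c) (t y : ℝ) :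
    Real.exp (-(|flowMap (c t) (p t) y| / 2)) ≤ Real.exp 1 * weight (0 - y) := by
  rw [weight, ← Real.exp_add]
  refine Real.exp_le_exp.2 ?_
  have h1 := half_abs_sub_le_abs_flowMap_sub (h.admissible t) (c t) 0 y
  have h2 : flowMap (c t) (p t) 0 = c t := by simp [flowMap]
  rw [h2, abs_sub_comm (c t)] at h1
  have h3 := abs_sub (flowMap (c t) (p t) y) (c t)
  have h4 := h.abs_c_le t
  linarith

/-- A compactly supported function is dominated by any exponential; the bound is uniform in time
because `|c| ≤ 1/2` and `p ≥ 1/2`. -/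
theorem exists_abs_test_le (h : IsFlow m₀ δ p c) {φ : ℝ → ℝ} (hφ : IsTestFunction φ) :
    ∃ C, 0 ≤ C ∧ ∀ t y, |φ (flowMap (c t) (p t) y)| ≤ C * weight (0 - y) := by
  have hc : Continuous fun z => φ z * Real.exp (|z| / 2) := by
    have := hφ.1.continuous
    fun_prop
  obtain ⟨C, hC⟩ := hc.bounded_above_of_compact_support (hφ.2.mul_right)
  have hC0 : 0 ≤ C := (norm_nonneg _).trans (hC 0)
  refine ⟨C * Real.exp 1, by positivity, fun t y => ?_⟩
  set z := flowMap (c t) (p t) y with hz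
  have h1 := hC z
  rw [norm_mul, Real.norm_eq_abs, Real.norm_of_nonneg (Real.exp_pos _).le] at h1
  have h2 : Real.exp (|z| / 2) * Real.exp (-(|z| / 2)) = 1 := by rw [← Real.exp_add]; simp
  calc |φ z| = |φ z| * Real.exp (|z| / 2) * Real.exp (-(|z| / 2)) := by rw [mul_assoc, h2, mul_one]
    _ ≤ C * (Real.exp 1 * weight (0 - y)) :=
        mul_le_mul h1 (h.exp_neg_abs_flowMap_le t y) (Real.exp_pos _).le hC0
    _ = _ := by ring

/-- The momentum satisfies the equation in weak form. -/
theorem hasDerivAt_integral_momentumAt (h : IsFlow m₀ δ p c) {φ : ℝ → ℝ} (hφ : IsTestFunction φ)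
    {t : ℝ} (ht : t ∈ Ioo (-δ) δ) :
    HasDerivAt (fun t => ∫ z, h.momentumAt t z * φ z)
      ((∫ z, flux (h.momentumAt t) z * deriv φ z) - ∫ z, source (h.momentumAt t) z * φ z) t := by
  obtain ⟨C, hC0, hC⟩ := h.exists_abs_test_le hφ
  obtain ⟨D, hD0, hD⟩ := h.exists_abs_test_le hφ.deriv
  have hcf : ∀ t, Continuous (flowMap (c t) (p t)) := fun t => continuous_flowMap _ _
  have key := h.hasDerivAt_integral (F := fun t y => φ (flowMap (c t) (p t) y))
    (F' := fun t y => deriv φ (flowMap (c t) (p t) y) * lagV m₀ (p t) y)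
    (C := C + D * (3 * ‖m₀‖)) (x := 0)
    (fun t => (hφ.1.continuous.comp (hcf t)).aestronglyMeasurable)
    (fun t => ((hφ.deriv.1.continuous.comp (hcf t)).mul
      (lagV m₀ (p t)).continuous).aestronglyMeasurable)
    (fun t y => by
      have hw := weight_pos (0 - y)
      have : 0 ≤ D * (3 * ‖m₀‖) * weight (0 - y) := by positivity
      linarith [hC t y])
    (fun t y => by
      have hw := weight_pos (0 - y)
      have h1 := mul_le_mul (hD t y) (h.abs_lagV_le t y) (abs_nonneg _) (by positivity)
      rw [← abs_mul] at h1
      have : 0 ≤ C * weight (0 - y) := by positivity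
      linarith)
    (fun t ht y => (hφ.differentiable _).hasDerivAt.comp t (h.hasDerivAt_flowMap ht y)) ht
  simp_rw [h.integral_momentumAt_mul]
  refine key.congr_deriv ?_
  set m := h.momentumAt t with hm
  have e1 : ∫ y, m₀ y / p t y * (deriv φ (flowMap (c t) (p t) y) * lagV m₀ (p t) y
      - lagW m₀ (p t) y * φ (flowMap (c t) (p t) y))
      = ∫ z, m z * (deriv φ z * ((Rfun true m z + Rfun false m z) / 2)
        - (Rfun false m z - Rfun true m z) / 2 * φ z) := by
    rw [h.integral_momentumAt_mul t]
    congr 1; ext y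
    rw [lagV_apply, lagW_apply, h.lag_eq, h.lag_eq]
  rw [e1, ← integral_sub (hφ.deriv.integrable_mul _) (hφ.integrable_mul _)]
  refine integral_congr_ae ?_
  filter_upwards [coeFn_flux m, coeFn_source m, ae_green_eq m, ae_dgreen_eq m] with z h1 h2 h3 h4
  rw [h1, h2, h3, h4]
  ring

/-- The differential inequality along characteristics. -/
theorem exists_hasDerivAt_lag (h : IsFlow m₀ δ p c) (b : Bool) (x : ℝ) {t : ℝ}
    (ht : t ∈ Ioo (-δ) δ) :
    ∃ a', HasDerivAt (fun t => lag b m₀ (p t) x) a' t ∧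
      -(lag true m₀ (p t) x * lag false m₀ (p t) x) / 2 ≤ sg b * a' := by
  set K : ℝ → ℝ → ℝ := fun t y => kern b (flowMap (c t) (p t) x - flowMap (c t) (p t) y) with hK
  have hKw : ∀ t y, |K t y| ≤ weight (x - y) := fun t y => by
    rw [abs_of_nonneg (kern_nonneg _ _)]
    exact (kern_flowMap_sub_le b (h.admissible t) _ _ _).trans (exp_half_le_weight _)
  have hKm : ∀ t, Measurable (K t) := fun t => measurable_kern_flowMap b _ _ _
  have hKd : ∀ t ∈ Ioo (-δ) δ, ∀ y, HasDerivAt (fun t => K t y)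
      (K t y * (-(sg b * (lagV m₀ (p t) x - lagV m₀ (p t) y)))) t := by
    intro t ht y
    simp only [hK, kern_flowMap_sub b (h.admissible _)]
    -- The condition `0 ≤ sg b * (x - y)` does not involve `t`, so each branch is smooth in time.
    split_ifs with hs
    · exact (((h.hasDerivAt_flowMap ht x).sub (h.hasDerivAt_flowMap ht y)).const_mul
        (sg b)).neg.exp
    · rw [zero_mul]; exact hasDerivAt_const _ _
  have key := h.hasDerivAt_integral (F := K)
    (F' := fun t y => K t y * (-(sg b * (lagV m₀ (p t) x - lagV m₀ (p t) y))))
    (C := 1 + 6 * ‖m₀‖) (x := x) (fun t => (hKm t).aestronglyMeasurable)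
    (fun t => by
      have := (lagV m₀ (p t)).continuous.measurable
      exact ((hKm t).mul (by fun_prop)).aestronglyMeasurable)
    (fun t y => by
      have hw := weight_pos (x - y)
      have : 0 ≤ 6 * ‖m₀‖ * weight (x - y) := by positivity
      linarith [hKw t y])
    (fun t y => by
      have hw := weight_pos (x - y)
      have h1 : |(-(sg b * (lagV m₀ (p t) x - lagV m₀ (p t) y)))| ≤ 6 * ‖m₀‖ := by
        rw [abs_neg, abs_mul, abs_sg, one_mul]
        refine (abs_sub _ _).trans ?_
        linarith [h.abs_lagV_le t x, h.abs_lagV_le t y]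
      rw [abs_mul]
      have h2 := mul_le_mul (hKw t y) h1 (abs_nonneg _) hw.le
      linarith) hKd ht
  have e0 : ∀ t, lag b m₀ (p t) x = ∫ y, m₀ y / p t y * K t y := fun t => by
    rw [h.lag_eq]
    exact Rfun_transportL b m₀ (c t) (h.admissible t) x
  simp_rw [e0]
  refine ⟨_, key, ?_⟩
  set m := h.momentumAt t with hm
  set A := lag true m₀ (p t) x with hA
  set B := lag false m₀ (p t) x with hB
  set a := lag b m₀ (p t) x with ha
  set V := lagV m₀ (p t) x with hV
  set I := Rfun b (fun z => Rfun b m z * m z) (flowMap (c t) (p t) x) with hI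
  have hVe : V = (A + B) / 2 := lagV_apply _ _ _
  have eI : I = ∫ y, m₀ y / p t y * (K t y * lag b m₀ (p t) y) := by
    have e1 : I = ∫ z, m z * (kern b (flowMap (c t) (p t) x - z) * Rfun b m z) := by
      rw [hI]
      conv_lhs => unfold Rfun
      congr 1; ext z
      change _ * (Rfun b m z * m z) = _
      ring
    rw [e1, h.integral_momentumAt_mul t]
    congr 1; ext y
    rw [h.lag_eq]
  have hIle : a ^ 2 / 2 ≤ I := by
    rw [ha, h.lag_eq]
    exact half_sq_Rfun_le b (Lp.memLp m) _
  -- Since `v - sg b v_x` is `lag b` itself, the two contributions combine and the derivative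
  -- becomes `sg b (I - V a)`.
  have e2 : ∀ y, m₀ y / p t y * (K t y * (-(sg b * (V - lagV m₀ (p t) y)))
      - lagW m₀ (p t) y * K t y)
      = sg b * (m₀ y / p t y * (K t y * lag b m₀ (p t) y)) - sg b * V * (m₀ y / p t y * K t y) := by
    intro y
    rw [lagV_apply, lagW_apply]
    cases b <;> simp <;> ring
  have i1 : Integrable fun y => m₀ y / p t y * K t y :=
    integrable_lag_integrand b m₀ (c t) x (h.admissible t)
  have i2 : Integrable fun y => m₀ y / p t y * (K t y * lag b m₀ (p t) y) := by
    have := i1.mul_bdd (c := ‖lag b m₀ (p t)‖) (lag b m₀ (p t)).continuous.aestronglyMeasurable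
      (Eventually.of_forall fun y => (lag b m₀ (p t)).norm_coe_le_norm y)
    exact this.congr (Eventually.of_forall fun y => mul_assoc _ _ _)
  simp_rw [e2]
  rw [integral_sub (i2.const_mul _) (i1.const_mul _), integral_const_mul, integral_const_mul,
    ← eI, ← e0 t]
  change _ ≤ sg b * (sg b * I - sg b * V * a)
  have e3 : sg b * (sg b * I - sg b * V * a) = I - V * a := by
    linear_combination (I - V * a) * sg_mul_self b
  rw [e3, hVe]
  -- As `a` is either `A` or `B`, and `V` is their mean, the squares cancel and both cases leave
  -- `-AB/2`.
  have e4 : a ^ 2 / 2 - (A + B) / 2 * a = -(A * B) / 2 := by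
    cases b
    · change B ^ 2 / 2 - (A + B) / 2 * B = _; ring
    · change A ^ 2 / 2 - (A + B) / 2 * A = _; ring
  linarith

end IsFlow

/-! ### Strong continuity of the momentum in `L²` -/

/-- In a Hilbert space weak convergence and convergence of norms give strong convergence; for
bounded families it suffices to test weak convergence on a dense set. -/
theorem tendsto_of_tendsto_integral_test {ι : Type*} {l : Filter ι} {f : ι → L2} {g : L2} {C : ℝ}
    (hC : ∀ i, ‖f i‖ ≤ C) (hn : Tendsto (fun i => ‖f i‖ ^ 2) l (𝓝 (‖g‖ ^ 2)))
    (hw : ∀ φ : ℝ → ℝ, IsTestFunction φ →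
      Tendsto (fun i => ∫ x, f i x * φ x) l (𝓝 (∫ x, g x * φ x))) :
    Tendsto f l (𝓝 g) := by
  have hC' : 0 ≤ |C| + ‖g‖ := by positivity
  have hin : Tendsto (fun i => inner ℝ (f i - g) g) l (𝓝 0) := by
    rw [Metric.tendsto_nhds]
    intro ε hε
    obtain ⟨φL, ⟨φ, hφ, hφ1, hφ2⟩, hd⟩ := Metric.mem_closure_iff.1
      (Lp.dense_hasCompactSupport_contDiff (F := ℝ) (μ := (volume : Measure ℝ)) (p := 2)
        ENNReal.ofNat_ne_top g) (ε / (2 * (|C| + ‖g‖ + 1))) (by positivity)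
    have ht : IsTestFunction φ := ⟨hφ2, hφ1⟩
    have e : ∀ k : L2, inner ℝ k φL = ∫ x, k x * φ x := fun k => by
      rw [inner_eq_integral]
      exact integral_congr_ae (by filter_upwards [hφ] with x hx; rw [hx])
    filter_upwards [Metric.tendsto_nhds.1 (hw φ ht) (ε / 2) (by positivity)] with i hi
    rw [Real.dist_eq, ← e, ← e, ← inner_sub_left] at hi
    rw [Real.dist_eq, sub_zero]
    have e2 : inner ℝ (f i - g) g = inner ℝ (f i - g) φL + inner ℝ (f i - g) (g - φL) := by
      rw [← inner_add_right]; congr 1; abel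
    have h1 : ‖f i - g‖ ≤ |C| + ‖g‖ := (norm_sub_le _ _).trans (by
      have := (hC i).trans (le_abs_self C)
      linarith)
    have h2 : |inner ℝ (f i - g) (g - φL)| ≤ ε / 2 := by
      refine (abs_real_inner_le_norm _ _).trans ?_
      rw [dist_eq_norm] at hd
      calc _ ≤ (|C| + ‖g‖ + 1) * (ε / (2 * (|C| + ‖g‖ + 1))) :=
            mul_le_mul (by linarith) hd.le (norm_nonneg _) (by positivity)
        _ = ε / 2 := by field_simp
    rw [e2]
    exact (abs_add_le _ _).trans_lt (by linarith)
  have hsq : Tendsto (fun i => ‖f i - g‖ ^ 2) l (𝓝 0) := by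
    have h := (hn.sub_const (‖g‖ ^ 2)).sub (hin.const_mul 2)
    simp only [sub_self, mul_zero] at h
    refine h.congr fun i => ?_
    rw [norm_sub_sq_real, inner_sub_left, real_inner_self_eq_norm_sq]
    ring
  rw [tendsto_iff_norm_sub_tendsto_zero]
  have := hsq.sqrt
  simpa using this

namespace IsFlow

variable {m₀ : L2} {δ : ℝ} {p : ℝ → ℝ →ᵇ ℝ} {c : ℝ → ℝ}

theorem continuousAt_norm_sq_momentumAt (h : IsFlow m₀ δ p c) {t : ℝ} (ht : t ∈ Ioo (-δ) δ) :
    ContinuousAt (fun t => ‖h.momentumAt t‖ ^ 2) t := by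
  have e : (fun t => ‖h.momentumAt t‖ ^ 2) = fun t => ∫ x, m₀ x ^ 2 / p t x ^ 3 := by
    ext s; exact norm_sq_transportL m₀ (c s) (h.admissible s)
  rw [e]
  refine continuousAt_of_dominated (bound := fun x => 8 * m₀ x ^ 2) ?_ ?_
    ((Lp.memLp m₀).integrable_sq.const_mul 8) ?_
  · exact Eventually.of_forall fun s => (integrable_sq_div m₀ (h.admissible s)).1
  · refine Eventually.of_forall fun s => Eventually.of_forall fun x => ?_
    have h1 := (h.admissible s x).1
    have h3 : (1 / 8 : ℝ) ≤ p s x ^ 3 := by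
      have := pow_le_pow_left₀ (by norm_num) h1 3
      norm_num at this ⊢
      exact this
    rw [Real.norm_of_nonneg (by positivity), div_le_iff₀ (by positivity)]
    nlinarith [sq_nonneg (m₀ x)]
  · refine Eventually.of_forall fun x => ?_
    have hp : p t x ≠ 0 := by linarith [(h.admissible t x).1]
    exact continuousAt_const.div ((h.hasDerivAt_apply ht x).continuousAt.pow 3) (pow_ne_zero _ hp)

theorem continuousOn_momentumAt (h : IsFlow m₀ δ p c) :
    ContinuousOn h.momentumAt (Ioo (-δ) δ) := fun _ ht =>
  ContinuousAt.continuousWithinAt <| tendsto_of_tendsto_integral_test (h.norm_momentumAt_le)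
    (h.continuousAt_norm_sq_momentumAt ht)
    fun _ hφ => (h.hasDerivAt_integral_momentumAt hφ ht).continuousAt

theorem momentumAt_zero (h : IsFlow m₀ δ p c) : h.momentumAt 0 = m₀ := by
  refine Lp.ext ?_
  have hp := h.admissible 0
  have hf : ∀ x, flowMap (c 0) (p 0) x = x := by
    intro x
    rw [h.c_zero, h.p_zero]
    simp [flowMap]
  refine (coeFn_transportL m₀ (c 0) hp).trans (Eventually.of_forall fun z => ?_)
  have := transport_flowMap m₀ (c 0) hp z
  rw [hf] at this
  rw [this, h.p_zero]
  simp

theorem solvesOn (h : IsFlow m₀ δ p c) :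
    SolvesOn (Ioo (-δ) δ) fun t => solve (h.momentumAt t) := by
  have hc := h.continuousOn_momentumAt
  refine ⟨solve.continuous.comp_continuousOn hc, fun t => rate (h.momentumAt t),
    continuous_rate.comp_continuousOn hc, fun t ht => ⟨?_, satisfiesEquation_rate _⟩⟩
  exact (hasDerivAt_inclusion_solve hc
    (fun φ hφ t ht => h.hasDerivAt_integral_momentumAt hφ ht) ht).hasDerivWithinAt

end IsFlow

/-! ### Differential inequalities for the blow-up quantities -/

/-- With the integrating factor `exp (-∫ k)` the function becomes nondecreasing. -/
theorem pos_of_mul_le_deriv {a a' k : ℝ → ℝ} {δ : ℝ}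
    (ha : ∀ s ∈ Ioo (-δ) δ, HasDerivAt a (a' s) s) (hk : ContinuousOn k (Ioo (-δ) δ))
    (h : ∀ s ∈ Ioo (-δ) δ, k s * a s ≤ a' s) (h0 : 0 < a 0) {t : ℝ} (ht : 0 ≤ t) (htδ : t < δ) :
    0 < a t := by
  have h0m : (0 : ℝ) ∈ Ioo (-δ) δ := ⟨by linarith, by linarith⟩
  have hsub : Icc 0 t ⊆ Ioo (-δ) δ := fun s hs => ⟨by linarith [hs.1], by linarith [hs.2]⟩
  have hβ : ∀ s ∈ Ioo (-δ) δ, HasDerivAt (fun s => ∫ r in (0 : ℝ)..s, k r) (k s) s := by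
    intro s hs
    exact intervalIntegral.integral_hasDerivAt_right
      (hk.mono (ordConnected_Ioo.uIcc_subset h0m hs)).intervalIntegrable
      (hk.stronglyMeasurableAtFilter isOpen_Ioo s hs) (hk.continuousAt (isOpen_Ioo.mem_nhds hs))
  set E : ℝ → ℝ := fun s => a s * Real.exp (-∫ r in (0 : ℝ)..s, k r) with hE
  have hd : ∀ s ∈ Ioo (-δ) δ,
      HasDerivAt E ((a' s - k s * a s) * Real.exp (-∫ r in (0 : ℝ)..s, k r)) s := by
    intro s hs
    refine ((ha s hs).mul (hβ s hs).neg.exp).congr_deriv ?_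
    simp only [Pi.neg_apply]
    ring
  have hmono : MonotoneOn E (Icc 0 t) := by
    refine monotoneOn_of_deriv_nonneg (convex_Icc 0 t)
      (fun s hs => (hd s (hsub hs)).continuousAt.continuousWithinAt)
      (fun s hs => (hd s (hsub (interior_subset hs))).differentiableAt.differentiableWithinAt)
      fun s hs => ?_
    have hs' := hsub (interior_subset hs)
    rw [(hd s hs').deriv]
    exact mul_nonneg (sub_nonneg.2 (h s hs')) (Real.exp_pos _).le
  have := hmono (left_mem_Icc.2 ht) (right_mem_Icc.2 ht) ht
  simp only [hE, intervalIntegral.integral_same, neg_zero, Real.exp_zero, mul_one] at this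
  exact pos_of_mul_pos_left (h0.trans_le this) (Real.exp_pos _).le

/-- The derivative of `1/a + 1/b` is at most `-(b/a + a/b)/2 ≤ -1`. Positivity of each function
follows from its own linear inequality, with coefficient half of the other. -/
theorem inv_add_inv_le {a b a' b' : ℝ → ℝ} {δ : ℝ}
    (ha : ∀ s ∈ Ioo (-δ) δ, HasDerivAt a (a' s) s) (hb : ∀ s ∈ Ioo (-δ) δ, HasDerivAt b (b' s) s)
    (ha' : ∀ s ∈ Ioo (-δ) δ, a s * b s / 2 ≤ a' s) (hb' : ∀ s ∈ Ioo (-δ) δ, a s * b s / 2 ≤ b' s)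
    (ha0 : 0 < a 0) (hb0 : 0 < b 0) {t : ℝ} (ht : 0 ≤ t) (htδ : t < δ) :
    0 < a t ∧ 0 < b t ∧ (a t)⁻¹ + (b t)⁻¹ ≤ (a 0)⁻¹ + (b 0)⁻¹ - t := by
  have ca : ContinuousOn a (Ioo (-δ) δ) := fun s hs => (ha s hs).continuousAt.continuousWithinAt
  have cb : ContinuousOn b (Ioo (-δ) δ) := fun s hs => (hb s hs).continuousAt.continuousWithinAt
  have pa : ∀ s, 0 ≤ s → s < δ → 0 < a s := fun s hs hsδ =>
    pos_of_mul_le_deriv ha (cb.div_const 2) (fun r hr => by linarith [ha' r hr]) ha0 hs hsδ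
  have pb : ∀ s, 0 ≤ s → s < δ → 0 < b s := fun s hs hsδ =>
    pos_of_mul_le_deriv hb (ca.div_const 2) (fun r hr => by linarith [hb' r hr]) hb0 hs hsδ
  refine ⟨pa t ht htδ, pb t ht htδ, ?_⟩
  have hsub : ∀ s ∈ Icc 0 t, s ∈ Ioo (-δ) δ ∧ 0 < a s ∧ 0 < b s := fun s hs =>
    ⟨⟨by linarith [hs.1], by linarith [hs.2]⟩, pa s hs.1 (by linarith [hs.2]),
      pb s hs.1 (by linarith [hs.2])⟩
  have hd : ∀ s ∈ Icc 0 t, HasDerivAt (fun s => (a s)⁻¹ + (b s)⁻¹ + s)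
      (-a' s / a s ^ 2 + -b' s / b s ^ 2 + 1) s := by
    intro s hs
    obtain ⟨h1, h2, h3⟩ := hsub s hs
    exact (((ha s h1).inv h2.ne').add ((hb s h1).inv h3.ne')).add (hasDerivAt_id s)
  have hanti : AntitoneOn (fun s => (a s)⁻¹ + (b s)⁻¹ + s) (Icc 0 t) := by
    refine antitoneOn_of_deriv_nonpos (convex_Icc 0 t)
      (fun s hs => (hd s hs).continuousAt.continuousWithinAt)
      (fun s hs => (hd s (interior_subset hs)).differentiableAt.differentiableWithinAt)
      fun s hs => ?_
    obtain ⟨h1, h2, h3⟩ := hsub s (interior_subset hs)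
    rw [(hd s (interior_subset hs)).deriv]
    have i1 : a s * b s / 2 / a s ^ 2 ≤ a' s / a s ^ 2 :=
      div_le_div_of_nonneg_right (ha' s h1) (by positivity)
    have i2 : a s * b s / 2 / b s ^ 2 ≤ b' s / b s ^ 2 :=
      div_le_div_of_nonneg_right (hb' s h1) (by positivity)
    have i3 : 1 ≤ a s * b s / 2 / a s ^ 2 + a s * b s / 2 / b s ^ 2 := by
      have : a s * b s / 2 / a s ^ 2 + a s * b s / 2 / b s ^ 2
          = 1 + (a s - b s) ^ 2 / (2 * (a s * b s)) := by
        field_simp; ring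
      rw [this]
      have : 0 ≤ (a s - b s) ^ 2 / (2 * (a s * b s)) := by positivity
      linarith
    rw [neg_div, neg_div]
    linarith
  have := hanti (left_mem_Icc.2 ht) (right_mem_Icc.2 ht) ht
  simp only [add_zero] at this
  linarith

/-- The blow-up condition at the point `x` with margin `y`. -/
def BlowUpMargin (m : L2) (x y : ℝ) : Prop :=
  0 < Rfun true m x ∧ 0 < -Rfun false m x ∧ (Rfun true m x)⁻¹ + (-Rfun false m x)⁻¹ ≤ y

/-- The margin bounds the time left to the solution, and is used up at unit rate along the
characteristic through `x`. -/
theorem IsFlow.blowUpMargin {m₀ : L2} {δ : ℝ} {p : ℝ → ℝ →ᵇ ℝ} {c : ℝ → ℝ} (h : IsFlow m₀ δ p c)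
    {x y : ℝ} (hm : BlowUpMargin m₀ x y) {t : ℝ} (ht : 0 ≤ t) (htδ : t < δ) :
    BlowUpMargin (h.momentumAt t) (flowMap (c t) (p t) x) (y - t) := by
  -- The value `0` outside the interval only serves to choose the derivative as a total function.
  have hA : ∀ s, ∃ a', s ∈ Ioo (-δ) δ → HasDerivAt (fun t => lag true m₀ (p t) x) a' s ∧
      -(lag true m₀ (p s) x * lag false m₀ (p s) x) / 2 ≤ sg true * a' := by
    intro s
    by_cases hs : s ∈ Ioo (-δ) δ
    · obtain ⟨a', ha'⟩ := h.exists_hasDerivAt_lag true x hs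
      exact ⟨a', fun _ => ha'⟩
    · exact ⟨0, fun h => absurd h hs⟩
  have hB : ∀ s, ∃ a', s ∈ Ioo (-δ) δ → HasDerivAt (fun t => lag false m₀ (p t) x) a' s ∧
      -(lag true m₀ (p s) x * lag false m₀ (p s) x) / 2 ≤ sg false * a' := by
    intro s
    by_cases hs : s ∈ Ioo (-δ) δ
    · obtain ⟨a', ha'⟩ := h.exists_hasDerivAt_lag false x hs
      exact ⟨a', fun _ => ha'⟩
    · exact ⟨0, fun h => absurd h hs⟩
  choose A' hA' using hA
  choose B' hB' using hB
  have h0 : ∀ b, lag b m₀ (p 0) x = Rfun b m₀ x := by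
    intro b
    rw [h.lag_eq, h.momentumAt_zero, h.c_zero, h.p_zero]
    simp [flowMap]
  have key := inv_add_inv_le (a := fun s => lag true m₀ (p s) x)
    (b := fun s => -lag false m₀ (p s) x) (a' := A') (b' := fun s => -B' s) (δ := δ)
    (fun s hs => (hA' s hs).1) (fun s hs => (hB' s hs).1.neg)
    (fun s hs => by
      have := (hA' s hs).2
      simp only [sg_true, one_mul] at this
      linarith)
    (fun s hs => by
      have := (hB' s hs).2
      simp only [sg_false] at this
      linarith) (by rw [h0]; exact hm.1) (by rw [h0]; exact hm.2.1) ht htδ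
  rw [h0, h0, h.lag_eq, h.lag_eq] at key
  exact ⟨key.1, key.2.1, by linarith [key.2.2, hm.2.2]⟩

/-! ### Maximal solutions and blow-up -/

/-- The equation determines `u_t` from `u`, so being a solution becomes the autonomous condition of
`solvesOn_iff`, which can be checked locally, glued and translated in time. -/
theorem SatisfiesEquation.eq_rate {u : Sobolev 4} {w : Sobolev 3} (h : SatisfiesEquation u w) :
    w = rate (momentum u) := by
  rw [← sub_eq_zero]
  refine eq_zero_of_pairing_eq_zero fun φ hφ => ?_
  have h1 := (satisfiesEquation_iff u w).1 h φ hφ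
  rw [integral_sub_mul _ _ hφ.deriv, integral_add_mul _ _ hφ] at h1
  have h2 := pairing_rate (momentum u) hφ
  rw [← pairingL_apply hφ] at h2 ⊢
  rw [map_sub, h2, pairingL_apply, pairing]
  linarith

theorem solvesOn_iff {s : Set ℝ} {u : ℝ → Sobolev 4} :
    SolvesOn s u ↔ ContinuousOn u s ∧ ∀ t ∈ s,
      HasDerivWithinAt (fun r => inclusion (u r)) (rate (momentum (u t))) s t := by
  constructor
  · rintro ⟨h1, w, -, h2⟩
    refine ⟨h1, fun t ht => ?_⟩
    rw [← (h2 t ht).2.eq_rate]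
    exact (h2 t ht).1
  · rintro ⟨h1, h2⟩
    refine ⟨h1, fun t => rate (momentum (u t)), ?_, fun t ht => ⟨h2 t ht, ?_⟩⟩
    · exact continuous_rate.comp_continuousOn (momentumL.continuous.comp_continuousOn h1)
    · have := satisfiesEquation_rate (momentum (u t))
      rwa [solve_momentum] at this

theorem SolvesOn.of_local {s : Set ℝ} {u : ℝ → Sobolev 4}
    (h : ∀ t ∈ s, ∃ V ∈ 𝓝 t, ∃ v, SolvesOn (s ∩ V) v ∧ EqOn u v (s ∩ V)) : SolvesOn s u := by
  rw [solvesOn_iff]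
  constructor
  · intro t ht
    obtain ⟨V, hV, v, hv, e⟩ := h t ht
    have htV : t ∈ s ∩ V := ⟨ht, mem_of_mem_nhds hV⟩
    exact (continuousWithinAt_inter hV).1 ((hv.1 t htV).congr_of_mem e htV)
  · intro t ht
    obtain ⟨V, hV, v, hv, e⟩ := h t ht
    have htV : t ∈ s ∩ V := ⟨ht, mem_of_mem_nhds hV⟩
    have h1 := (solvesOn_iff.1 hv).2 t htV
    rw [← e htV] at h1
    exact (hasDerivWithinAt_inter hV).1
      (h1.congr_of_mem (fun r hr => congrArg inclusion (e hr)) htV)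

theorem SolvesOn.comp_add {s : Set ℝ} {u : ℝ → Sobolev 4} (h : SolvesOn s u) (a : ℝ) :
    SolvesOn ((fun t => t + a) ⁻¹' s) fun t => u (t + a) := by
  rw [solvesOn_iff] at h ⊢
  refine ⟨h.1.comp (by fun_prop) (mapsTo_preimage _ _), fun t ht => ?_⟩
  have := (h.2 (t + a) ht).scomp t (((hasDerivAt_id t).add_const a).hasDerivWithinAt)
    (mapsTo_preimage (fun t => t + a) s)
  rw [one_smul] at this
  exact this

/-- Local existence, on a time interval that depends on the size of the initial value only. -/
theorem exists_local_solution {M : ℝ} (hM : 0 ≤ M) :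
    ∃ δ > 0, ∀ u₀ : Sobolev 4, ‖momentum u₀‖ ≤ M → ∃ U : ℝ → Sobolev 4, U 0 = u₀ ∧
      SolvesOn (Ioo (-δ) δ) U ∧ ∀ x y, BlowUpMargin (momentum u₀) x y →
        ∀ t, 0 ≤ t → t < δ → ∃ x', BlowUpMargin (momentum (U t)) x' (y - t) := by
  refine ⟨1 / (10 * (M + 1)), by positivity, fun u₀ hu => ?_⟩
  obtain ⟨p, c, h⟩ := exists_isFlow hu
  refine ⟨fun t => solve (h.momentumAt t), ?_, h.solvesOn, fun x y hm t ht htδ => ?_⟩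
  · simp only [h.momentumAt_zero, solve_momentum]
  · simp only [momentum_solve]
    exact ⟨_, h.blowUpMargin hm ht htδ⟩

theorem isSolution_iff {u₀ : Sobolev 4} {T : EReal} {u : ℝ → Sobolev 4} :
    IsSolution u₀ T u ↔ 0 < T ∧ u 0 = u₀ ∧ SolvesOn (timeInterval T) u := Iff.rfl

theorem Icc_subset_timeInterval {T : EReal} {a b : ℝ} (ha : 0 ≤ a) (hb : (b : EReal) < T) :
    Icc a b ⊆ timeInterval T := fun _ ht =>
  ⟨ha.trans ht.1, (EReal.coe_le_coe_iff.2 ht.2).trans_lt hb⟩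

theorem IsSolution.unique {u₀ : Sobolev 4} {T T' : EReal} {u u' : ℝ → Sobolev 4}
    (h : IsSolution u₀ T u) (h' : IsSolution u₀ T' u') {t : ℝ} (ht : t ∈ timeInterval T)
    (ht' : t ∈ timeInterval T') : u t = u' t := by
  rw [isSolution_iff] at h h'
  exact (h.2.2.mono (Icc_subset_timeInterval le_rfl ht.2)).eqOn_Icc
    (h'.2.2.mono (Icc_subset_timeInterval le_rfl ht'.2)) (h.2.1.trans h'.2.1.symm)
    (right_mem_Icc.2 ht.1)

theorem isOpen_setOf_coe_lt (T : EReal) : IsOpen {r : ℝ | (r : EReal) < T} :=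
  isOpen_Iio.preimage continuous_coe_real_ereal

theorem exists_isSolution (u₀ : Sobolev 4) : ∃ T u, IsSolution u₀ T u := by
  obtain ⟨δ, hδ, h⟩ := exists_local_solution (norm_nonneg (momentum u₀))
  obtain ⟨U, h0, hU, -⟩ := h u₀ le_rfl
  refine ⟨(δ : EReal), U, isSolution_iff.2 ⟨EReal.coe_pos.2 hδ, h0, hU.mono fun t ht => ?_⟩⟩
  exact ⟨by linarith [ht.1], EReal.coe_lt_coe_iff.1 ht.2⟩

/-- The supremum of all lifespans is attained: by uniqueness any two solutions agree where both
live, so all of them glue to one curve, and nothing lives longer. -/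
theorem exists_isMaximalSolution (u₀ : Sobolev 4) : ∃ T u, IsMaximalSolution u₀ T u := by
  classical
  set S : Set EReal := {T | ∃ u, IsSolution u₀ T u} with hS
  have hex : ∀ t : ℝ, ∃ v : ℝ → Sobolev 4, t ∈ timeInterval (sSup S) →
      ∃ T, t ∈ timeInterval T ∧ IsSolution u₀ T v := by
    intro t
    by_cases ht : t ∈ timeInterval (sSup S)
    · obtain ⟨T, ⟨v, hv⟩, hT⟩ := lt_sSup_iff.1 ht.2
      exact ⟨v, fun _ => ⟨T, ⟨ht.1, hT⟩, hv⟩⟩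
    · exact ⟨0, fun h => absurd h ht⟩
  choose v hv using hex
  -- At time `t` the glued curve takes the value of a solution chosen for that `t`; the choice is
  -- immaterial by uniqueness.
  set U : ℝ → Sobolev 4 := fun t => v t t with hU
  have hle : ∀ T ∈ S, timeInterval T ⊆ timeInterval (sSup S) := fun T hT t ht =>
    ⟨ht.1, ht.2.trans_le (le_sSup hT)⟩
  have hUu : ∀ T u, IsSolution u₀ T u → EqOn U u (timeInterval T) := by
    intro T u hu t ht
    obtain ⟨T', ht', hv'⟩ := hv t (hle T ⟨u, hu⟩ ht)
    exact hv'.unique hu ht' ht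
  obtain ⟨T₀, u, hu⟩ := exists_isSolution u₀
  have hpos : 0 < sSup S := (isSolution_iff.1 hu).1.trans_le (le_sSup ⟨u, hu⟩)
  have hU0 : U 0 = u₀ := by
    rw [hUu T₀ u hu ⟨le_rfl, (isSolution_iff.1 hu).1⟩]
    exact (isSolution_iff.1 hu).2.1
  refine ⟨sSup S, U, isSolution_iff.2 ⟨hpos, hU0, SolvesOn.of_local fun t ht => ?_⟩, ?_⟩
  · obtain ⟨T, ⟨v, hv⟩, hT⟩ := lt_sSup_iff.1 ht.2
    have hsub : timeInterval (sSup S) ∩ {r : ℝ | (r : EReal) < T} ⊆ timeInterval T :=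
      fun r hr => ⟨hr.1.1, hr.2⟩
    exact ⟨_, (isOpen_setOf_coe_lt T).mem_nhds hT, v, (isSolution_iff.1 hv).2.2.mono hsub,
      (hUu T v hv).mono hsub⟩
  · intro T' u' hT' hu' _
    exact absurd (le_sSup (show T' ∈ S from ⟨u', hu'⟩)) (not_le.2 hT')

/-- A global solution has bounded momentum on `[0, y]`, hence a uniform local existence time `δ`
there. The margin is carried over `N` steps of length `y / N < δ`, passing from the local flow to
the given solution by uniqueness. At time `y` it would be zero, yet every margin is positive. -/
theorem not_isSolution_top {u₀ : Sobolev 4} {x y : ℝ} (hm : BlowUpMargin (momentum u₀) x y)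
    (u : ℝ → Sobolev 4) : ¬ IsSolution u₀ ⊤ u := by
  intro hu
  obtain ⟨-, h0, hs⟩ := isSolution_iff.1 hu
  have hypos : ∀ {m x y}, BlowUpMargin m x y → 0 < y := fun h =>
    (add_pos (inv_pos.2 h.1) (inv_pos.2 h.2.1)).trans_le h.2.2
  have hy := hypos hm
  have hI : ∀ a b : ℝ, 0 ≤ a → Icc a b ⊆ timeInterval ⊤ := fun a b ha =>
    Icc_subset_timeInterval ha (EReal.coe_lt_top b)
  obtain ⟨M, hM⟩ := isCompact_Icc.exists_bound_of_continuousOn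
    (momentumL.continuous.comp_continuousOn (hs.1.mono (hI 0 y le_rfl)))
  have hM0 : 0 ≤ M := (norm_nonneg _).trans (hM 0 (left_mem_Icc.2 hy.le))
  obtain ⟨δ, hδ, hloc⟩ := exists_local_solution hM0
  obtain ⟨N, hN⟩ := exists_nat_gt (y / δ)
  have hNpos : (0 : ℝ) < N := (div_pos hy hδ).trans hN
  set d : ℝ := y / N with hd
  have hd0 : 0 < d := by positivity
  have hdδ : d < δ := by
    rw [div_lt_iff₀ hδ] at hN
    rw [hd, div_lt_iff₀ hNpos, mul_comm]
    exact hN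
  have hNd : N * d = y := by rw [hd]; field_simp
  have key : ∀ n : ℕ, n ≤ N → ∃ x, BlowUpMargin (momentum (u (n * d))) x (y - n * d) := by
    intro n
    induction n with
    | zero => intro _; exact ⟨x, by simpa [h0] using hm⟩
    | succ n ih =>
      intro hn
      obtain ⟨x, hx⟩ := ih (by omega)
      have hnd : (n : ℝ) * d ≤ y := by
        rw [← hNd]
        exact mul_le_mul_of_nonneg_right (by exact_mod_cast (by omega : n ≤ N)) hd0.le
      have hnd0 : 0 ≤ (n : ℝ) * d := by positivity
      obtain ⟨U, hU0, hU, hUm⟩ := hloc (u (n * d)) (hM _ ⟨hnd0, hnd⟩)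
      obtain ⟨x', hx'⟩ := hUm x _ hx d hd0.le hdδ
      have h1 : SolvesOn (Icc 0 d) U := hU.mono fun t ht =>
        ⟨by linarith [ht.1], by linarith [ht.2]⟩
      have h2 : SolvesOn (Icc 0 d) fun t => u (t + n * d) := (hs.comp_add (n * d)).mono fun t ht =>
        ⟨add_nonneg ht.1 hnd0, EReal.coe_lt_top _⟩
      have h3 : U d = u (d + n * d) :=
        h1.eqOn_Icc h2 (by rw [hU0, zero_add]) (right_mem_Icc.2 hd0.le)
      refine ⟨x', ?_⟩
      have e1 : ((n + 1 : ℕ) : ℝ) * d = d + n * d := by push_cast; ring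
      rw [e1, ← h3]
      convert hx' using 1
      ring
  obtain ⟨x', hx'⟩ := key N le_rfl
  rw [hNd, sub_self] at hx'
  exact lt_irrefl _ (hypos hx')

/-- Otherwise the norm lies below some `K` at times arbitrarily close to `τ`. The existence time `δ`
depends only on `K`, so restarting at such a `t₁ > τ - δ` continues the solution beyond `τ`, against
maximality. -/
theorem IsMaximalSolution.tendsto_norm {u₀ : Sobolev 4} {τ : ℝ} {u : ℝ → Sobolev 4}
    (h : IsMaximalSolution u₀ τ u) : Tendsto (fun t => ‖u t‖) (𝓝[<] τ) atTop := by
  classical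
  obtain ⟨hu, hmax⟩ := h
  obtain ⟨hτ, h0, hs⟩ := isSolution_iff.1 hu
  have hτ0 : 0 < τ := EReal.coe_pos.1 hτ
  rw [tendsto_atTop]
  by_contra! hcon
  obtain ⟨K, hK⟩ := hcon
  have hM : 0 ≤ ‖momentumL‖ * |K| := by positivity
  obtain ⟨δ, hδ, hloc⟩ := exists_local_solution hM
  have hev : ∀ᶠ t in 𝓝[<] τ, t ∈ Ioo (max 0 (τ - δ)) τ :=
    Ioo_mem_nhdsLT (max_lt hτ0 (by linarith))
  obtain ⟨t₁, hK1, ht₁⟩ := (hK.and_eventually hev).exists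
  have h1 : 0 < t₁ := (le_max_left _ _).trans_lt ht₁.1
  have h2 : τ - δ < t₁ := (le_max_right _ _).trans_lt ht₁.1
  have hmom : ‖momentum (u t₁)‖ ≤ ‖momentumL‖ * |K| :=
    (momentumL.le_opNorm (u t₁)).trans
      (mul_le_mul_of_nonneg_left (hK1.le.trans (le_abs_self K)) (ContinuousLinearMap.opNorm_nonneg _))
  obtain ⟨U, hU0, hU, -⟩ := hloc (u t₁) hmom
  have hUs := hU.comp_add (-t₁)
  have hagree : ∀ t ∈ Ico t₁ τ, u t = U (t + -t₁) := by
    intro t ht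
    have a1 : SolvesOn (Icc t₁ t) u :=
      hs.mono (Icc_subset_timeInterval h1.le (EReal.coe_lt_coe_iff.2 ht.2))
    have a2 : SolvesOn (Icc t₁ t) fun t => U (t + -t₁) := hUs.mono fun r hr => by
      constructor <;> linarith [hr.1, hr.2, ht.2]
    exact a1.eqOn_Icc a2 (by rw [add_neg_cancel, hU0]) (right_mem_Icc.2 ht.1)
  set u' : ℝ → Sobolev 4 := fun t => if t < τ then u t else U (t + -t₁) with hu'
  have e1 : EqOn u' u (Iio τ) := fun t ht => if_pos ht
  -- The two pieces agree on all of `(t₁, τ)`, so near `τ` the glued curve is the restarted solution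
  -- and no matching condition at `τ` arises.
  have e2 : EqOn u' (fun t => U (t + -t₁)) (Ioi t₁) := by
    intro t ht
    by_cases htτ : t < τ
    · rw [e1 htτ]; exact hagree t ⟨le_of_lt ht, htτ⟩
    · exact if_neg htτ
  refine hmax ((t₁ + δ : ℝ) : EReal) u' (EReal.coe_lt_coe_iff.2 (by linarith)) ?_ ?_
  · refine isSolution_iff.2 ⟨EReal.coe_pos.2 (by linarith), by rw [e1 hτ0, h0],
      SolvesOn.of_local fun t ht => ?_⟩
    have htδ : t < t₁ + δ := EReal.coe_lt_coe_iff.1 ht.2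
    by_cases htτ : t < τ
    · refine ⟨Iio τ, Iio_mem_nhds htτ, u, hs.mono fun r hr => ?_, e1.mono inter_subset_right⟩
      exact ⟨hr.1.1, EReal.coe_lt_coe_iff.2 hr.2⟩
    · refine ⟨Ioi t₁, Ioi_mem_nhds (ht₁.2.trans_le (not_lt.1 htτ)), _, hUs.mono fun r hr => ?_,
        e2.mono inter_subset_right⟩
      have hr1 : t₁ < r := hr.2
      have hr2 : r < t₁ + δ := EReal.coe_lt_coe_iff.1 hr.1.2
      constructor <;> linarith
  · intro t ht
    exact e1 (EReal.coe_lt_coe_iff.1 ht.2)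

theorem Rfun_false_eq {f : ℝ → ℝ} (x : ℝ) :
    Rfun false f x = Real.exp x * ∫ y in Ici x, Real.exp (-y) * f y := by
  rw [← integral_indicator measurableSet_Ici, ← integral_const_mul]
  unfold Rfun
  congr 1; ext y
  by_cases h : x ≤ y
  · simp [kern, h, ← mul_assoc, ← Real.exp_add]
    left; ring
  · simp [kern, h]

theorem exists_blowUpMargin {m : L2} {f : ℝ → ℝ} (hf : f =ᵐ[volume] m) {x : ℝ}
    (hl : 0 < ∫ y in Iic x, Real.exp y * f y) (hr : ∫ y in Ici x, Real.exp (-y) * f y < 0) :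
    ∃ y, BlowUpMargin m x y := by
  refine ⟨_, ?_, ?_, le_rfl⟩
  · rw [← Rfun_congr_ae true hf, Rfun_true_eq]
    exact mul_pos (Real.exp_pos _) hl
  · rw [← Rfun_congr_ae false hf, Rfun_false_eq, ← mul_neg]
    exact mul_pos (Real.exp_pos _) (neg_pos.2 hr)

end CHType

theorem mainTheorem6 (u₀ : CHType.Sobolev 4) (m₀ : ℝ → ℝ)
    (hm₀ : m₀ =ᵐ[volume] CHType.momentum u₀) (x₀ : ℝ) (hx₀ : m₀ x₀ = 0)
    (hleft : 0 < ∫ x in Set.Iic x₀, Real.exp x * m₀ x)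
    (hright : ∫ x in Set.Ici x₀, Real.exp (-x) * m₀ x < 0) :
    (∃ (T : EReal) (u : ℝ → CHType.Sobolev 4), CHType.IsMaximalSolution u₀ T u) ∧
      ∀ (T : EReal) (u : ℝ → CHType.Sobolev 4), CHType.IsMaximalSolution u₀ T u →
        CHType.BlowsUpInFiniteTime T u := by
  refine ⟨CHType.exists_isMaximalSolution u₀, fun T u h => ?_⟩
  obtain ⟨y, hy⟩ := CHType.exists_blowUpMargin hm₀ hleft hright
  induction T with
  | bot => exact absurd h.1.1 (by simp)
  | top => exact absurd h.1 (CHType.not_isSolution_top hy u)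
  | coe τ => exact ⟨τ, rfl, h.tendsto_norm⟩
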